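/- **Model.** For $n\in\mathbb N$ and $p,s,\alpha\in[0,1]$, the seeded correlated Erdős–Rényi model $\mathcal G(n,p;s,\alpha)$ is: $G_0\sim\mathcal G(n,p)$ on $[n]$; $G_1^*$ and $G_2$ are obtained from $G_0$ by keeping each edge with probability $s$, independently over edges and independently of each other given $G_0$; $\pi^*$ is an independent uniform permutation of $[n]$; $G_1$ is $G_1^*$ with every vertex $i$ relabelled $\pi^*(i)$; and, independently for each $i$, $\pi_0(i)=\pi^*(i)$ with probability $\alpha$ ($i$ is then a seed, $i\in I_0$) and $\pi_0(i)={?}$ otherwise. **Algorithm.** Input: graphs $G_1,G_2$ on $[n]$, $\pi_0$, $\ell\in\mathbb N$, $\eta\in\mathbb R$. Write $N^G_\ell(i)$ for the set of vertices at distance at most $\ell$ from $i$ in $G$, $\Gamma^G_1(i)$ for the set of neighbours of $i$, and $G\setminus S$ for $G$ with the vertices in $S$ removed. 1. For unseeded $u\in V(G_1)$, $v\in V(G_2)$ (that is, $u\notin\pi_0(I_0)$, $v\notin I_0$) and $i\in\Gamma_1^{G_1}(u)$, $j\in\Gamma_1^{G_2}(v)$, let $$w^{u,v}_{i,j}=\min_{x\ne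 i,\ y\ne j}\Bigl|\bigl\{k\in I_0:\ \pi_0(k)\in N^{G_1\setminus\{u,x\}}_\ell(i),\ k\in N^{G_2\setminus\{v,y\}}_\ell(j)\bigr\}\Bigr|,\qquad Z_{u,v}=\sum_{i\in\Gamma_1^{G_1}(u)}\ \sum_{j\in\Gamma_1^{G_2}(v)}\mathbf 1\{w^{u,v}_{i,j}\ge\eta\},$$ where $x$ ranges over $V(G_1)$ and $y$ over $V(G_2)$. If $Z_{u,v}\ge \frac{\log n}{\log\log n}-1$, set $\hat\pi(v)=u$. 2. Set $\hat\pi(k)=\pi_0(k)$ for every $k\in I_0$. Then, for all $u\in V(G_1)$ and $v\in V(G_2)$ that are unmatched so far, set $\hat\pi(v)=u$ if there are vertices $j_1,j_2$ already matched to each other, $\hat\pi(j_2)=j_1$, such that $u$ is adjacent to $j_1$ in $G_1$ and $v$ is adjacent to $j_2$ in $G_2$. 3. If there is a conflict (some vertex of $G_1$ or $G_2$ is matched to two vertices) or some vertex is unmatched, output an independent uniformly random permutation; otherwise output $\hat\pi$. **Theorem.** Let $\varepsilon<1/6$ be a fixed constant and let $p=p_n$, $s=s_n$, $\alpha=\alpha_n\in[0,1]$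 satisfy, for all sufficiently large $n$, $np\le n^{\varepsilon}$, $s\ge s_0$ for some constant $s_0>0$ (that is, $s=\Theta(1)$) and $\alpha\ge n^{-1+3\varepsilon}$, and moreover $nps^2-\log n\to+\infty$ as $n\to\infty$. Then the algorithm above runs in polynomial time (on a unit-cost random-access machine it takes at most $C n^{k}+C$ steps, with absolute constants $C,k$, on every input, where the numbers $\ell,\eta$ and $\log n/\log\log n-1$ and the random permutation of step 3 are supplied with the input), and, run on $(G_1,G_2,\pi_0)$ drawn from $\mathcal G(n,p;s,\alpha)$ with $$\ell=\Bigl\lfloor\frac{(1-\varepsilon)\log n}{\log(np)}\Bigr\rfloor,\qquad \eta=4^{2\ell+2}\,n^{1-2\varepsilon}\,\alpha,$$ it outputs $\hat\pi=\pi^*$ with probability $1-o(1)$ as $n\to\infty$. -/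

import Mathlib

namespace SeededMatching

open MeasureTheory ProbabilityTheory SimpleGraph

/-! ### The seeded correlated Erdős–Rényi model -/

instance permMeasurableSpace (n : ℕ) : MeasurableSpace (Equiv.Perm (Fin n)) := ⊤

/-- The independent sources of randomness: the parent graph `G₀`, two graphs of retained vertex
pairs (one for each subsampling), the set of seeds, the latent permutation, and the permutation
that the algorithm outputs on failure. -/
structure Sample (n : ℕ) where
  parent : SimpleGraph (Fin n)
  keep₁ : SimpleGraph (Fin n)
  keep₂ : SimpleGraph (Fin n)
  seedSet : Set (Fin n)
  latent : Equiv.Perm (Fin n)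
  fallback : Equiv.Perm (Fin n)

namespace Sample

variable {n : ℕ}

/-- The first subsample of the parent graph, before relabeling. -/
def G₁star (ω : Sample n) : SimpleGraph (Fin n) := ω.parent ⊓ ω.keep₁

/-- The second subsample of the parent graph. -/
def G₂ (ω : Sample n) : SimpleGraph (Fin n) := ω.parent ⊓ ω.keep₂

/-- The observed first graph: every vertex `i` of `G₁star` is relabeled as `latent i`. -/
def G₁ (ω : Sample n) : SimpleGraph (Fin n) := ω.G₁star.map ω.latent.toEmbedding

open Classical in
/-- The revealed partial matching; `none` stands for `?`. -/
noncomputable def π₀ (ω : Sample n) (i : Fin n) : Option (Fin n) :=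
  if i ∈ ω.seedSet then some (ω.latent i) else none

end Sample

/-- The joint law of the independent coordinates of a `Sample`: `G(n, p)` for the parent,
`G(n, s)` for each of the two graphs of retained pairs, an `α`-random set of seeds, and two
uniform permutations. -/
noncomputable def coordinateLaw (n : ℕ) (p s α : unitInterval) :
    Measure (SimpleGraph (Fin n) × SimpleGraph (Fin n) × SimpleGraph (Fin n) × Set (Fin n) ×
      Equiv.Perm (Fin n) × Equiv.Perm (Fin n)) :=
  (binomialRandom (Fin n) p).prod <| (binomialRandom (Fin n) s).prod <|
    (binomialRandom (Fin n) s).prod <| (setBernoulli Set.univ α).prod <|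
      (PMF.uniformOfFintype (Equiv.Perm (Fin n))).toMeasure.prod
        (PMF.uniformOfFintype (Equiv.Perm (Fin n))).toMeasure

/-- The probability of an event under the seeded model `G(n, p; s, α)`. -/
noncomputable def prob (n : ℕ) (p s α : unitInterval) (E : Sample n → Prop) : ℝ :=
  (coordinateLaw n p s α).real
    {x | E ⟨x.1, x.2.1, x.2.2.1, x.2.2.2.1, x.2.2.2.2.1, x.2.2.2.2.2⟩}

/-! ### The matching algorithm -/

/-- The input of the algorithm: the two graphs, the seeds, the tuning parameters `ℓ` and `η`, and
the random permutation that is returned when failure is declared. -/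
structure Input (n : ℕ) where
  G₁ : SimpleGraph (Fin n)
  G₂ : SimpleGraph (Fin n)
  π₀ : Fin n → Option (Fin n)
  ℓ : ℕ
  η : ℝ
  fallback : Equiv.Perm (Fin n)

/-- `N_k^G(u)`: the vertices at distance at most `k` from `u`. -/
def nbhd {V : Type*} (G : SimpleGraph V) (k : ℕ) (u : V) : Set V := {v | G.edist u v ≤ k}

/-- `G \ S`. The removed vertices stay in the vertex type as isolated vertices; neighbourhoods are
only taken around vertices outside `S`, and these do not see the removed ones. -/
def removeVerts {V : Type*} (G : SimpleGraph V) (S : Set V) : SimpleGraph V where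
  Adj a b := G.Adj a b ∧ a ∉ S ∧ b ∉ S
  symm := ⟨fun _ _ h => ⟨h.1.symm, h.2.2, h.2.1⟩⟩
  loopless := ⟨fun _ h => G.irrefl h.1⟩

namespace Input

variable {n : ℕ}

/-- The number of common seeds in the `ℓ`-neighbourhood of `i` in `G₁ \ {u, x}` and in the
`ℓ`-neighbourhood of `j` in `G₂ \ {v, y}`. -/
noncomputable def commonSeeds (I : Input n) (u v i j x y : Fin n) : ℕ :=
  Set.ncard {k | ∃ m, I.π₀ k = some m ∧ m ∈ nbhd (removeVerts I.G₁ {u, x}) I.ℓ i ∧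
    k ∈ nbhd (removeVerts I.G₂ {v, y}) I.ℓ j}

/-- `w^{u,v}_{i,j}`: the minimum of `commonSeeds` over `x ≠ i` and `y ≠ j`, so that `i` and `j`
are vertices of the graphs in which their neighbourhoods are taken. For `i` adjacent to `u` and
`j` adjacent to `v` the index set contains `(u, v)`. -/
noncomputable def w (I : Input n) (u v i j : Fin n) : ℕ :=
  ⨅ xy : {x : Fin n // x ≠ i} × {y : Fin n // y ≠ j}, I.commonSeeds u v i j xy.1 xy.2

open Classical in
/-- `Z_{u,v}`. -/
noncomputable def Z (I : Input n) (u v : Fin n) : ℕ :=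
  ∑ i ∈ Finset.univ.filter (I.G₁.Adj u), ∑ j ∈ Finset.univ.filter (I.G₂.Adj v),
    if I.η ≤ (I.w u v i j : ℝ) then 1 else 0

/-- The threshold for `Z_{u,v}`. -/
noncomputable def threshold (n : ℕ) : ℝ := Real.log n / Real.log (Real.log n) - 1

/-- The first step sets `π̂(v) = u`: both vertices are unseeded and `Z_{u,v}` is large. -/
def highMatch (I : Input n) (v u : Fin n) : Prop :=
  I.π₀ v = none ∧ (∀ k, I.π₀ k ≠ some u) ∧ threshold n ≤ (I.Z u v : ℝ)

/-- `π̂(v) = u` has been set by the first step or by the seeds. -/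
def matched (I : Input n) (v u : Fin n) : Prop := I.highMatch v u ∨ I.π₀ v = some u

/-- The last step sets `π̂(v) = u`: both vertices are unmatched so far, and they are adjacent, in
`G₂` and `G₁` respectively, to two vertices that have been matched to each other. -/
def lowMatch (I : Input n) (v u : Fin n) : Prop :=
  (∀ u', ¬ I.matched v u') ∧ (∀ v', ¬ I.matched v' u) ∧
    ∃ j₁ j₂, I.matched j₂ j₁ ∧ I.G₁.Adj u j₁ ∧ I.G₂.Adj v j₂

/-- All the assignments `π̂(v) = u` made during the algorithm. -/
def assigned (I : Input n) (v u : Fin n) : Prop := I.matched v u ∨ I.lowMatch v u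

/-- There is no conflict (no vertex receives two partners) and no unmatched vertex. -/
def Success (I : Input n) : Prop :=
  (∀ v u u', I.assigned v u → I.assigned v u' → u = u') ∧
  (∀ v v' u, I.assigned v u → I.assigned v' u → v = v') ∧
  (∀ v, ∃ u, I.assigned v u)

theorem Success.exists_perm {I : Input n} (h : I.Success) :
    ∃ π : Equiv.Perm (Fin n), ∀ v, I.assigned v (π v) := by
  choose f hf using h.2.2
  have hinj : Function.Injective f := fun a b hab => h.2.1 a b (f a) (hf a) (hab ▸ hf b)
  exact ⟨Equiv.ofBijective f (Finite.injective_iff_bijective.mp hinj), hf⟩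

open Classical in
/-- The output `π̂` of the algorithm: the permutation assembled from the assignments, or the random
permutation if failure is declared. -/
noncomputable def output (I : Input n) : Equiv.Perm (Fin n) :=
  if h : I.Success then h.exists_perm.choose else I.fallback

end Input

/-- The choice `ℓ = ⌊(1 - ε) log n / log (np)⌋`. -/
noncomputable def tunedEll (ε : ℝ) (n : ℕ) (p : ℝ) : ℕ :=
  ⌊(1 - ε) * Real.log n / Real.log (n * p)⌋₊

/-- The choice `η = 4 ^ (2ℓ + 2) n ^ (1 - 2ε) α`. -/
noncomputable def tunedEta (ε : ℝ) (n : ℕ) (p α : ℝ) : ℝ :=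
  4 ^ (2 * tunedEll ε n p + 2) * (n : ℝ) ^ (1 - 2 * ε) * α

/-- The input that the algorithm receives under the seeded model, with the tuned parameters. -/
noncomputable def observed (ε : ℝ) {n : ℕ} (p α : ℝ) (ω : Sample n) : Input n where
  G₁ := ω.G₁
  G₂ := ω.G₂
  π₀ := ω.π₀
  ℓ := tunedEll ε n p
  η := tunedEta ε n p α
  fallback := ω.fallback

/-! ### Running time

A random-access machine with arrays of natural numbers, presented as a small imperative language.
The only arithmetic operation is the successor, so that stored numbers grow by at most one per
step beyond the constants and the input. -/

/-- The memory: countably many two-dimensional arrays. A scalar is the entry `(0, 0)`. -/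
abbrev Store := ℕ → ℕ → ℕ → ℕ

/-- The memory with entry `(i, j)` of array `a` overwritten by `x`. -/
def Store.write (σ : Store) (a i j x : ℕ) : Store :=
  fun a' i' j' => if a' = a ∧ i' = i ∧ j' = j then x else σ a' i' j'

inductive Expr where
  | const (c : ℕ)
  | read (a : ℕ) (i j : Expr)
  | succ (e : Expr)

def Expr.eval (σ : Store) : Expr → ℕ
  | .const c => c
  | .read a i j => σ a (i.eval σ) (j.eval σ)
  | .succ e => e.eval σ + 1

/-- Evaluating an expression costs one step for each of its nodes. -/
def Expr.cost : Expr → ℕ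
  | .const _ => 1
  | .read _ i j => i.cost + j.cost + 1
  | .succ e => e.cost + 1

inductive Cmd where
  | skip
  /-- `a[i, j] := e` -/
  | assign (a : ℕ) (i j e : Expr)
  | seq (c d : Cmd)
  /-- `if e < f then c else d` -/
  | ifLt (e f : Expr) (c d : Cmd)
  /-- `for a[0, 0] = 0, …, e - 1 do c`, with `e` evaluated once, before the loop. -/
  | loop (a : ℕ) (e : Expr) (c : Cmd)

/-- Executing a command: the resulting memory and the number of steps. -/
def Cmd.run : Cmd → Store → Store × ℕ
  | .skip, σ => (σ, 1)
  | .assign a i j e, σ =>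
      (σ.write a (i.eval σ) (j.eval σ) (e.eval σ), i.cost + j.cost + e.cost + 1)
  | .seq c d, σ => ((d.run (c.run σ).1).1, (c.run σ).2 + (d.run (c.run σ).1).2 + 1)
  | .ifLt e f c d, σ =>
      if e.eval σ < f.eval σ then ((c.run σ).1, (c.run σ).2 + e.cost + f.cost + 1)
      else ((d.run σ).1, (d.run σ).2 + e.cost + f.cost + 1)
  | .loop a e c, σ =>
      (List.range (e.eval σ)).foldl
        (fun st k => ((c.run (st.1.write a 0 0 k)).1, st.2 + (c.run (st.1.write a 0 0 k)).2 + 1))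
        (σ, e.cost + 1)

open Classical in
/-- The adjacency matrix as an array. -/
noncomputable def encodeGraph {n : ℕ} (G : SimpleGraph (Fin n)) (i j : ℕ) : ℕ :=
  if ∃ (hi : i < n) (hj : j < n), G.Adj ⟨i, hi⟩ ⟨j, hj⟩ then 1 else 0

/-- The initial memory: `n`, the two adjacency matrices, the seeds (`0` for `none` and `m + 1` for
`some m`), `ℓ`, the two thresholds and the random permutation. The thresholds are only ever compared
with counts, so they are rounded up to natural numbers. -/
noncomputable def encode {n : ℕ} (I : Input n) : Store
  | 0, 0, 0 => n
  | 1, i, j => encodeGraph I.G₁ i j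
  | 2, i, j => encodeGraph I.G₂ i j
  | 3, i, 0 => if h : i < n then (I.π₀ ⟨i, h⟩).elim 0 (fun m => (m : ℕ) + 1) else 0
  | 4, 0, 0 => I.ℓ
  | 5, 0, 0 => ⌈I.η⌉₊
  | 6, 0, 0 => ⌈Input.threshold n⌉₊
  | 7, i, 0 => if h : i < n then (I.fallback ⟨i, h⟩ : ℕ) else 0
  | _, _, _ => 0

/-- One program computes `A` on all inputs (leaving the permutation in array `8`), within a number
of steps that is polynomial in the number `n` of vertices. -/
def RunsInPolynomialTime (A : ∀ {n : ℕ}, Input n → Equiv.Perm (Fin n)) : Prop :=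
  ∃ (P : Cmd) (C k : ℕ), ∀ (n : ℕ) (I : Input n),
    (∀ v : Fin n, (P.run (encode I)).1 8 v 0 = (A I v : ℕ)) ∧
      (P.run (encode I)).2 ≤ C * n ^ k + C

end SeededMatching

/-! Write `d = np`, `h = d^(1/8)`, and call an edge common if it survives both subsamplings; the
common edges form `G(n, ps²)`. The graphs are functions of independent labels on the vertex pairs,
and the seeds are independent of the labels. The proof therefore has a deterministic core
(`output_eq_latent`), union bounds over bad label configurations (`Pr_badGraph_le`), and Chernoff
bounds for the seeds with the graphs fixed (`Pr_badSeeds_le`).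

True pairs. A vertex is light if its common degree is at most `nps²/20`. In the parent graph, with
high probability, two distinct light vertices are never adjacent and have no common neighbour, and
small vertex sets span few edges. Hence balls of the common graph around heavy vertices, even after
deleting three vertices, grow by a factor of order `d` per step until they reach size `n^(1-3ε/2)`
(`card_ball_ge_of_sparse`). At radius `ℓ` they contain at least `2η/α` vertices, so at least `η`
seeds. Every heavy common neighbour `i` of a vertex thus contributes the pair `(i, i)` to `Z`, and
only one common neighbour can be light, so heavy vertices pass the threshold.

Wrong pairs. For `u ≠ v`, all but boundedly many pairs `(i, j)` of neighbours are separated: for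
suitable deleted vertices `x, y`, both neighbourhoods lie in one masked graph in which `i` and `j`
are further apart than an inner radius `L` (`card_not_separated_le`). Two `ℓ`-balls with such
centres meet in at most `η/(4α)` vertices, so they share fewer than `η` seeds. As the threshold
tends to infinity, wrong pairs fail the test. The intersection bound (`card_ball_inter_ball_le`,
`card_ball_inter_ball_le_of_far`) is a counting recursion: from a vertex at distance `δ` from `i`,
at most `2h` edges do not lead further away from `i`, at most `3d` lead outwards, and a path that
has left the ball can return only through the few entry edges into its sphere.

Light vertices. With high probability no vertex is isolated in the common graph; this is where `nps²
- log n → ∞` is needed. Each light vertex then has a heavy, already matched common neighbour, and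
step 2 finds the correct partner and no other.

Both random edge counts, backward edges and entry edges, are taken over sets of pairs that are
themselves random. They obey binomial tails because each set is determined without inspecting its
own pairs (`Pr_exposure_le`).

Running time. The algorithm is written as a term in a small language of counts over the vertices and
`n`-fold iterations, the latter used for exploring neighbourhoods. Terms compile to programs whose
loops all have length `n` (`Tm.computes_compile`), and such programs have polynomial cost
(`Cmd.SizeBounded.exists_cost_le`). -/

namespace SeededMatching

open Finset

/-! ### Finite product distributions -/

section ProductWeights

variable {ι X : Type*} [Fintype ι] [DecidableEq ι] [Fintype X] {w : X → ℝ}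

/-- A probability vector. -/
structure IsWeight (w : X → ℝ) : Prop where
  nonneg : ∀ x, 0 ≤ w x
  sum_eq : ∑ x, w x = 1

/-- Expectation with respect to the product over `ι` of the probability vector `w`. -/
noncomputable def Ex (w : X → ℝ) (g : (ι → X) → ℝ) : ℝ := ∑ ω, (∏ i, w (ω i)) * g ω

open Classical in
/-- Probability with respect to the product over `ι` of the probability vector `w`. -/
noncomputable def Pr (w : X → ℝ) (E : (ι → X) → Prop) : ℝ := Ex w fun ω => if E ω then 1 else 0

open Classical in
/-- The probability of `Q` under the vector `w`. -/
noncomputable def mass (w : X → ℝ) (Q : X → Prop) : ℝ := ∑ x, if Q x then w x else 0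

open Classical in
/-- The number of coordinates in `f` whose value satisfies `Q`. -/
noncomputable def cnt (Q : X → Prop) (f : Finset ι) (ω : ι → X) : ℕ := #{i ∈ f | Q (ω i)}

lemma IsWeight.mass_nonneg (hw : IsWeight w) (Q : X → Prop) : 0 ≤ mass w Q :=
  sum_nonneg fun x _ => by split_ifs; exacts [hw.nonneg x, le_rfl]

lemma IsWeight.mass_le_one (hw : IsWeight w) (Q : X → Prop) : mass w Q ≤ 1 := by
  rw [← hw.sum_eq]
  exact sum_le_sum fun x _ => by split_ifs; exacts [le_rfl, hw.nonneg x]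

lemma Ex_mono (hw : IsWeight w) {g g' : (ι → X) → ℝ} (h : ∀ ω, g ω ≤ g' ω) : Ex w g ≤ Ex w g' :=
  sum_le_sum fun ω _ => mul_le_mul_of_nonneg_left (h ω) (prod_nonneg fun _ _ => hw.nonneg _)

lemma Ex_sum {κ : Type*} (s : Finset κ) (g : κ → (ι → X) → ℝ) :
    Ex w (fun ω => ∑ a ∈ s, g a ω) = ∑ a ∈ s, Ex w (g a) := by
  unfold Ex
  rw [sum_comm]
  exact sum_congr rfl fun ω _ => mul_sum _ _ _

lemma Ex_const_mul (c : ℝ) (g : (ι → X) → ℝ) : Ex w (fun ω => c * g ω) = c * Ex w g := by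
  unfold Ex
  rw [mul_sum]
  exact sum_congr rfl fun ω _ => by ring

lemma Ex_mul_const (c : ℝ) (g : (ι → X) → ℝ) : Ex w (fun ω => g ω * c) = Ex w g * c := by
  simp_rw [mul_comm _ c]
  exact Ex_const_mul c g

lemma Ex_prod (g : ι → X → ℝ) :
    Ex w (fun ω => ∏ i, g i (ω i)) = ∏ i, ∑ x, w x * g i x := by
  rw [prod_univ_sum, Fintype.piFinset_univ]
  unfold Ex
  exact sum_congr rfl fun ω _ => by rw [prod_mul_distrib]

lemma Ex_const (hw : IsWeight w) (c : ℝ) : Ex (ι := ι) w (fun _ => c) = c := by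
  have h := Ex_prod (ι := ι) (w := w) fun _ _ => 1
  simp only [prod_const_one, mul_one, hw.sum_eq] at h
  have := Ex_const_mul (ι := ι) (w := w) c fun _ => 1
  simpa [h] using this

lemma Ex_nonneg (hw : IsWeight w) {g : (ι → X) → ℝ} (h : ∀ ω, 0 ≤ g ω) : 0 ≤ Ex w g :=
  sum_nonneg fun ω _ => mul_nonneg (prod_nonneg fun _ _ => hw.nonneg _) (h ω)

lemma Pr_nonneg (hw : IsWeight w) (E : (ι → X) → Prop) : 0 ≤ Pr w E :=
  Ex_nonneg hw fun ω => by split_ifs <;> norm_num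

lemma Pr_mono (hw : IsWeight w) {E F : (ι → X) → Prop} (h : ∀ ω, E ω → F ω) : Pr w E ≤ Pr w F :=
  Ex_mono hw fun ω => by
    by_cases hE : E ω
    · simp [hE, h ω hE]
    · simp only [hE, if_false]; split_ifs <;> norm_num

lemma Pr_le_one (hw : IsWeight w) (E : (ι → X) → Prop) : Pr w E ≤ 1 := by
  refine (Ex_mono hw fun ω => ?_).trans (Ex_const hw 1).le
  split_ifs <;> norm_num

lemma Pr_or_le (hw : IsWeight w) (E F : (ι → X) → Prop) :
    Pr w (fun ω => E ω ∨ F ω) ≤ Pr w E + Pr w F := by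
  classical
  have : Pr w E + Pr w F
      = Ex w fun ω => (if E ω then 1 else 0) + (if F ω then 1 else 0) := by
    rw [Pr, Pr, Ex, Ex, Ex, ← sum_add_distrib]
    refine sum_congr rfl fun ω _ => ?_
    rw [mul_add]
  rw [this]
  refine Ex_mono hw fun ω => ?_
  by_cases hE : E ω <;> by_cases hF : F ω <;> simp [hE, hF]

lemma Pr_exists_mem_le (hw : IsWeight w) {κ : Type*} (s : Finset κ) (E : κ → (ι → X) → Prop) :
    Pr w (fun ω => ∃ a ∈ s, E a ω) ≤ ∑ a ∈ s, Pr w (E a) := by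
  classical
  have h : ∑ a ∈ s, Pr w (E a) = Ex w (fun ω => ∑ a ∈ s, if E a ω then (1 : ℝ) else 0) := by
    rw [Ex_sum]
    exact sum_congr rfl fun a _ => by unfold Pr; congr
  rw [h]
  refine Ex_mono hw fun ω => ?_
  split_ifs with hE
  · obtain ⟨a, ha, hEa⟩ := hE
    refine le_trans ?_ (single_le_sum (f := fun a => if E a ω then (1 : ℝ) else 0)
      (fun b _ => by split_ifs <;> norm_num) ha)
    simp [hEa]
  · exact sum_nonneg fun b _ => by split_ifs <;> norm_num

lemma Pr_exists_le (hw : IsWeight w) {κ : Type*} [Fintype κ] (E : κ → (ι → X) → Prop) (B : ℝ)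
    (hB : ∀ a, Pr w (E a) ≤ B) : Pr w (fun ω => ∃ a, E a ω) ≤ Fintype.card κ * B := by
  have h := Pr_exists_mem_le hw univ E
  simp only [mem_univ, true_and] at h
  refine h.trans ((sum_le_sum fun a _ => hB a).trans ?_)
  simp

/-- Exchanging the coordinates in `f` between two independent copies. -/
def swapOn (f : Finset ι) : (ι → X) × (ι → X) ≃ (ι → X) × (ι → X) where
  toFun x := (fun i => if i ∈ f then x.2 i else x.1 i, fun i => if i ∈ f then x.1 i else x.2 i)
  invFun x := (fun i => if i ∈ f then x.2 i else x.1 i, fun i => if i ∈ f then x.1 i else x.2 i)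
  left_inv x := by
    ext i <;> by_cases hi : i ∈ f <;> simp [hi]
  right_inv x := by
    ext i <;> by_cases hi : i ∈ f <;> simp [hi]

/-- Functions of disjoint sets of coordinates are independent. -/
lemma Ex_mul_of_indep (hw : IsWeight w) (f : Finset ι) {g₁ g₂ : (ι → X) → ℝ}
    (h₁ : ∀ ω ω', (∀ i, i ∉ f → ω i = ω' i) → g₁ ω = g₁ ω')
    (h₂ : ∀ ω ω', (∀ i, i ∈ f → ω i = ω' i) → g₂ ω = g₂ ω') :
    Ex w (fun ω => g₁ ω * g₂ ω) = Ex w g₁ * Ex w g₂ := by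
  -- Take two independent copies and swap their coordinates in `f`. The total weight is unchanged,
  -- `g₁` of the first copy does not notice, and `g₂` of the second becomes `g₂` of the first. The
  -- second copy then integrates to `1`.
  have key : Ex w g₁ * Ex w g₂ = ∑ x : (ι → X) × (ι → X),
      ((∏ i, w (x.1 i)) * (g₁ x.1 * g₂ x.1)) * ∏ i, w (x.2 i) := by
    rw [Ex, Ex, sum_mul_sum, ← Finset.sum_product', univ_product_univ]
    refine Fintype.sum_equiv (swapOn f) _ _ fun x => ?_
    have e₁ : g₁ x.1 = g₁ (swapOn f x).1 := h₁ _ _ fun i hi => by simp [swapOn, hi]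
    have e₂ : g₂ x.2 = g₂ (swapOn f x).1 := h₂ _ _ fun i hi => by simp [swapOn, hi]
    have e₃ : (∏ i, w (x.1 i)) * ∏ i, w (x.2 i)
        = (∏ i, w ((swapOn f x).1 i)) * ∏ i, w ((swapOn f x).2 i) := by
      rw [← prod_mul_distrib, ← prod_mul_distrib]
      refine prod_congr rfl fun i _ => ?_
      by_cases hi : i ∈ f <;> simp [swapOn, hi, mul_comm]
    rw [← e₁, ← e₂]
    linear_combination (g₁ x.1 * g₂ x.2) * e₃
  have h1 : ∑ ω' : ι → X, ∏ i, w (ω' i) = 1 := by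
    simpa [Ex] using Ex_const (ι := ι) hw 1
  rw [key, ← univ_product_univ, Finset.sum_product]
  simp_rw [← mul_sum, h1, mul_one]
  rfl

lemma Pr_and_of_indep (hw : IsWeight w) (f : Finset ι) {E₁ E₂ : (ι → X) → Prop}
    (h₁ : ∀ ω ω', (∀ i, i ∉ f → ω i = ω' i) → (E₁ ω ↔ E₁ ω'))
    (h₂ : ∀ ω ω', (∀ i, i ∈ f → ω i = ω' i) → (E₂ ω ↔ E₂ ω')) :
    Pr w (fun ω => E₁ ω ∧ E₂ ω) = Pr w E₁ * Pr w E₂ := by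
  classical
  unfold Pr
  rw [← Ex_mul_of_indep hw f]
  · congr 1
    ext ω
    by_cases a : E₁ ω <;> by_cases b : E₂ ω <;> simp [a, b]
  · intro ω ω' h
    simp [h₁ ω ω' h]
  · intro ω ω' h
    simp [h₂ ω ω' h]

/-- The probability generating function of a binomial count. -/
lemma Ex_pow_cnt (hw : IsWeight w) (Q : X → Prop) (f : Finset ι) (z : ℝ) :
    Ex w (fun ω => z ^ cnt Q f ω) = (1 + mass w Q * (z - 1)) ^ #f := by
  classical
  have h : ∀ ω : ι → X, z ^ cnt Q f ω = ∏ i, if i ∈ f then (if Q (ω i) then z else 1) else 1 := by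
    intro ω
    rw [prod_ite_mem, univ_inter, prod_ite, prod_const, prod_const_one, mul_one]
    unfold cnt
    congr!
  simp_rw [h]
  rw [Ex_prod (fun i x => if i ∈ f then (if Q x then z else 1) else 1)]
  have h1 : ∀ i, (∑ x, w x * (if i ∈ f then (if Q x then z else 1) else 1))
      = if i ∈ f then 1 + mass w Q * (z - 1) else 1 := by
    intro i
    split_ifs
    · have : (1 : ℝ) + mass w Q * (z - 1) = ∑ x, w x + mass w Q * (z - 1) := by rw [hw.sum_eq]
      rw [this, mass, sum_mul, ← sum_add_distrib]
      refine sum_congr rfl fun x _ => ?_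
      split_ifs <;> ring
    · simp [hw.sum_eq]
  simp_rw [h1]
  rw [prod_ite_mem, univ_inter, prod_const]

lemma Ex_pow_cnt_le (hw : IsWeight w) (Q : X → Prop) (f : Finset ι) {z : ℝ} (hz : 0 ≤ z) :
    Ex w (fun ω => z ^ cnt Q f ω) ≤ Real.exp (#f * mass w Q * (z - 1)) := by
  rw [Ex_pow_cnt hw]
  have h0 : 0 ≤ 1 + mass w Q * (z - 1) := by
    nlinarith [hw.mass_nonneg Q, hw.mass_le_one Q, mul_nonneg (hw.mass_nonneg Q) hz]
  have h1 : 1 + mass w Q * (z - 1) ≤ Real.exp (mass w Q * (z - 1)) := by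
    linarith [Real.add_one_le_exp (mass w Q * (z - 1))]
  calc _ ≤ Real.exp (mass w Q * (z - 1)) ^ #f := pow_le_pow_left₀ h0 h1 _
    _ = _ := by rw [← Real.exp_nat_mul]; ring_nf

lemma Pr_le_Ex (hw : IsWeight w) {E : (ι → X) → Prop} {g : (ι → X) → ℝ} (h0 : ∀ ω, 0 ≤ g ω)
    (h : ∀ ω, E ω → 1 ≤ g ω) : Pr w E ≤ Ex w g :=
  Ex_mono hw fun ω => by split_ifs with hE; exacts [h ω hE, h0 ω]

/-- Upper tail of a binomial count. -/
lemma Pr_le_cnt_le_exp (hw : IsWeight w) (Q : X → Prop) (f : Finset ι) {z : ℝ} (hz : 1 ≤ z)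
    (t : ℝ) : Pr w (fun ω => t ≤ cnt Q f ω) ≤
      z ^ (-t) * Real.exp (#f * mass w Q * (z - 1)) := by
  have hz0 : 0 < z := by linarith
  refine (Pr_le_Ex hw (g := fun ω => z ^ (-t) * z ^ cnt Q f ω) (fun ω => by positivity) ?_).trans ?_
  · intro ω h
    rw [← Real.rpow_natCast, ← Real.rpow_add hz0]
    exact Real.one_le_rpow hz (by linarith)
  · rw [Ex_const_mul]
    exact mul_le_mul_of_nonneg_left (Ex_pow_cnt_le hw Q f hz0.le) (by positivity)

/-- Lower tail of a binomial count. -/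
lemma Pr_cnt_le_le_exp (hw : IsWeight w) (Q : X → Prop) (f : Finset ι) {z : ℝ} (hz0 : 0 < z)
    (hz : z ≤ 1) (t : ℝ) : Pr w (fun ω => (cnt Q f ω : ℝ) ≤ t) ≤
      z ^ (-t) * Real.exp (#f * mass w Q * (z - 1)) := by
  refine (Pr_le_Ex hw (g := fun ω => z ^ (-t) * z ^ cnt Q f ω) (fun ω => by positivity) ?_).trans ?_
  · intro ω h
    rw [← Real.rpow_natCast, ← Real.rpow_add hz0]
    exact Real.one_le_rpow_of_pos_of_le_one_of_nonpos hz0 hz (by linarith)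
  · rw [Ex_const_mul]
    exact mul_le_mul_of_nonneg_left (Ex_pow_cnt_le hw Q f hz0.le) (by positivity)

/-- The indicator of an empty count is `0 ^ cnt`, so this is the generating function at `z = 0`. -/
lemma Pr_cnt_eq_zero_le (hw : IsWeight w) (Q : X → Prop) (f : Finset ι) :
    Pr w (fun ω => cnt Q f ω = 0) ≤ Real.exp (-(#f * mass w Q)) := by
  refine (Pr_le_Ex hw (g := fun ω => (0 : ℝ) ^ cnt Q f ω) (fun ω => by positivity) ?_).trans ?_
  · intro ω h
    simp [h]
  · exact (Ex_pow_cnt_le hw Q f le_rfl).trans (le_of_eq (by ring_nf))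

/-- Upper tail of a binomial count, in the form `(e μ / t) ^ t`. -/
lemma Pr_le_cnt_le_rpow (hw : IsWeight w) (Q : X → Prop) (f : Finset ι) {μ t : ℝ} (hμ : 0 < μ)
    (ht : 0 < t) (hf : #f * mass w Q ≤ μ) :
    Pr w (fun ω => t ≤ cnt Q f ω) ≤ (Real.exp 1 * μ / t) ^ t := by
  -- For `t ≤ e μ` the claimed bound is at least `1`; otherwise the exponential bound is used at its
  -- optimal point `z = t / μ`.
  rcases le_or_gt t (Real.exp 1 * μ) with h | h
  · exact (Pr_le_one hw _).trans (Real.one_le_rpow ((one_le_div ht).2 h) ht.le)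
  · have hμt : μ ≤ t := by
      have : 1 ≤ Real.exp 1 := by linarith [Real.add_one_le_exp (1 : ℝ)]
      nlinarith
    have hz : 1 ≤ t / μ := (one_le_div hμ).2 hμt
    refine (Pr_le_cnt_le_exp hw Q f hz t).trans ?_
    have h2 : (#f : ℝ) * mass w Q * (t / μ - 1) ≤ t := by
      calc (#f : ℝ) * mass w Q * (t / μ - 1) ≤ μ * (t / μ - 1) :=
            mul_le_mul_of_nonneg_right hf (by linarith)
        _ = t - μ := by field_simp
        _ ≤ t := by linarith
    calc (t / μ) ^ (-t) * Real.exp (#f * mass w Q * (t / μ - 1))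
        ≤ (t / μ) ^ (-t) * Real.exp t := by gcongr
      _ = (Real.exp 1 * μ / t) ^ t := by
        rw [mul_div_assoc, Real.mul_rpow (Real.exp_pos 1).le (by positivity), Real.exp_one_rpow,
          Real.rpow_neg (by positivity), ← Real.inv_rpow (by positivity), inv_div, mul_comm]

/-- The event that all coordinates in `f` satisfy `Q`. -/
lemma Pr_forall_mem (hw : IsWeight w) (Q : X → Prop) (f : Finset ι) :
    Pr w (fun ω => ∀ i ∈ f, Q (ω i)) = mass w Q ^ #f := by
  classical
  have h : Pr w (fun ω => ∀ i ∈ f, Q (ω i))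
      = Ex w fun ω => ∏ i, if i ∈ f then (if Q (ω i) then 1 else 0) else 1 := by
    unfold Pr
    congr 1
    ext ω
    rw [prod_ite_mem, univ_inter, prod_ite_zero, prod_const_one]
    congr!
  rw [h, Ex_prod (fun i x => if i ∈ f then (if Q x then 1 else 0) else 1)]
  have h1 : ∀ i, (∑ x, w x * (if i ∈ f then (if Q x then 1 else 0) else 1))
      = if i ∈ f then mass w Q else 1 := by
    intro i
    split_ifs
    · simp [mass]
    · simp [hw.sum_eq]
  simp_rw [h1]
  rw [prod_ite_mem, univ_inter, prod_const]

/-- The probability of a product event. -/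
lemma Pr_forall (Q : ι → X → Prop) :
    Pr w (fun ω => ∀ i, Q i (ω i)) = ∏ i, mass w (Q i) := by
  classical
  have h : Pr w (fun ω => ∀ i, Q i (ω i)) = Ex w fun ω => ∏ i, if Q i (ω i) then 1 else 0 := by
    unfold Pr
    congr 1
    ext ω
    rw [prod_ite_zero, prod_const_one]
    simp
  rw [h, Ex_prod (fun i x => if Q i x then 1 else 0)]
  exact prod_congr rfl fun i _ => by simp [mass]

set_option linter.unusedSectionVars false in
lemma cnt_congr {Q : X → Prop} {f : Finset ι} {ω ω' : ι → X} (h : ∀ i ∈ f, ω i = ω' i) :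
    cnt Q f ω = cnt Q f ω' := by
  classical
  unfold cnt
  congr 1
  exact filter_congr fun i hi => by rw [h i hi]

/-- Exposure: if the random set `F` of coordinates does not depend on the coordinates that it
contains, then the count over `F` obeys the tail bound of a binomial count. -/
lemma Pr_exposure_le (hw : IsWeight w) (Q : X → Prop) (F : (ι → X) → Finset ι)
    (hF : ∀ ω ω', (∀ i, i ∉ F ω → ω i = ω' i) → F ω' = F ω) {μ t : ℝ} (hμ : 0 < μ) (ht : 0 < t) :
    Pr w (fun ω => #(F ω) * mass w Q ≤ μ ∧ t ≤ cnt Q (F ω) ω) ≤ (Real.exp 1 * μ / t) ^ t := by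
  classical
  have hB : 0 ≤ (Real.exp 1 * μ / t) ^ t := by positivity
  -- Split according to the value `f` of `F`. By `hF` the event `F = f` is decided by coordinates
  -- outside `f`, hence independent of the count over `f`, and these events have total probability
  -- `1`.
  calc Pr w (fun ω => #(F ω) * mass w Q ≤ μ ∧ t ≤ cnt Q (F ω) ω)
      ≤ Pr w (fun ω => ∃ f ∈ (univ : Finset (Finset ι)),
          F ω = f ∧ (#f * mass w Q ≤ μ ∧ t ≤ cnt Q f ω)) :=
        Pr_mono hw fun ω h => ⟨F ω, mem_univ _, rfl, h⟩
    _ ≤ ∑ f, Pr w (fun ω => F ω = f ∧ (#f * mass w Q ≤ μ ∧ t ≤ cnt Q f ω)) :=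
        Pr_exists_mem_le hw _ _
    _ ≤ ∑ f, Pr w (fun ω => F ω = f) * (Real.exp 1 * μ / t) ^ t := by
        refine sum_le_sum fun f _ => ?_
        rw [Pr_and_of_indep hw f]
        · refine mul_le_mul_of_nonneg_left ?_ (Pr_nonneg hw _)
          by_cases hf : #f * mass w Q ≤ μ
          · simp only [hf, true_and]
            exact Pr_le_cnt_le_rpow hw Q f hμ ht hf
          · simp only [hf, false_and]
            simpa [Pr, Ex] using hB
        · intro ω ω' h
          constructor
          · rintro rfl
            exact hF ω ω' h
          · rintro rfl
            exact hF ω' ω fun i hi => (h i hi).symm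
        · intro ω ω' h
          rw [cnt_congr h]
    _ = (Real.exp 1 * μ / t) ^ t := by
        rw [← sum_mul]
        have : ∑ f, Pr w (fun ω => F ω = f) = 1 := by
          unfold Pr
          rw [← Ex_sum]
          refine Eq.trans (congrArg (Ex w) ?_) (Ex_const (ι := ι) hw 1)
          ext ω
          rw [sum_eq_single (F ω)] <;> simp +contextual [eq_comm]
        rw [this, one_mul]

end ProductWeights

end SeededMatching

namespace SeededMatching

open Finset

/-! ### Neighbourhoods -/

section Nbhd

variable {V : Type*} {G G' : SimpleGraph V} {k l : ℕ} {u v a b : V}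

lemma mem_nbhd : v ∈ nbhd G k u ↔ G.edist u v ≤ k := Iff.rfl

lemma mem_nbhd_iff_walk : v ∈ nbhd G k u ↔ ∃ p : G.Walk u v, p.length ≤ k := by
  rw [mem_nbhd]
  constructor
  · intro h
    have hne : G.edist u v ≠ ⊤ := ne_top_of_le_ne_top (ENat.natCast_ne_top k) h
    obtain ⟨p, hp⟩ := SimpleGraph.exists_walk_of_edist_ne_top hne
    exact ⟨p, by rw [← hp] at h; exact_mod_cast h⟩
  · rintro ⟨p, hp⟩
    exact (SimpleGraph.edist_le p).trans (by exact_mod_cast hp)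

lemma mem_nbhd_self : u ∈ nbhd G k u := by simp [mem_nbhd]

lemma mem_nbhd_zero : v ∈ nbhd G 0 u ↔ v = u := by
  simp [mem_nbhd, eq_comm (a := v)]

lemma mem_nbhd_comm : v ∈ nbhd G k u ↔ u ∈ nbhd G k v := by
  rw [mem_nbhd, mem_nbhd, SimpleGraph.edist_comm]

lemma nbhd_mono_radius (h : k ≤ l) (hv : v ∈ nbhd G k u) : v ∈ nbhd G l u :=
  le_trans (mem_nbhd.1 hv) (by exact_mod_cast h)

lemma nbhd_mono_graph (h : G ≤ G') (hv : v ∈ nbhd G k u) : v ∈ nbhd G' k u :=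
  (SimpleGraph.edist_anti h).trans hv

lemma nbhd_trans (ha : a ∈ nbhd G k u) (hb : b ∈ nbhd G l a) : b ∈ nbhd G (k + l) u := by
  rw [mem_nbhd] at *
  push_cast
  exact SimpleGraph.edist_triangle.trans (add_le_add ha hb)

lemma mem_nbhd_one_of_adj (h : G.Adj u v) : v ∈ nbhd G 1 u := by
  rw [mem_nbhd_iff_walk]
  exact ⟨h.toWalk, by simp⟩

lemma mem_nbhd_succ : v ∈ nbhd G (k + 1) u ↔ v = u ∨ ∃ w, G.Adj u w ∧ v ∈ nbhd G k w := by
  constructor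
  · intro h
    obtain ⟨p, hp⟩ := mem_nbhd_iff_walk.1 h
    cases p with
    | nil => exact Or.inl rfl
    | cons h q =>
      right
      exact ⟨_, h, mem_nbhd_iff_walk.2 ⟨q, by simpa using hp⟩⟩
  · rintro (rfl | ⟨w, hw, hv⟩)
    · exact mem_nbhd_self
    · rw [add_comm]
      exact nbhd_trans (mem_nbhd_one_of_adj hw) hv

lemma mem_nbhd_succ' : v ∈ nbhd G (k + 1) u ↔ v = u ∨ ∃ w, w ∈ nbhd G k u ∧ G.Adj w v := by
  rw [mem_nbhd_comm, mem_nbhd_succ, eq_comm]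
  refine or_congr Iff.rfl (exists_congr fun w => ?_)
  rw [mem_nbhd_comm, and_comm, G.adj_comm]

lemma removeVerts_le (S : Set V) : removeVerts G S ≤ G := fun _ _ h => h.1

lemma removeVerts_mono (h : G ≤ G') (S : Set V) : removeVerts G S ≤ removeVerts G' S :=
  fun _ _ hab => ⟨h hab.1, hab.2⟩

lemma removeVerts_anti {S S' : Set V} (h : S ⊆ S') : removeVerts G S' ≤ removeVerts G S :=
  fun _ _ hab => ⟨hab.1, fun ha => hab.2.1 (h ha), fun hb => hab.2.2 (h hb)⟩

lemma notMem_of_mem_nbhd_removeVerts {S : Set V} (hu : u ∉ S)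
    (hv : v ∈ nbhd (removeVerts G S) k u) : v ∉ S := by
  cases k with
  | zero => rwa [mem_nbhd_zero.1 hv]
  | succ k =>
    rcases mem_nbhd_succ'.1 hv with rfl | ⟨w, -, hw⟩
    · exact hu
    · exact hw.2.2

/-- Vertices that are not further away than `a` are reached without passing through `a`. -/
lemma mem_nbhd_removeVerts_of_le {i : V} {δ : ℕ} (ha : ∀ m < δ, a ∉ nbhd G m i) (hk : k ≤ δ)
    (hba : b ≠ a) (hb : b ∈ nbhd G k i) : b ∈ nbhd (removeVerts G {a}) k i := by
  induction k generalizing b with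
  | zero => rwa [mem_nbhd_zero] at *
  | succ k ih =>
    rw [mem_nbhd_succ'] at *
    rcases hb with rfl | ⟨w, hw, hwb⟩
    · exact Or.inl rfl
    · have hwa : w ≠ a := by
        rintro rfl
        exact ha k (by omega) hw
      exact Or.inr ⟨w, ih (by omega) hwa hw, hwb, by simpa using hwa, by simpa using hba⟩

/-- A walk from outside `A` to `A` decomposes at its first entry into `A`. -/
lemma exists_first_entry {A : Set V} {z : V} (hz : z ∈ A) (hb : b ∉ A) (h : z ∈ nbhd G k b) :
    ∃ m, m < k ∧ ∃ s t, s ∈ nbhd (removeVerts G A) m b ∧ t ∈ A ∧ G.Adj s t ∧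
      z ∈ nbhd G (k - 1 - m) t := by
  induction k generalizing b with
  | zero =>
    rw [mem_nbhd_zero] at h
    exact absurd (h ▸ hz) hb
  | succ k ih =>
    rcases mem_nbhd_succ.1 h with rfl | ⟨w, hbw, hzw⟩
    · exact absurd hz hb
    by_cases hw : w ∈ A
    · exact ⟨0, by omega, b, w, mem_nbhd_self, hw, hbw, by simpa using hzw⟩
    · obtain ⟨m, hm, s, t, hs, ht, hst, hzt⟩ := ih hw hzw
      refine ⟨m + 1, by omega, s, t, ?_, ht, hst, ?_⟩
      · exact mem_nbhd_succ.2 (Or.inr ⟨w, ⟨hbw, hb, hw⟩, hs⟩)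
      · have : k + 1 - 1 - (m + 1) = k - 1 - m := by omega
        rwa [this]

end Nbhd

/-! ### Finite balls -/

set_option linter.unusedSectionVars false

section Ball

variable {V : Type*} [Fintype V] [DecidableEq V]

open Classical in
/-- The set of neighbours of a vertex. -/
noncomputable def nb (G : SimpleGraph V) (a : V) : Finset V := univ.filter (G.Adj a)

open Classical in
/-- The ball as a finite set. -/
noncomputable def ball (G : SimpleGraph V) (k : ℕ) (u : V) : Finset V :=
  univ.filter (· ∈ nbhd G k u)

open Classical in
/-- The vertices at distance exactly `k`. -/
noncomputable def sphere (G : SimpleGraph V) (k : ℕ) (u : V) : Finset V :=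
  univ.filter fun v => G.edist u v = k

open Classical in
/-- The pairs in `S × T` that are edges. -/
noncomputable def edgesBetween (G : SimpleGraph V) (S T : Finset V) : Finset (V × V) :=
  (S ×ˢ T).filter fun e => G.Adj e.1 e.2

variable {G : SimpleGraph V}

@[simp] lemma mem_nb {a b : V} : b ∈ nb G a ↔ G.Adj a b := by simp [nb]

@[simp] lemma mem_ball {k : ℕ} {u v : V} : v ∈ ball G k u ↔ v ∈ nbhd G k u := by simp [ball]

@[simp] lemma mem_sphere {k : ℕ} {u v : V} : v ∈ sphere G k u ↔ G.edist u v = k := by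
  simp [sphere]

@[simp] lemma mem_edgesBetween {S T : Finset V} {e : V × V} :
    e ∈ edgesBetween G S T ↔ (e.1 ∈ S ∧ e.2 ∈ T) ∧ G.Adj e.1 e.2 := by
  simp [edgesBetween]

lemma coe_ball {k : ℕ} {u : V} : (ball G k u : Set V) = nbhd G k u := by
  ext; simp

lemma sphere_subset_ball {k : ℕ} {u : V} : sphere G k u ⊆ ball G k u := fun v hv => by
  rw [mem_ball, mem_nbhd, mem_sphere.1 hv]

lemma ball_subset_of_le {G' : SimpleGraph V} (h : G ≤ G') (k : ℕ) (u : V) :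
    ball G k u ⊆ ball G' k u := fun v hv => by
  rw [mem_ball] at *
  exact nbhd_mono_graph h hv

lemma card_biUnion_real_le {κ : Type*} (s : Finset κ) (t : κ → Finset V) {c m : ℝ}
    (hs : (#s : ℝ) ≤ m) (hc : 0 ≤ c) (h : ∀ a ∈ s, (#(t a) : ℝ) ≤ c) :
    (#(s.biUnion t) : ℝ) ≤ m * c := by
  calc (#(s.biUnion t) : ℝ) ≤ ∑ a ∈ s, (#(t a) : ℝ) := by exact_mod_cast card_biUnion_le
    _ ≤ ∑ _a ∈ s, c := sum_le_sum h
    _ = #s * c := by simp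
    _ ≤ m * c := by gcongr

lemma card_ball_le {Δ : ℝ} (hΔ : 2 ≤ Δ) (hdeg : ∀ a, (#(nb G a) : ℝ) ≤ Δ) (k : ℕ) (u : V) :
    (#(ball G k u) : ℝ) ≤ 2 * Δ ^ k := by
  -- The `- 1` absorbs the centre: `1 + Δ (2 Δ^k - 1) ≤ 2 Δ^(k+1) - 1` because `Δ ≥ 2`.
  suffices h : (#(ball G k u) : ℝ) ≤ 2 * Δ ^ k - 1 by linarith
  induction k generalizing u with
  | zero =>
    have : ball G 0 u = {u} := by
      ext v; simp [mem_nbhd_zero]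
    simp [this]; norm_num
  | succ k ih =>
    have hsub : ball G (k + 1) u ⊆ {u} ∪ (nb G u).biUnion (ball G k) := by
      intro v hv
      rw [mem_ball, mem_nbhd_succ] at hv
      simpa using hv
    have hc : 0 ≤ 2 * Δ ^ k - 1 := by
      have : 1 ≤ Δ ^ k := one_le_pow₀ (by linarith)
      linarith
    calc (#(ball G (k + 1) u) : ℝ) ≤ #({u} ∪ (nb G u).biUnion (ball G k)) := by
          exact_mod_cast card_le_card hsub
      _ ≤ #({u} : Finset V) + #((nb G u).biUnion (ball G k)) := by exact_mod_cast card_union_le _ _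
      _ ≤ 1 + Δ * (2 * Δ ^ k - 1) := by
          gcongr
          · simp
          · exact card_biUnion_real_le _ _ (hdeg u) hc fun a _ => ih a
      _ ≤ 2 * Δ ^ (k + 1) - 1 := by rw [pow_succ]; linarith

/-- Counting recursion for the intersection of a ball around `i` with the balls around other
vertices. `U r δ` bounds the intersection with the ball of radius `r` around a vertex at distance
`δ` from `i`, and `∑ k, f k * U (r - 1 - k) ℓ` the one around a vertex outside. -/
theorem card_ball_inter_ball_le {i : V} {ℓ : ℕ} {Δ h : ℝ} {f : ℕ → ℝ} {U : ℕ → ℕ → ℝ}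
    (hdeg : ∀ a, (#(nb G a) : ℝ) ≤ Δ)
    (hback : ∀ a, a ≠ i → (#(nb G a ∩ ball (removeVerts G {a}) ℓ i) : ℝ) ≤ h)
    (hentry : ∀ b, b ∉ ball G ℓ i → ∀ m < ℓ,
      (#(edgesBetween G (ball (removeVerts G (ball G ℓ i)) m b) (sphere G ℓ i)) : ℝ) ≤ f m)
    (hh : 0 ≤ h) (hf : ∀ m, 0 ≤ f m)
    (hUpos : ∀ r δ, 0 ≤ U r δ) (hUanti : ∀ r δ, U r (δ + 1) ≤ U r δ)
    (hU0 : ∀ δ, 1 ≤ U 0 δ)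
    (hin : ∀ r δ, δ < ℓ → 1 + h * U r (δ - 1) + Δ * U r (δ + 1) ≤ U (r + 1) δ)
    (hT : ∀ r, r < ℓ →
      1 + h * U r (ℓ - 1) + Δ * (∑ m ∈ range r, f m * U (r - 1 - m) ℓ) ≤ U (r + 1) ℓ) :
    (∀ r ≤ ℓ, ∀ δ ≤ ℓ, ∀ a, G.edist i a = δ → (#(ball G ℓ i ∩ ball G r a) : ℝ) ≤ U r δ) ∧
    (∀ r ≤ ℓ, ∀ b, b ∉ ball G ℓ i →
      (#(ball G ℓ i ∩ ball G r b) : ℝ) ≤ ∑ m ∈ range r, f m * U (r - 1 - m) ℓ) := by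
  set A := ball G ℓ i with hA
  have hAmem : ∀ v, v ∈ A ↔ G.edist i v ≤ ℓ := fun v => by rw [hA, mem_ball, mem_nbhd]
  have hanti' : ∀ r δ δ', δ' ≤ δ → U r δ ≤ U r δ' := fun r δ δ' h =>
    antitone_nat_of_succ_le (hUanti r) h
  -- bound outside, from the bounds on the sphere for smaller radii
  have hout : ∀ r ≤ ℓ, (∀ r' < r, ∀ a, G.edist i a = ℓ → (#(A ∩ ball G r' a) : ℝ) ≤ U r' ℓ) →
      ∀ b, b ∉ A → (#(A ∩ ball G r b) : ℝ) ≤ ∑ m ∈ range r, f m * U (r - 1 - m) ℓ := by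
    intro r hr hT' b hb
    -- Cut a path from `b` to `z` at its first entry into `A`: `m` steps in the complement, one
    -- entry edge, at most `r - 1 - m` further steps. The entry point lies exactly on the sphere,
    -- since otherwise its predecessor would already belong to `A`.
    have hsub : A ∩ ball G r b ⊆ (range r).biUnion fun m =>
        (edgesBetween G (ball (removeVerts G A) m b) (sphere G ℓ i)).biUnion fun e =>
          A ∩ ball G (r - 1 - m) e.2 := by
      intro z hz
      rw [mem_inter] at hz
      obtain ⟨m, hm, s, t, hs, ht, hst, hzt⟩ :=
        exists_first_entry (A := (A : Set V)) (mem_coe.2 hz.1) (by exact_mod_cast hb)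
          (mem_ball.1 hz.2)
      have hsA : s ∉ A := by
        have := notMem_of_mem_nbhd_removeVerts (by exact_mod_cast hb) hs
        exact_mod_cast this
      have htT : G.edist i t = ℓ := by
        refine le_antisymm ((hAmem t).1 (by exact_mod_cast ht)) ?_
        by_contra hlt
        rw [not_le] at hlt
        apply hsA
        rw [hAmem]
        calc G.edist i s ≤ G.edist i t + G.edist t s := SimpleGraph.edist_triangle
          _ ≤ G.edist i t + 1 := by
            gcongr
            exact_mod_cast mem_nbhd_one_of_adj hst.symm
          _ ≤ ℓ := Order.add_one_le_of_lt hlt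
      rw [mem_biUnion]
      refine ⟨m, mem_range.2 hm, mem_biUnion.2 ⟨(s, t), ?_, ?_⟩⟩
      · rw [mem_edgesBetween]
        exact ⟨⟨mem_ball.2 hs, mem_sphere.2 htT⟩, hst⟩
      · rw [mem_inter]
        exact ⟨hz.1, mem_ball.2 hzt⟩
    calc (#(A ∩ ball G r b) : ℝ) ≤ _ := Nat.cast_le.2 (card_le_card hsub)
      _ ≤ ∑ m ∈ range r, (#((edgesBetween G (ball (removeVerts G A) m b) (sphere G ℓ i)).biUnion
          fun e => A ∩ ball G (r - 1 - m) e.2) : ℝ) := by exact_mod_cast card_biUnion_le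
      _ ≤ _ := by
        refine sum_le_sum fun m hm => ?_
        rw [mem_range] at hm
        refine card_biUnion_real_le _ _ (hentry b hb m (by omega)) (hUpos _ _) fun e he => ?_
        exact hT' _ (by omega) _ (mem_sphere.1 (mem_edgesBetween.1 he).1.2)
  have main : ∀ r ≤ ℓ, ∀ δ ≤ ℓ, ∀ a, G.edist i a = δ → (#(A ∩ ball G r a) : ℝ) ≤ U r δ := by
    intro r
    induction r using Nat.strong_induction_on with
    | _ r ih =>
    intro hr δ hδ a ha
    rcases r with _ | r
    · refine le_trans ?_ (hU0 δ)
      have : A ∩ ball G 0 a ⊆ {a} := by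
        intro z hz
        simpa using mem_nbhd_zero.1 (mem_ball.1 (mem_inter.1 hz).2)
      exact_mod_cast card_le_card this
    have hstep : ∀ b, G.Adj a b → G.edist i b ≤ (δ + 1 : ℕ) ∧ (δ : ℕ∞) ≤ G.edist i b + 1 := by
      intro b hab
      have h1 : G.edist a b ≤ 1 := by exact_mod_cast mem_nbhd_one_of_adj hab
      constructor
      · push_cast
        rw [← ha]
        exact SimpleGraph.edist_triangle.trans (by gcongr)
      · rw [← ha]
        refine SimpleGraph.edist_triangle.trans (b := G.edist i b + G.edist b a) ?_
        rw [SimpleGraph.edist_comm (u := b)]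
        gcongr
    classical
    -- Neighbours of `a` that are no further from `i` than `a` is can be reached from `i` without
    -- using `a`, so `hback` counts them. All other neighbours are at level `δ + 1` exactly.
    set N₁ := (nb G a).filter fun b => G.edist i b ≤ δ with hN₁
    set N₂ := (nb G a).filter fun b => ¬ G.edist i b ≤ δ with hN₂
    have hsub : A ∩ ball G (r + 1) a ⊆
        {a} ∪ (N₁.biUnion fun b => A ∩ ball G r b) ∪ (N₂.biUnion fun b => A ∩ ball G r b) := by
      intro z hz
      rw [mem_inter, mem_ball (u := a), mem_nbhd_succ] at hz
      rcases hz with ⟨hzA, rfl | ⟨b, hab, hzb⟩⟩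
      · simp
      · by_cases hb : G.edist i b ≤ δ
        · simp only [mem_union, mem_biUnion]
          left; right
          exact ⟨b, by simp [hN₁, hab, hb], mem_inter.2 ⟨hzA, mem_ball.2 hzb⟩⟩
        · simp only [mem_union, mem_biUnion]
          right
          exact ⟨b, by rw [hN₂, mem_filter]; exact ⟨by simpa using hab, hb⟩, mem_inter.2 ⟨hzA, mem_ball.2 hzb⟩⟩
    have hN₁card : (#N₁ : ℝ) ≤ h := by
      by_cases hai : a = i
      · have : N₁ = ∅ := by
          have hδ0 : (δ : ℕ∞) = 0 := by
            rw [← ha, hai]; simp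
          rw [hN₁, filter_eq_empty_iff]
          intro b hb hle
          rw [hδ0, nonpos_iff_eq_zero, SimpleGraph.edist_eq_zero_iff] at hle
          rw [mem_nb, hai, hle] at hb
          exact G.irrefl hb
        simpa [this] using hh
      · refine le_trans ?_ (hback a hai)
        norm_cast
        refine card_le_card fun b hb => ?_
        rw [hN₁, mem_filter] at hb
        rw [mem_inter, mem_ball]
        refine ⟨hb.1, nbhd_mono_radius hδ (mem_nbhd_removeVerts_of_le (δ := δ) ?_ le_rfl ?_ hb.2)⟩
        · intro m hm hmem
          rw [mem_nbhd, ha] at hmem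
          have : δ ≤ m := by exact_mod_cast hmem
          omega
        · rintro rfl
          exact G.irrefl (mem_nb.1 hb.1)
    have hB₁ : (#(N₁.biUnion fun b => A ∩ ball G r b) : ℝ) ≤ h * U r (δ - 1) := by
      refine card_biUnion_real_le _ _ hN₁card (hUpos _ _) fun b hb => ?_
      rw [hN₁, mem_filter, mem_nb] at hb
      obtain ⟨δ', hδ'⟩ := ENat.ne_top_iff_exists.1 (ne_top_of_le_ne_top (ENat.natCast_ne_top δ) hb.2)
      have h2 := (hstep b hb.1).2
      have h3 := hb.2
      rw [← hδ'] at h2 h3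
      have h2' : δ ≤ δ' + 1 := by exact_mod_cast h2
      have h3' : δ' ≤ δ := by exact_mod_cast h3
      exact (ih r (by omega) (by omega) δ' (by omega) b hδ'.symm).trans
        (hanti' _ _ _ (by omega))
    have hN₂card : (#N₂ : ℝ) ≤ Δ :=
      le_trans (by exact_mod_cast card_le_card (filter_subset _ _)) (hdeg a)
    have hcard : (#(A ∩ ball G (r + 1) a) : ℝ) ≤ 1 + h * U r (δ - 1)
        + #(N₂.biUnion fun b => A ∩ ball G r b) := by
      calc (#(A ∩ ball G (r + 1) a) : ℝ) ≤ _ := Nat.cast_le.2 (card_le_card hsub)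
        _ ≤ (#({a} ∪ (N₁.biUnion fun b => A ∩ ball G r b)) : ℝ)
            + #(N₂.biUnion fun b => A ∩ ball G r b) := by exact_mod_cast card_union_le _ _
        _ ≤ (#({a} : Finset V) : ℝ) + #(N₁.biUnion fun b => A ∩ ball G r b)
            + #(N₂.biUnion fun b => A ∩ ball G r b) := by
          gcongr; exact_mod_cast card_union_le _ _
        _ ≤ _ := by
          gcongr
          simp
    have hlev : ∀ b ∈ N₂, G.edist i b = (δ + 1 : ℕ) := by
      intro b hb
      rw [hN₂, mem_filter, mem_nb, not_le] at hb
      refine le_antisymm (hstep b hb.1).1 ?_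
      push_cast
      exact Order.add_one_le_of_lt hb.2
    -- Inside the sphere the outward neighbours are still in `A`, and `hin` closes the step. On the
    -- sphere they lie outside `A`, and the excursion bound `hout` feeds `hT`, using only smaller
    -- radii on the sphere.
    rcases hδ.lt_or_eq with hlt | rfl
    · refine hcard.trans (le_trans ?_ (hin r δ hlt))
      gcongr
      exact card_biUnion_real_le _ _ hN₂card (hUpos _ _) fun b hb =>
        ih r (by omega) (by omega) _ hlt b (hlev b hb)
    · refine hcard.trans (le_trans ?_ (hT r (by omega)))
      gcongr
      refine card_biUnion_real_le _ _ hN₂card ?_ fun b hb => ?_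
      · refine sum_nonneg fun m _ => ?_
        exact mul_nonneg (hf m) (hUpos _ _)
      · refine hout r (by omega) (fun r' hr' a' ha' => ih r' (by omega) (by omega) δ le_rfl a' ha')
          b ?_
        rw [hAmem, hlev b hb, not_le]
        exact_mod_cast Nat.lt_succ_self δ
  exact ⟨main, fun r hr b hb => hout r hr
    (fun r' hr' a ha => main r' (by omega) ℓ le_rfl a ha) b hb⟩

end Ball

end SeededMatching

/-! ### Solving the recursion for intersections of distant balls -/

namespace SeededMatching

open Finset

/-- The sum times `y - x` telescopes to `y^r - x^r`, and `y - x ≥ y/2`. -/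
lemma geom_sum₂_le {x y : ℝ} (hx : 0 ≤ x) (hxy : 2 * x ≤ y) (hy : 0 < y) (r : ℕ) :
    ∑ m ∈ range r, x ^ m * y ^ (r - 1 - m) ≤ 2 * y ^ r / y := by
  have h := geom_sum₂_mul x y r
  rw [le_div_iff₀ hy]
  have hS : 0 ≤ ∑ m ∈ range r, x ^ m * y ^ (r - 1 - m) :=
    sum_nonneg fun m _ => by positivity
  have hxr : 0 ≤ x ^ r := by positivity
  nlinarith

lemma geom_sum₂_le_of_le {x y : ℝ} (hx : 0 ≤ x) (hxy : x ≤ y) (r : ℕ) :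
    ∑ m ∈ range r, x ^ (m + 1) * y ^ (r - 1 - m) ≤ r * y ^ r := by
  calc ∑ m ∈ range r, x ^ (m + 1) * y ^ (r - 1 - m) ≤ ∑ m ∈ range r, y ^ r := by
        refine sum_le_sum fun m hm => ?_
        rw [mem_range] at hm
        calc x ^ (m + 1) * y ^ (r - 1 - m) ≤ y ^ (m + 1) * y ^ (r - 1 - m) := by
              have : 0 ≤ y := hx.trans hxy
              gcongr
          _ = y ^ r := by rw [← pow_add]; congr 1; omega
    _ = r * y ^ r := by simp

/-- The contribution of the excursions outside the ball. -/
lemma sum_excursion_le {h B : ℝ} {ℓ r : ℕ} (hh : 2 ≤ h) (hB : 0 ≤ B) (hBℓ : ℓ * B ≤ 1 / 8)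
    (hr : r ≤ ℓ) :
    ∑ m ∈ range r, (h ^ (m + 1) + B * (3 * h ^ 8) ^ (m + 1)) *
      ((12 * h ^ 5) ^ (r - 1 - m) + 4 * B * (3 * h ^ 8 + 2 * h) ^ (r - 1 - m)) ≤
      (12 * h ^ 5) ^ r / (6 * h ^ 4) +
        4 * B * (3 * h ^ 8 + 2 * h) ^ r * (5 / 8 + 2 * h / (3 * h ^ 8)) := by
  have h0 : 0 < h := by linarith
  set β := 12 * h ^ 5 with hβ
  set Δ := 3 * h ^ 8 with hΔ
  set lam := Δ + 2 * h with hlam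
  have hβ0 : 0 < β := by positivity
  have hΔ0 : 0 < Δ := by positivity
  have hlam0 : 0 < lam := by positivity
  have hΔlam : Δ ≤ lam := by linarith
  have h3 : 8 ≤ h ^ 3 := by nlinarith [pow_le_pow_left₀ (by norm_num) hh 3]
  have h4 : 16 ≤ h ^ 4 := by nlinarith [pow_le_pow_left₀ (by norm_num) hh 4]
  have h7 : 128 ≤ h ^ 7 := by nlinarith [pow_le_pow_left₀ (by norm_num) hh 7]
  have e1 : 2 * h ≤ β := by rw [hβ]; nlinarith
  have e2 : 2 * β ≤ Δ := by
    have : h ^ 8 = h ^ 3 * h ^ 5 := by ring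
    have h5 : 0 < h ^ 5 := by positivity
    rw [hβ, hΔ, this]; nlinarith
  have e3 : 2 * h ≤ lam := by linarith
  have s1 := geom_sum₂_le h0.le e1 hβ0 r
  have s2 := geom_sum₂_le h0.le e3 hlam0 r
  have s3 := geom_sum₂_le hβ0.le e2 hΔ0 r
  have s4 := geom_sum₂_le_of_le hΔ0.le hΔlam r
  have s3' : ∑ m ∈ range r, Δ ^ m * β ^ (r - 1 - m) ≤ 2 * Δ ^ r / Δ := by
    refine le_of_eq_of_le ?_ s3
    rw [← sum_range_reflect]
    refine sum_congr rfl fun m hm => ?_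
    rw [mem_range] at hm
    rw [mul_comm]
    congr 2
    omega
  -- Four convolutions of geometric sequences. In the first three the bases differ by a factor of at
  -- least `2`, so each sum is of the order of its largest term. In the last, `Δ` and `lam` are
  -- nearly equal and the sum costs a factor `r`, which `ℓ B ≤ 1/8` pays for.
  have hsplit : ∑ m ∈ range r, (h ^ (m + 1) + B * Δ ^ (m + 1)) *
      (β ^ (r - 1 - m) + 4 * B * lam ^ (r - 1 - m)) =
      h * (∑ m ∈ range r, h ^ m * β ^ (r - 1 - m))
      + 4 * B * h * (∑ m ∈ range r, h ^ m * lam ^ (r - 1 - m))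
      + B * Δ * (∑ m ∈ range r, Δ ^ m * β ^ (r - 1 - m))
      + 4 * B * B * (∑ m ∈ range r, Δ ^ (m + 1) * lam ^ (r - 1 - m)) := by
    simp only [mul_sum, ← sum_add_distrib]
    refine sum_congr rfl fun m _ => ?_
    ring
  rw [hsplit]
  have t1 : h * (∑ m ∈ range r, h ^ m * β ^ (r - 1 - m)) ≤ β ^ r / (6 * h ^ 4) := by
    calc _ ≤ h * (2 * β ^ r / β) := by gcongr
      _ = β ^ r / (6 * h ^ 4) := by
        have : β = 12 * h ^ 5 := hβ
        generalize β ^ r = y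
        rw [this]; field_simp; ring
  have t2 : 4 * B * h * (∑ m ∈ range r, h ^ m * lam ^ (r - 1 - m))
      ≤ 4 * B * lam ^ r * (2 * h / Δ) := by
    calc _ ≤ 4 * B * h * (2 * lam ^ r / lam) := by gcongr
      _ ≤ 4 * B * h * (2 * lam ^ r / Δ) := by gcongr
      _ = _ := by ring
  have t3 : B * Δ * (∑ m ∈ range r, Δ ^ m * β ^ (r - 1 - m)) ≤ 4 * B * lam ^ r * (1 / 2) := by
    calc _ ≤ B * Δ * (2 * Δ ^ r / Δ) := by gcongr
      _ = 2 * B * Δ ^ r := by field_simp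
      _ ≤ 2 * B * lam ^ r := by gcongr
      _ = _ := by ring
  have t4 : 4 * B * B * (∑ m ∈ range r, Δ ^ (m + 1) * lam ^ (r - 1 - m))
      ≤ 4 * B * lam ^ r * (1 / 8) := by
    calc _ ≤ 4 * B * B * (r * lam ^ r) := by gcongr
      _ = 4 * B * lam ^ r * (r * B) := by ring
      _ ≤ 4 * B * lam ^ r * (ℓ * B) := by gcongr
      _ ≤ 4 * B * lam ^ r * (1 / 8) := by gcongr
  linarith

section

variable {V : Type*} [Fintype V] [DecidableEq V] {G : SimpleGraph V}

/-- Two balls with distant centres have a small intersection. -/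
theorem card_ball_inter_ball_le_of_far {i j : V} {ℓ L : ℕ} {h B : ℝ} (hℓ : 1 ≤ ℓ)
    (hh : 2 ≤ h) (hB : 0 ≤ B) (hBℓ : ℓ * B ≤ 1 / 8)
    (hdeg : ∀ a, (#(nb G a) : ℝ) ≤ 3 * h ^ 8)
    (hback : ∀ a, a ≠ i → (#(nb G a ∩ ball (removeVerts G {a}) ℓ i) : ℝ) ≤ 2 * h)
    (hentry : ∀ b, b ∉ ball G ℓ i → ∀ m < ℓ,
      (#(edgesBetween G (ball (removeVerts G (ball G ℓ i)) m b) (sphere G ℓ i)) : ℝ) ≤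
        h ^ (m + 1) + B * (3 * h ^ 8) ^ (m + 1))
    (hfar : (L : ℕ∞) ≤ G.edist i j) :
    (#(ball G ℓ i ∩ ball G ℓ j) : ℝ) ≤
      (12 * h ^ 5) ^ ℓ * (h ^ 3) ^ (ℓ - L) + 4 * B * (3 * h ^ 8 + 2 * h) ^ ℓ := by
  have h0 : 0 < h := by linarith
  have h1 : 1 ≤ h := by linarith
  have h7 : 128 ≤ h ^ 7 := by nlinarith [pow_le_pow_left₀ (by norm_num) hh 7]
  have hβ1 : 1 ≤ 12 * h ^ 5 := by nlinarith [one_le_pow₀ h1 (n := 5)]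
  have hγ1 : 1 ≤ h ^ 3 := one_le_pow₀ h1
  have hq : 2 * h / (3 * h ^ 8) ≤ 1 / 8 := by
    rw [div_le_div_iff₀ (by positivity) (by norm_num)]
    nlinarith
  set lam := 3 * h ^ 8 + 2 * h with hlam
  have hlam0 : 0 < lam := by positivity
  -- The exponents `5` and `3` balance the recursion: a backward step has `2h` choices and gains
  -- `h^3`, which stays below `h^5`; an outward step has `3h^8` choices and loses `h^3`, which gives
  -- `3h^5`. The second summand does not depend on `δ`. It is the bulk contribution, proportional to
  -- `B`, and grows by `3h^8 + 2h` per step.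
  let U : ℕ → ℕ → ℝ := fun r δ => (12 * h ^ 5) ^ r * (h ^ 3) ^ (ℓ - δ) + 4 * B * lam ^ r
  have hUl : ∀ r, U r ℓ = (12 * h ^ 5) ^ r + 4 * B * lam ^ r := fun r => by simp [U]
  obtain ⟨hI, hO⟩ := card_ball_inter_ball_le (G := G) (i := i) (ℓ := ℓ) (U := U) hdeg hback hentry
    (by positivity) (fun m => by positivity) (fun r δ => by positivity)
    (fun r δ => by
      have : (h ^ 3) ^ (ℓ - (δ + 1)) ≤ (h ^ 3) ^ (ℓ - δ) := pow_le_pow_right₀ hγ1 (by omega)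
      simp only [U]
      gcongr)
    (fun δ => by
      have : 1 ≤ (h ^ 3) ^ (ℓ - δ) := one_le_pow₀ hγ1
      have : 0 ≤ 4 * B := by positivity
      simp only [U, pow_zero, one_mul, mul_one]
      linarith)
    (fun r δ hδ => by
      have g1 : (h ^ 3) ^ (ℓ - δ) = (h ^ 3) ^ (ℓ - (δ + 1)) * h ^ 3 := by
        rw [← pow_succ]; congr 1; omega
      -- Two levels apart, hence the factor `h^6`. At `δ = 0` the subtraction is truncated and the
      -- inequality has slack.
      have g2 : (h ^ 3) ^ (ℓ - (δ - 1)) ≤ (h ^ 3) ^ (ℓ - (δ + 1)) * h ^ 6 := by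
        calc (h ^ 3) ^ (ℓ - (δ - 1)) ≤ (h ^ 3) ^ (ℓ - (δ + 1) + 2) :=
              pow_le_pow_right₀ hγ1 (by omega)
          _ = _ := by rw [pow_add]; ring
      simp only [U]
      rw [g1, pow_succ (12 * h ^ 5) r, pow_succ lam r]
      have hg : 1 ≤ (h ^ 3) ^ (ℓ - (δ + 1)) := one_le_pow₀ hγ1
      have hb : 1 ≤ (12 * h ^ 5) ^ r := one_le_pow₀ hβ1
      generalize (h ^ 3) ^ (ℓ - (δ - 1)) = g' at *
      generalize (h ^ 3) ^ (ℓ - (δ + 1)) = g at *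
      generalize (12 * h ^ 5) ^ r = b at *
      have hτ : 0 ≤ 4 * B * lam ^ r := by positivity
      have hbg : 1 ≤ b * g := one_le_mul_of_one_le_of_one_le hb hg
      have hb0 : 0 ≤ b := by linarith
      have a1 : 2 * h * (b * g') ≤ 2 * h * (b * (g * h ^ 6)) := by gcongr
      have h8 : 1 ≤ h ^ 8 := one_le_pow₀ h1
      have a2 : h ^ 7 ≤ h ^ 8 := pow_le_pow_right₀ h1 (by norm_num)
      have a3 : 1 ≤ (b * g) * h ^ 8 := one_le_mul_of_one_le_of_one_le hbg h8
      have a4 : (b * g) * h ^ 7 ≤ (b * g) * h ^ 8 := by gcongr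
      have e : 4 * B * (lam ^ r * lam) = (4 * B * lam ^ r) * (3 * h ^ 8 + 2 * h) := by
        rw [hlam]; ring
      rw [e]
      nlinarith)
    (fun r hr => by
      simp only [hUl]
      have hex := sum_excursion_le hh hB hBℓ hr.le
      simp only [← hlam] at hex
      have hUl' : U r (ℓ - 1) = (12 * h ^ 5) ^ r * h ^ 3 + 4 * B * lam ^ r := by
        have : ℓ - (ℓ - 1) = 1 := by omega
        simp [U, this]
      rw [hUl', pow_succ (12 * h ^ 5) r, pow_succ lam r]
      have hb : 1 ≤ (12 * h ^ 5) ^ r := one_le_pow₀ hβ1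
      generalize (12 * h ^ 5) ^ r = b at *
      have hτ : 0 ≤ 4 * B * lam ^ r := by positivity
      have e : 4 * B * (lam ^ r * lam) = (4 * B * lam ^ r) * (3 * h ^ 8 + 2 * h) := by
        rw [hlam]; ring
      rw [e]
      generalize 4 * B * lam ^ r = y at *
      refine (add_le_add le_rfl (mul_le_mul_of_nonneg_left hex (by positivity))).trans ?_
      have e2 : 3 * h ^ 8 * (b / (6 * h ^ 4)) = b * h ^ 4 / 2 := by field_simp; ring
      have e3 : 3 * h ^ 8 * (2 * h / (3 * h ^ 8)) = 2 * h := by field_simp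
      have e4 : 3 * h ^ 8 * (b / (6 * h ^ 4) + y * (5 / 8 + 2 * h / (3 * h ^ 8)))
          = b * h ^ 4 / 2 + y * (15 / 8 * h ^ 8 + 2 * h) := by
        rw [mul_add, e2]; linear_combination y * e3
      rw [e4]
      have f1 : 1 ≤ h ^ 5 := one_le_pow₀ h1
      have f2 : h ^ 4 ≤ h ^ 5 := pow_le_pow_right₀ h1 (by norm_num)
      have f3 : 1 ≤ b * h ^ 5 := one_le_mul_of_one_le_of_one_le hb f1
      have f4 : b * h ^ 4 ≤ b * h ^ 5 := by gcongr
      have f5 : 2 * h ≤ 9 / 8 * h ^ 8 := by nlinarith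
      have f6 : y * (2 * h) ≤ y * (9 / 8 * h ^ 8) := by gcongr
      nlinarith)
  by_cases hj : j ∈ ball G ℓ i
  · have hj' : G.edist i j ≤ ℓ := by rwa [mem_ball, mem_nbhd] at hj
    obtain ⟨δ, hδ⟩ := ENat.ne_top_iff_exists.1 (ne_top_of_le_ne_top (ENat.natCast_ne_top ℓ) hj')
    rw [← hδ] at hj' hfar
    have hj'' : δ ≤ ℓ := by exact_mod_cast hj'
    have hfar' : L ≤ δ := by exact_mod_cast hfar
    refine (hI ℓ le_rfl δ hj'' j hδ.symm).trans ?_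
    simp only [U]
    gcongr
  · refine (hO ℓ le_rfl j hj).trans ?_
    simp only [hUl]
    refine (sum_excursion_le hh hB hBℓ le_rfl).trans ?_
    have hb : 0 ≤ (12 * h ^ 5) ^ ℓ := by positivity
    have h4 : 1 ≤ 6 * h ^ 4 := by nlinarith [one_le_pow₀ h1 (n := 4)]
    have hg : 1 ≤ (h ^ 3) ^ (ℓ - L) := one_le_pow₀ hγ1
    refine add_le_add ?_ ?_
    · calc (12 * h ^ 5) ^ ℓ / (6 * h ^ 4) ≤ (12 * h ^ 5) ^ ℓ := div_le_self hb h4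
        _ ≤ _ := le_mul_of_one_le_right hb hg
    · exact mul_le_of_le_one_right (by positivity) (by linarith)

end

end SeededMatching

/-! ### Growth of balls in sparse graphs -/

namespace SeededMatching

open Finset

section

variable {V : Type*} [Fintype V] [DecidableEq V] {G : SimpleGraph V}

lemma ball_mono {k l : ℕ} (h : k ≤ l) (u : V) : ball G k u ⊆ ball G l u := fun v hv => by
  rw [mem_ball] at *
  exact nbhd_mono_radius h hv

lemma ball_zero (u : V) : ball G 0 u = {u} := by
  ext v; simp [mem_nbhd_zero]

/-- In a locally sparse graph whose vertices of small degree are scattered, balls grow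
geometrically until they reach the size `M` up to which sparsity is known. -/
theorem card_ball_ge_of_sparse {i : V} {Lt : Finset V} {M K D : ℝ} (hK : 0 < K)
    (hDK : 8 * K ≤ D)
    (hsparse : ∀ W : Finset V, (#W : ℝ) ≤ M → (#(edgesBetween G W W) : ℝ) ≤ 2 * K * #W)
    (hi : i ∉ Lt)
    (hheavy : ∀ k, ∀ a ∈ ball G k i, a ∉ Lt → D ≤ #(nb G a))
    (hlight : ∀ a, #(nb G a ∩ Lt) ≤ 1) (k : ℕ) :
    M ≤ #(ball G k i) ∨ (D / (4 * K)) ^ k ≤ #(ball G k i) := by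
  -- The induction also carries that at least half of the ball is not light. These vertices send at
  -- least `D/2` edges per ball vertex into the next ball, which spans at most `2K` ordered edges
  -- per vertex. So the ball grows by the factor `D/(4K) ≥ 2`.
  suffices h : M ≤ #(ball G k i) ∨ ((D / (4 * K)) ^ k ≤ #(ball G k i) ∧
      (#(ball G k i) : ℝ) ≤ 2 * #(ball G k i \ Lt)) from h.imp_right And.left
  have hD2 : 2 ≤ D / (4 * K) := by
    rw [le_div_iff₀ (by positivity)]; linarith
  induction k with
  | zero =>
    right
    have : ({i} : Finset V) \ Lt = {i} := by
      rw [Finset.sdiff_eq_self_iff_disjoint]; simpa using hi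
    rw [ball_zero, this]
    simp
  | succ k ih =>
    rcases le_or_gt M #(ball G (k + 1) i) with hM | hM
    · exact Or.inl hM
    right
    have hmono : (#(ball G k i) : ℝ) ≤ #(ball G (k + 1) i) :=
      Nat.cast_le.2 (card_le_card (ball_mono (Nat.le_succ k) i))
    rcases ih with ih | ⟨ih1, ih2⟩
    · linarith
    have hedge : D * #(ball G k i \ Lt) ≤ #(edgesBetween G (ball G (k + 1) i) (ball G (k + 1) i)) := by
      have hsub : (ball G k i \ Lt).sigma (fun a => nb G a) ⊆
          (edgesBetween G (ball G (k + 1) i) (ball G (k + 1) i)).map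
            (Equiv.sigmaEquivProd V V).symm.toEmbedding := by
        rintro ⟨a, b⟩ hab
        rw [mem_sigma, mem_sdiff, mem_nb] at hab
        rw [mem_map_equiv]
        simp only [Equiv.symm_symm, Equiv.sigmaEquivProd_apply, mem_edgesBetween]
        refine ⟨⟨ball_mono (Nat.le_succ k) i hab.1.1, ?_⟩, hab.2⟩
        rw [mem_ball, mem_nbhd_succ']
        exact Or.inr ⟨a, mem_ball.1 hab.1.1, hab.2⟩
      have hc := card_le_card hsub
      rw [card_map, card_sigma] at hc
      calc D * #(ball G k i \ Lt) = ∑ _a ∈ ball G k i \ Lt, D := by simp [mul_comm]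
        _ ≤ ∑ a ∈ ball G k i \ Lt, (#(nb G a) : ℝ) := by
            refine sum_le_sum fun a ha => ?_
            rw [mem_sdiff] at ha
            exact hheavy k a ha.1 ha.2
        _ ≤ _ := by exact_mod_cast hc
    have hsp := hsparse _ hM.le
    have hgrow : D / (4 * K) * #(ball G k i) ≤ #(ball G (k + 1) i) := by
      rw [div_mul_eq_mul_div, div_le_iff₀ (by positivity)]
      have hD : 0 ≤ D := by linarith
      nlinarith [mul_le_mul_of_nonneg_left ih2 hD]
    have hpos : (0 : ℝ) ≤ #(ball G k i) := by positivity
    refine ⟨?_, ?_⟩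
    · calc (D / (4 * K)) ^ (k + 1) = D / (4 * K) * (D / (4 * K)) ^ k := by ring
        _ ≤ D / (4 * K) * #(ball G k i) := by gcongr
        _ ≤ _ := hgrow
    -- The centre is not light, so every light vertex of the next ball is a neighbour of the present
    -- ball, each of whose vertices has at most one light neighbour. Thus light vertices number at
    -- most the old ball, which is at most half of the new one.
    · have hLt : #(ball G (k + 1) i ∩ Lt) ≤ #(ball G k i) := by
        have hsub : ball G (k + 1) i ∩ Lt ⊆ (ball G k i).biUnion fun a => nb G a ∩ Lt := by
          intro v hv
          rw [mem_inter, mem_ball, mem_nbhd_succ'] at hv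
          rcases hv with ⟨rfl | ⟨w, hw, hwv⟩, hL⟩
          · exact absurd hL hi
          · rw [mem_biUnion]
            exact ⟨w, mem_ball.2 hw, mem_inter.2 ⟨mem_nb.2 hwv, hL⟩⟩
        calc _ ≤ _ := card_le_card hsub
          _ ≤ #(ball G k i) * 1 := card_biUnion_le_card_mul _ _ _ fun a _ => hlight a
          _ = _ := mul_one _
      have hsplit : #(ball G (k + 1) i \ Lt) + #(ball G (k + 1) i ∩ Lt) = #(ball G (k + 1) i) :=
        card_sdiff_add_card_inter _ _
      have h1 : (#(ball G (k + 1) i \ Lt) : ℝ) + #(ball G (k + 1) i ∩ Lt) = #(ball G (k + 1) i) := by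
        exact_mod_cast hsplit
      have h2 : (#(ball G (k + 1) i ∩ Lt) : ℝ) ≤ #(ball G k i) := by exact_mod_cast hLt
      nlinarith

end

end SeededMatching

namespace SeededMatching

open Finset

set_option linter.unusedSectionVars false

/-! ### Random graphs from independent labels of the vertex pairs -/

section RandomGraph

variable {V X : Type*} [Fintype V] [DecidableEq V] [Fintype X] {w : X → ℝ}

/-- The graph of the pairs whose label satisfies `Q`. -/
def gr (Q : X → Prop) (ω : Sym2 V → X) : SimpleGraph V where
  Adj a b := a ≠ b ∧ Q (ω s(a, b))
  symm := ⟨fun a b h => ⟨h.1.symm, by rw [Sym2.eq_swap]; exact h.2⟩⟩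
  loopless := ⟨fun _ h => h.1 rfl⟩

@[simp] lemma gr_adj {Q : X → Prop} {ω : Sym2 V → X} {a b : V} :
    (gr Q ω).Adj a b ↔ a ≠ b ∧ Q (ω s(a, b)) := Iff.rfl

/-- The pairs that join `a` to the elements of `S`. -/
def star (a : V) (S : Finset V) : Finset (Sym2 V) := S.image fun b => s(a, b)

lemma mem_star {a : V} {S : Finset V} {e : Sym2 V} : e ∈ star a S ↔ ∃ b ∈ S, s(a, b) = e := by
  simp [star]

lemma card_star (a : V) (S : Finset V) : #(star a S) = #S :=
  card_image_of_injective _ fun _ _ h => Sym2.congr_right.1 h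

lemma cnt_star (Q : X → Prop) (ω : Sym2 V → X) {a : V} {S : Finset V} (ha : a ∉ S) :
    cnt Q (star a S) ω = #(nb (gr Q ω) a ∩ S) := by
  classical
  unfold cnt star
  rw [filter_image, card_image_of_injective _ fun _ _ h => Sym2.congr_right.1 h]
  congr 1
  ext b
  simp only [mem_filter, mem_inter, mem_nb, gr_adj]
  constructor
  · rintro ⟨hb, hQ⟩
    exact ⟨⟨fun h => ha (h ▸ hb), hQ⟩, hb⟩
  · rintro ⟨⟨-, hQ⟩, hb⟩
    exact ⟨hb, hQ⟩

lemma nb_inter_erase (G : SimpleGraph V) (a : V) : nb G a ∩ univ.erase a = nb G a := by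
  rw [inter_eq_left]
  intro b hb
  rw [mem_nb] at hb
  simp [hb.ne']

/-- Makes the graph without `a` independent of the labels of the pairs at `a`. -/
lemma removeVerts_gr_congr {Q : X → Prop} {ω ω' : Sym2 V → X} {a : V}
    (h : ∀ e, a ∉ e → ω e = ω' e) :
    removeVerts (gr Q ω) {a} = removeVerts (gr Q ω') {a} := by
  ext b c
  simp only [removeVerts, gr_adj, Set.mem_singleton_iff]
  constructor <;> rintro ⟨⟨hbc, hQ⟩, hb, hc⟩ <;> refine ⟨⟨hbc, ?_⟩, hb, hc⟩
  · rwa [← h]; simp [Ne.symm hb, Ne.symm hc]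
  · rwa [h]; simp [Ne.symm hb, Ne.symm hc]

lemma Pr_exists_degree_gt_le (hw : IsWeight w) (Q : X → Prop) {d : ℝ}
    (hd : Fintype.card V * mass w Q = d) :
    Pr w (fun ω : Sym2 V → X => ∃ a, 3 * d < #(nb (gr Q ω) a)) ≤
      Fintype.card V * ((3 : ℝ) ^ (-(3 * d)) * Real.exp (2 * d)) := by
  refine Pr_exists_le hw _ _ fun a => ?_
  refine (Pr_mono hw (F := fun ω => 3 * d ≤ cnt Q (star a (univ.erase a)) ω) fun ω h => ?_).trans
    ((Pr_le_cnt_le_exp hw Q _ (z := 3) (by norm_num) _).trans ?_)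
  · rw [cnt_star Q ω (by simp), nb_inter_erase]
    exact h.le
  · refine mul_le_mul_of_nonneg_left (Real.exp_le_exp.2 ?_) (by positivity)
    rw [card_star, card_erase_of_mem (mem_univ a), card_univ, ← hd]
    have h1 : ((Fintype.card V - 1 : ℕ) : ℝ) ≤ Fintype.card V := by
      exact_mod_cast Nat.sub_le _ _
    have := hw.mass_nonneg Q
    nlinarith

/-- The neighbours of a vertex among the vertices of a ball around another vertex. -/
lemma Pr_exists_nb_inter_ball_ge_le (hw : IsWeight w) (Q : X → Prop) {Δ t : ℝ} (hΔ : 2 ≤ Δ)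
    (ht : 0 < t) (r : ℕ) (hQ : 0 < mass w Q) :
    Pr w (fun ω : Sym2 V → X => (∀ a, (#(nb (gr Q ω) a) : ℝ) ≤ Δ) ∧ ∃ x : V × V, x.1 ≠ x.2 ∧
      t ≤ #(nb (gr Q ω) x.2 ∩ ball (removeVerts (gr Q ω) {x.2}) r x.1)) ≤
      (Fintype.card V : ℝ) ^ 2 * (Real.exp 1 * (2 * Δ ^ r * mass w Q) / t) ^ t := by
  have hcard : (Fintype.card V : ℝ) ^ 2 = Fintype.card (V × V) := by
    rw [Fintype.card_prod]; push_cast; ring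
  rw [hcard]
  refine (Pr_mono hw (F := fun ω => ∃ x : V × V, (∀ a, (#(nb (gr Q ω) a) : ℝ) ≤ Δ) ∧ x.1 ≠ x.2 ∧
      t ≤ #(nb (gr Q ω) x.2 ∩ ball (removeVerts (gr Q ω) {x.2}) r x.1)) ?_).trans
    (Pr_exists_le hw _ _ fun x => ?_)
  · rintro ω ⟨h, x, hx⟩
    exact ⟨x, h, hx⟩
  obtain ⟨i, a⟩ := x
  dsimp only
  by_cases hia : i = a
  · simp only [hia, ne_eq, not_true_eq_false, false_and, and_false]
    have : Pr w (fun _ : Sym2 V → X => False) = 0 := by simp [Pr, Ex]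
    rw [this]
    positivity
  -- The ball around `i` is explored in the graph without `a`, so the pairs joining it to `a` are
  -- still unexposed.
  let F : (Sym2 V → X) → Finset (Sym2 V) := fun ω => star a (ball (removeVerts (gr Q ω) {a}) r i)
  refine (Pr_mono hw (F := fun ω => #(F ω) * mass w Q ≤ 2 * Δ ^ r * mass w Q ∧ t ≤ cnt Q (F ω) ω)
    ?_).trans (Pr_exposure_le hw Q F ?_ (by positivity) ht)
  · rintro ω ⟨hdeg, -, h⟩
    have ha : a ∉ ball (removeVerts (gr Q ω) {a}) r i := by
      rw [mem_ball]
      intro hmem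
      exact notMem_of_mem_nbhd_removeVerts (by simpa using hia) hmem rfl
    refine ⟨?_, ?_⟩
    · gcongr
      rw [card_star]
      refine card_ball_le hΔ (fun b => le_trans ?_ (hdeg b)) r i
      norm_cast
      refine card_le_card fun c hc => ?_
      rw [mem_nb] at *
      exact hc.1
    · rwa [cnt_star Q ω ha]
  · intro ω ω' h
    simp only [F]
    rw [removeVerts_gr_congr (ω := ω') (ω' := ω)]
    intro e he
    refine (h e fun hmem => he ?_).symm
    obtain ⟨b, -, rfl⟩ := mem_star.1 hmem
    simp

/-- If two graphs have the same edges at all vertices that are closer to `i` than `ℓ`, then they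
have the same balls around `i` up to radius `ℓ`. -/
lemma nbhd_congr {G G' : SimpleGraph V} {i : V} {ℓ : ℕ}
    (h : ∀ k < ℓ, ∀ a ∈ nbhd G k i, ∀ b, G.Adj a b ↔ G'.Adj a b) {k : ℕ} (hk : k ≤ ℓ) :
    nbhd G' k i = nbhd G k i := by
  induction k with
  | zero => ext v; rw [mem_nbhd_zero, mem_nbhd_zero]
  | succ k ih =>
    ext v
    rw [mem_nbhd_succ', mem_nbhd_succ', ih (by omega)]
    refine or_congr Iff.rfl (exists_congr fun a => and_congr_right fun ha => ?_)
    exact (h k (by omega) a ha v).symm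

lemma edist_eq_iff {G : SimpleGraph V} {i v : V} {ℓ : ℕ} :
    G.edist i v = ℓ ↔ v ∈ nbhd G ℓ i ∧ ∀ k < ℓ, v ∉ nbhd G k i := by
  simp only [mem_nbhd]
  constructor
  · intro h
    rw [h]
    refine ⟨le_rfl, fun k hk hle => ?_⟩
    have : ℓ ≤ k := by exact_mod_cast hle
    omega
  · rintro ⟨h1, h2⟩
    obtain ⟨m, hm⟩ := ENat.ne_top_iff_exists.1 (ne_top_of_le_ne_top (ENat.natCast_ne_top ℓ) h1)
    rw [← hm] at h1 h2 ⊢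
    have h1' : m ≤ ℓ := by exact_mod_cast h1
    rcases h1'.lt_or_eq with hlt | rfl
    · exact absurd le_rfl (h2 m hlt)
    · rfl

open Classical in
/-- The pairs between the sphere of radius `ℓ` around `i` and the ball of radius `m` around `b`
in the complement of the ball of radius `ℓ` around `i`. -/
noncomputable def entryPairs (G : SimpleGraph V) (ℓ m : ℕ) (i b : V) : Finset (Sym2 V) :=
  if b ∈ ball G ℓ i then ∅ else
    (ball (removeVerts G (ball G ℓ i)) m b ×ˢ sphere G ℓ i).image fun x => s(x.1, x.2)

/-- These pairs are found without inspecting them. The ball and the sphere around `i` are determined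
by edges at vertices closer than `ℓ`, and the ball around `b` by edges with both ends outside; a
selected pair joins the sphere to the outside and is of neither kind. If `b` lies in the ball, no
pair is selected and the graphs agree. This is the hypothesis of `Pr_exposure_le`. -/
lemma entryPairs_congr {G G' : SimpleGraph V} {ℓ m : ℕ} {i b : V}
    (h : ∀ a c, s(a, c) ∉ entryPairs G ℓ m i b → (G.Adj a c ↔ G'.Adj a c)) :
    entryPairs G' ℓ m i b = entryPairs G ℓ m i b := by
  by_cases hb : b ∈ ball G ℓ i
  · have : G' = G := by
      ext a c
      exact (h a c (by simp [entryPairs, hb])).symm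
    rw [this]
  have hb' : b ∉ nbhd G ℓ i := by simpa using hb
  have key : ∀ s, s ∈ ball (removeVerts G (ball G ℓ i)) m b → s ∉ nbhd G ℓ i := by
    intro s hs
    rw [mem_ball] at hs
    have := notMem_of_mem_nbhd_removeVerts (by exact_mod_cast hb) hs
    simpa using this
  have hnb : ∀ k ≤ ℓ, nbhd G' k i = nbhd G k i := by
    intro k hk
    refine nbhd_congr (fun k hk a ha c => h a c ?_) hk
    rw [entryPairs, if_neg hb]
    intro hmem
    obtain ⟨⟨s, t⟩, hst, he⟩ := mem_image.1 hmem
    rw [mem_product, mem_sphere, edist_eq_iff] at hst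
    rcases Sym2.eq_iff.1 he with ⟨rfl, rfl⟩ | ⟨rfl, rfl⟩
    · exact key s hst.1 (nbhd_mono_radius hk.le ha)
    · exact hst.2.2 k hk ha
  have hball : ball G' ℓ i = ball G ℓ i := by
    ext v; rw [mem_ball, mem_ball, hnb ℓ le_rfl]
  have hsphere : sphere G' ℓ i = sphere G ℓ i := by
    ext v
    rw [mem_sphere, mem_sphere, edist_eq_iff, edist_eq_iff, hnb ℓ le_rfl]
    refine and_congr_right fun _ => forall₂_congr fun k hk => ?_
    rw [hnb k hk.le]
  have hrem : removeVerts G' (ball G ℓ i) = removeVerts G (ball G ℓ i) := by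
    ext a c
    simp only [removeVerts]
    rw [and_congr_left_iff]
    rintro ⟨ha, hc⟩
    refine (h a c ?_).symm
    rw [entryPairs, if_neg hb]
    intro hmem
    obtain ⟨⟨s, t⟩, hst, he⟩ := mem_image.1 hmem
    rw [mem_product] at hst
    have := sphere_subset_ball hst.2
    rcases Sym2.eq_iff.1 he with ⟨rfl, rfl⟩ | ⟨rfl, rfl⟩
    · exact hc (by exact_mod_cast this)
    · exact ha (by exact_mod_cast this)
  rw [entryPairs, entryPairs, hball, hsphere, hrem]

/-- The number of edges by which a ball in the complement of a ball enters the latter. -/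
lemma Pr_entry_ge_le (hw : IsWeight w) (Q : X → Prop) {Δ t : ℝ} (hΔ : 2 ≤ Δ) (ht : 0 < t)
    (M : SimpleGraph V) (ℓ m : ℕ) (i b : V) (hQ : 0 < mass w Q) :
    Pr w (fun ω : Sym2 V → X => (∀ a, (#(nb (gr Q ω) a) : ℝ) ≤ Δ) ∧
      b ∉ ball (gr Q ω ⊓ M) ℓ i ∧
      t ≤ #(edgesBetween (gr Q ω ⊓ M)
        (ball (removeVerts (gr Q ω ⊓ M) (ball (gr Q ω ⊓ M) ℓ i)) m b)
        (sphere (gr Q ω ⊓ M) ℓ i))) ≤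
      (Real.exp 1 * (4 * Δ ^ (m + ℓ) * mass w Q) / t) ^ t := by
  classical
  let F : (Sym2 V → X) → Finset (Sym2 V) := fun ω => entryPairs (gr Q ω ⊓ M) ℓ m i b
  refine (Pr_mono hw (F := fun ω => #(F ω) * mass w Q ≤ 4 * Δ ^ (m + ℓ) * mass w Q ∧
    t ≤ cnt Q (F ω) ω) ?_).trans (Pr_exposure_le hw Q F ?_ (by positivity) ht)
  · rintro ω ⟨hdeg, hb, h⟩
    set G' := gr Q ω ⊓ M with hG'
    have hG'le : G' ≤ gr Q ω := inf_le_left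
    have hdeg' : ∀ a, (#(nb G' a) : ℝ) ≤ Δ := fun a => by
      refine le_trans ?_ (hdeg a)
      norm_cast
      exact card_le_card fun c hc => by rw [mem_nb] at *; exact hG'le hc
    have hdeg'' : ∀ a, (#(nb (removeVerts G' (ball G' ℓ i)) a) : ℝ) ≤ Δ := fun a => by
      refine le_trans ?_ (hdeg' a)
      norm_cast
      exact card_le_card fun c hc => by rw [mem_nb] at *; exact hc.1
    have hFω : F ω = (ball (removeVerts G' (ball G' ℓ i)) m b ×ˢ sphere G' ℓ i).image
        fun x => s(x.1, x.2) := by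
      simp only [F, entryPairs, ← hG']
      rw [if_neg hb]
    refine ⟨?_, h.trans ?_⟩
    · gcongr
      rw [hFω]
      calc (#((ball (removeVerts G' (ball G' ℓ i)) m b ×ˢ sphere G' ℓ i).image
            fun x => s(x.1, x.2)) : ℝ)
          ≤ #(ball (removeVerts G' (ball G' ℓ i)) m b ×ˢ sphere G' ℓ i) := by
            exact_mod_cast card_image_le
        _ = #(ball (removeVerts G' (ball G' ℓ i)) m b) * #(sphere G' ℓ i) := by
            rw [card_product]; push_cast; rfl
        _ ≤ (2 * Δ ^ m) * (2 * Δ ^ ℓ) := by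
            gcongr
            · exact card_ball_le hΔ hdeg'' m b
            · exact le_trans (Nat.cast_le.2 (card_le_card sphere_subset_ball))
                (card_ball_le hΔ hdeg' ℓ i)
        _ = 4 * Δ ^ (m + ℓ) := by rw [pow_add]; ring
    · norm_cast
      unfold cnt
      refine card_le_card_of_injOn (fun x => s(x.1, x.2)) ?_ ?_
      · intro x hx
        rw [mem_coe, mem_edgesBetween] at hx
        rw [mem_coe, mem_filter, hFω]
        refine ⟨mem_image_of_mem _ (mem_product.2 hx.1), ?_⟩
        exact (hG'le hx.2).2
      · intro x hx y hy hxy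
        rw [mem_coe, mem_edgesBetween] at hx hy
        have key : ∀ s, s ∈ ball (removeVerts G' (ball G' ℓ i)) m b → s ∉ ball G' ℓ i := by
          intro s hs
          rw [mem_ball] at hs
          have := notMem_of_mem_nbhd_removeVerts (by exact_mod_cast hb) hs
          exact_mod_cast this
        rcases Sym2.eq_iff.1 hxy with ⟨h1, h2⟩ | ⟨h1, h2⟩
        · exact Prod.ext h1 h2
        · exact absurd (sphere_subset_ball hy.1.2) (h1 ▸ key _ hx.1.1)
  · intro ω ω' h
    refine entryPairs_congr fun a c hac => ?_
    have := h _ hac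
    simp only [SimpleGraph.inf_adj, gr_adj, this]

end RandomGraph

end SeededMatching

/-! ### Rare configurations: shortcuts, dense sets, isolated vertices, pairs of light vertices -/

namespace SeededMatching

open Finset

set_option linter.unusedSectionVars false

section RandomGraph

variable {V X : Type*} [Fintype V] [DecidableEq V] [Fintype X] {w : X → ℝ}

open Classical in
/-- The neighbours of `v` that are joined to another neighbour of `v` by a path of length at most
`L` that avoids `v`. -/
noncomputable def shortcut (G : SimpleGraph V) (v : V) (L : ℕ) : Finset V :=
  {j ∈ nb G v | ∃ j' ∈ nb G v, j' ≠ j ∧ j' ∈ nbhd (removeVerts G {v}) L j}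

/-- The vertices that occur in a set of pairs. -/
def endpoints (P : Finset (V × V)) : Finset V := P.image Prod.fst ∪ P.image Prod.snd

/-- Greedy choice. The `2s` endpoints already used block at most `2sK` neighbours of `v`, namely
those within distance `L` of one of them. An unblocked `j` is a new vertex, and so is its partner
`j'`, since otherwise `j` would be blocked by `j'`. -/
lemma exists_disjoint_pairs {G : SimpleGraph V} {v : V} {L t K : ℕ}
    (hK : ∀ c ∈ nb G v, #(nb G v ∩ ball (removeVerts G {v}) L c) ≤ K)
    (ht : 2 * t * K < #(shortcut G v L)) :
    ∃ P : Finset (V × V), #P = t ∧ #(endpoints P) = 2 * t ∧ endpoints P ⊆ nb G v ∧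
      ∀ x ∈ P, x.2 ∈ nbhd (removeVerts G {v}) L x.1 := by
  classical
  suffices h : ∀ s ≤ t, ∃ P : Finset (V × V), #P = s ∧ #(endpoints P) = 2 * s ∧
      endpoints P ⊆ nb G v ∧ ∀ x ∈ P, x.2 ∈ nbhd (removeVerts G {v}) L x.1 from h t le_rfl
  intro s hs
  induction s with
  | zero => exact ⟨∅, by simp [endpoints]⟩
  | succ s ih =>
    obtain ⟨P, hP, hU, hnb, hrel⟩ := ih (by omega)
    set B := (endpoints P).biUnion fun c => nb G v ∩ ball (removeVerts G {v}) L c with hB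
    have hBcard : #B ≤ 2 * s * K := by
      rw [← hU]
      exact card_biUnion_le_card_mul _ _ _ fun c hc => hK c (hnb hc)
    have hlt : #B < #(shortcut G v L) := by
      refine lt_of_le_of_lt (hBcard.trans ?_) ht
      gcongr
      omega
    obtain ⟨j, hj, hjB⟩ := exists_mem_notMem_of_card_lt_card hlt
    rw [shortcut, mem_filter] at hj
    obtain ⟨hjv, j', hj'v, hne, hjj'⟩ := hj
    have hjU : j ∉ endpoints P := fun h => hjB <| by
      rw [hB, mem_biUnion]
      exact ⟨j, h, mem_inter.2 ⟨hjv, mem_ball.2 mem_nbhd_self⟩⟩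
    have hj'U : j' ∉ endpoints P := fun h => hjB <| by
      rw [hB, mem_biUnion]
      exact ⟨j', h, mem_inter.2 ⟨hjv, mem_ball.2 (mem_nbhd_comm.1 hjj')⟩⟩
    have hins : endpoints (insert (j, j') P) = insert j (insert j' (endpoints P)) := by
      ext x
      simp only [endpoints, image_insert, mem_union, mem_insert]
      tauto
    refine ⟨insert (j, j') P, ?_, ?_, ?_, ?_⟩
    · rw [card_insert_of_notMem, hP]
      intro hmem
      exact hjU (mem_union_left _ (mem_image_of_mem Prod.fst hmem))
    · rw [hins, card_insert_of_notMem, card_insert_of_notMem hj'U, hU]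
      · ring
      · rw [mem_insert, not_or]
        exact ⟨hne.symm, hjU⟩
    · rw [hins]
      exact insert_subset hjv (insert_subset hj'v hnb)
    · intro x hx
      rcases mem_insert.1 hx with rfl | hx
      · exact hjj'
      · exact hrel x hx

/-- Many disjoint pairs of neighbours of `v` that are joined by short paths are unlikely. -/
lemma Pr_exists_disjoint_pairs_le (hw : IsWeight w) (Q : X → Prop) {Δ : ℝ} (hΔ : 2 ≤ Δ)
    (L t : ℕ) :
    Pr w (fun ω : Sym2 V → X => (∀ a, (#(nb (gr Q ω) a) : ℝ) ≤ Δ) ∧ ∃ v, ∃ P : Finset (V × V),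
      #P = t ∧ #(endpoints P) = 2 * t ∧ endpoints P ⊆ nb (gr Q ω) v ∧
      ∀ x ∈ P, x.2 ∈ nbhd (removeVerts (gr Q ω) {v}) L x.1) ≤
      Fintype.card V * (Fintype.card V * (2 * Δ ^ L) * mass w Q ^ 2) ^ t := by
  classical
  refine (Pr_mono hw (F := fun ω => ∃ v, ((∀ a, (#(nb (gr Q ω) a) : ℝ) ≤ Δ) ∧
      ∃ P : Finset (V × V),
      #P = t ∧ #(endpoints P) = 2 * t ∧ endpoints P ⊆ nb (gr Q ω) v ∧
      ∀ x ∈ P, x.2 ∈ nbhd (removeVerts (gr Q ω) {v}) L x.1)) ?_).trans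
    (Pr_exists_le hw _ _ fun v => ?_)
  · rintro ω ⟨h, v, hv⟩
    exact ⟨v, h, hv⟩
  let R : (Sym2 V → X) → Finset (V × V) := fun ω =>
    univ.filter fun x => x.2 ∈ nbhd (removeVerts (gr Q ω) {v}) L x.1
  let E : Finset (V × V) → (Sym2 V → X) → Prop := fun P ω =>
    (∀ a, (#(nb (removeVerts (gr Q ω) {v}) a) : ℝ) ≤ Δ) ∧ P ⊆ R ω
  -- For a fixed `P`, closeness is a property of the graph without `v`, hence independent of the
  -- `2t` edges from `v` to the endpoints.
  have hP : ∀ P : Finset (V × V), Pr w (fun ω => E P ω ∧ #P = t ∧ #(endpoints P) = 2 * t ∧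
      endpoints P ⊆ nb (gr Q ω) v) ≤ mass w Q ^ (2 * t) * if #P = t then Pr w (E P) else 0 := by
    intro P
    by_cases hc : #P = t ∧ #(endpoints P) = 2 * t
    · simp only [hc.1, hc.2, true_and, if_true]
      have hstar : Pr w (fun ω : Sym2 V → X => ∀ e ∈ star v (endpoints P), Q (ω e))
          = mass w Q ^ (2 * t) := by
        rw [Pr_forall_mem hw, card_star, hc.2]
      rw [← hstar, mul_comm, ← Pr_and_of_indep hw (star v (endpoints P))]
      · refine Pr_mono hw fun ω hω => ⟨hω.1, fun e he => ?_⟩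
        obtain ⟨b, hb, rfl⟩ := mem_star.1 he
        exact (mem_nb.1 (hω.2 hb)).2
      · intro ω ω' h
        simp only [E, R]
        rw [removeVerts_gr_congr (ω := ω) (ω' := ω')]
        intro e he
        refine h e fun hmem => he ?_
        obtain ⟨b, -, rfl⟩ := mem_star.1 hmem
        simp
      · intro ω ω' h
        exact forall₂_congr fun e he => by rw [h e he]
    · have : Pr w (fun ω : Sym2 V → X => E P ω ∧ #P = t ∧ #(endpoints P) = 2 * t ∧
          endpoints P ⊆ nb (gr Q ω) v) = 0 := by
        have h0 : ∀ ω : Sym2 V → X, ¬ (E P ω ∧ #P = t ∧ #(endpoints P) = 2 * t ∧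
          endpoints P ⊆ nb (gr Q ω) v) := fun ω h => hc ⟨h.2.1, h.2.2.1⟩
        simp [Pr, Ex, h0]
      rw [this]
      have := hw.mass_nonneg Q
      have := Pr_nonneg hw (E P)
      positivity
  calc _ ≤ Pr w (fun ω => ∃ P ∈ (univ : Finset (Finset (V × V))), E P ω ∧ #P = t ∧
        #(endpoints P) = 2 * t ∧ endpoints P ⊆ nb (gr Q ω) v) := by
        refine Pr_mono hw ?_
        rintro ω ⟨hdeg, P, h1, h2, h3, h4⟩
        refine ⟨P, mem_univ _, ⟨fun a => le_trans ?_ (hdeg a), ?_⟩, h1, h2, h3⟩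
        · norm_cast
          exact card_le_card fun c hc => by rw [mem_nb] at *; exact hc.1
        · intro x hx
          simp only [R, mem_filter, mem_univ, true_and]
          exact h4 x hx
    _ ≤ ∑ P, mass w Q ^ (2 * t) * if #P = t then Pr w (E P) else 0 :=
        (Pr_exists_mem_le hw _ _).trans (sum_le_sum fun P _ => hP P)
    _ = mass w Q ^ (2 * t) * Ex w (fun ω => ∑ P, if #P = t ∧ E P ω then 1 else 0) := by
        rw [← mul_sum, Ex_sum]
        congr 1
        refine sum_congr rfl fun P _ => ?_
        by_cases hPt : #P = t
        · simp only [hPt, true_and, if_true, Pr]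
          congr!
        · simp [hPt, Ex]
    _ ≤ mass w Q ^ (2 * t) * (Fintype.card V * (2 * Δ ^ L)) ^ t := by
        have := hw.mass_nonneg Q
        gcongr
        refine (Ex_mono hw fun ω => ?_).trans (Ex_const hw _).le
        by_cases hdeg : ∀ a, (#(nb (removeVerts (gr Q ω) {v}) a) : ℝ) ≤ Δ
        -- Under the degree bound the graph without `v` has at most `n · 2Δ^L` close ordered pairs,
        -- so the number of admissible `P` is at most the `t`-th power of this.
        · have hR : (#(R ω) : ℝ) ≤ Fintype.card V * (2 * Δ ^ L) := by
            have hsub : R ω ⊆ univ.biUnion fun a : V =>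
                (ball (removeVerts (gr Q ω) {v}) L a).map ⟨fun b => (a, b), fun b c h => by
                  simpa using h⟩ := by
              rintro ⟨a, b⟩ hx
              simp only [R, mem_filter, mem_univ, true_and] at hx
              rw [mem_biUnion]
              exact ⟨a, mem_univ a, mem_map.2 ⟨b, mem_ball.2 hx, rfl⟩⟩
            calc (#(R ω) : ℝ) ≤ _ := Nat.cast_le.2 (card_le_card hsub)
              _ ≤ _ := card_biUnion_real_le _ _ (by simp) (by positivity) fun a _ => by
                  rw [card_map]
                  exact card_ball_le hΔ hdeg L a
          calc (∑ P, if #P = t ∧ E P ω then (1 : ℝ) else 0)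
              ≤ ∑ P, if P ∈ powersetCard t (R ω) then (1 : ℝ) else 0 := by
                refine sum_le_sum fun P _ => ?_
                by_cases h : #P = t ∧ E P ω
                · rw [if_pos h, if_pos]
                  exact mem_powersetCard.2 ⟨h.2.2, h.1⟩
                · rw [if_neg h]
                  positivity
            _ = ((#(R ω)).choose t : ℝ) := by
                rw [← card_powersetCard, sum_boole, filter_mem_eq_inter, univ_inter]
            _ ≤ (#(R ω) : ℝ) ^ t := by exact_mod_cast Nat.choose_le_pow _ _
            _ ≤ _ := by gcongr
        · have : ∀ P, ¬ (#P = t ∧ E P ω) := fun P h => hdeg h.2.1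
          simp only [this, if_false, sum_const_zero]
          positivity
    _ = _ := by ring

/-- Small sets of vertices span few edges. -/
lemma Pr_exists_dense_le (hw : IsWeight w) (Q : X → Prop) {M K θ : ℝ} (hK : 0 < K)
    (hM : 0 < M) (hQ : 0 < mass w Q) (hθ1 : θ ≤ 1)
    (hθ : Fintype.card V * (Real.exp 1 * (M * mass w Q) / K) ^ K ≤ θ) :
    Pr w (fun ω : Sym2 V → X => ∃ W : Finset V, W.Nonempty ∧ (#W : ℝ) ≤ M ∧
      K * #W ≤ cnt Q W.sym2 ω) ≤ Fintype.card V * θ := by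
  classical
  set n := Fintype.card V with hn
  -- The Chernoff bound for `W` is the `#W`-th power of a quantity that, multiplied by `n`, is at
  -- most `θ`. The union over the at most `n^c` sets of size `c` thus costs `θ^c ≤ θ`.
  have hW : ∀ W : Finset V, W.Nonempty → (#W : ℝ) ≤ M →
      Pr w (fun ω : Sym2 V → X => K * #W ≤ cnt Q W.sym2 ω) ≤
        ((Real.exp 1 * (M * mass w Q) / K) ^ K) ^ #W := by
    intro W hne hWM
    have hpos : (0 : ℝ) < #W := by exact_mod_cast hne.card_pos
    refine (Pr_le_cnt_le_rpow hw Q W.sym2 (μ := #W * (M * mass w Q)) (by positivity)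
      (by positivity) ?_).trans (le_of_eq ?_)
    · rw [← mul_assoc]
      gcongr
      have h1 : #W.sym2 ≤ #W * #W := by
        rw [card_sym2, Nat.choose_two_right]
        rcases hc : #W with _ | c
        · simp
        · rw [Nat.add_sub_cancel]
          refine Nat.div_le_of_le_mul ?_
          nlinarith
      calc (#W.sym2 : ℝ) ≤ #W * #W := by exact_mod_cast h1
        _ ≤ #W * M := by gcongr
    · rw [Real.rpow_mul_natCast (by positivity)]
      congr 2
      field_simp
  calc _ ≤ Pr w (fun ω : Sym2 V → X => ∃ W ∈ (univ.filter fun W : Finset V => W.Nonempty ∧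
        (#W : ℝ) ≤ M), K * #W ≤ cnt Q W.sym2 ω) := by
        refine Pr_mono hw ?_
        rintro ω ⟨W, h1, h2, h3⟩
        exact ⟨W, by simp [h1, h2], h3⟩
    _ ≤ ∑ W ∈ univ.filter fun W : Finset V => W.Nonempty ∧ (#W : ℝ) ≤ M,
          ((Real.exp 1 * (M * mass w Q) / K) ^ K) ^ #W := by
        refine (Pr_exists_mem_le hw _ _).trans (sum_le_sum fun W hWm => ?_)
        rw [mem_filter] at hWm
        exact hW W hWm.2.1 hWm.2.2
    _ ≤ ∑ c ∈ Icc 1 n, ∑ W ∈ powersetCard c (univ : Finset V),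
          ((Real.exp 1 * (M * mass w Q) / K) ^ K) ^ #W := by
        rw [← sum_biUnion]
        · refine sum_le_sum_of_subset_of_nonneg ?_ fun _ _ _ => by positivity
          intro W hWm
          rw [mem_filter] at hWm
          rw [mem_biUnion]
          exact ⟨#W, mem_Icc.2 ⟨hWm.2.1.card_pos, card_le_univ W⟩, mem_powersetCard.2
            ⟨subset_univ _, rfl⟩⟩
        · intro a _ b _ hab
          exact disjoint_left.2 fun W h1 h2 => hab <| by
            rw [mem_powersetCard] at h1 h2
            rw [← h1.2, h2.2]
    _ ≤ ∑ c ∈ Icc 1 n, θ := by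
        refine sum_le_sum fun c hc => ?_
        rw [mem_Icc] at hc
        have : ∑ W ∈ powersetCard c (univ : Finset V),
            ((Real.exp 1 * (M * mass w Q) / K) ^ K) ^ #W
            = n.choose c * ((Real.exp 1 * (M * mass w Q) / K) ^ K) ^ c := by
          rw [sum_congr rfl fun W hWm => by rw [(mem_powersetCard.1 hWm).2], sum_const,
            card_powersetCard, nsmul_eq_mul, card_univ]
        rw [this]
        have hθ0 : 0 ≤ θ := le_trans (by positivity) hθ
        calc (n.choose c : ℝ) * ((Real.exp 1 * (M * mass w Q) / K) ^ K) ^ c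
            ≤ (n : ℝ) ^ c * ((Real.exp 1 * (M * mass w Q) / K) ^ K) ^ c := by
              gcongr
              exact_mod_cast Nat.choose_le_pow _ _
          _ = (n * (Real.exp 1 * (M * mass w Q) / K) ^ K) ^ c := by rw [mul_pow]
          _ ≤ θ ^ c := by gcongr
          _ ≤ θ := pow_le_of_le_one hθ0 hθ1 (by omega)
    _ = n * θ := by simp

lemma card_edgesBetween_self_le (Q : X → Prop) (ω : Sym2 V → X) (W : Finset V) :
    #(edgesBetween (gr Q ω) W W) ≤ 2 * cnt Q W.sym2 ω := by
  classical
  refine (card_le_mul_card_image (f := fun x : V × V => s(x.1, x.2)) _ 2 ?_).trans ?_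
  · intro e _
    induction e with
    | h a b =>
      refine (card_le_card (t := {(a, b), (b, a)}) fun x hx => ?_).trans card_le_two
      rw [mem_filter] at hx
      rcases Sym2.eq_iff.1 hx.2 with ⟨h1, h2⟩ | ⟨h1, h2⟩
      · simp [← h1, ← h2]
      · simp [← h1, ← h2]
  · gcongr
    unfold cnt
    refine card_le_card fun e he => ?_
    obtain ⟨x, hx, rfl⟩ := mem_image.1 he
    rw [mem_edgesBetween] at hx
    rw [mem_filter, mk_mem_sym2_iff]
    exact ⟨hx.1, hx.2.2⟩

lemma Pr_exists_isolated_le (hw : IsWeight w) (Q : X → Prop) :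
    Pr w (fun ω : Sym2 V → X => ∃ a, nb (gr Q ω) a = ∅) ≤
      Fintype.card V * Real.exp (-((Fintype.card V - 1 : ℕ) * mass w Q)) := by
  refine Pr_exists_le hw _ _ fun a => ?_
  refine (Pr_mono hw fun ω h => ?_).trans
    ((Pr_cnt_eq_zero_le hw Q (star a (univ.erase a))).trans (le_of_eq ?_))
  · rw [cnt_star Q ω (by simp), nb_inter_erase, h, card_empty]
  · rw [card_star, card_erase_of_mem (mem_univ a), card_univ]

/-- Two vertices of small degree, together with some given edges. -/
lemma Pr_two_light_le (hw : IsWeight w) (Q Q' : X → Prop) {a b : V} (hab : a ≠ b) (C : Finset V)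
    (ha : a ∈ C) (hb : b ∈ C) (e : Finset (Sym2 V)) (he : ∀ x ∈ e, ∀ c ∈ x, c ∈ C) {z : ℝ}
    (hz : 0 < z) (hz1 : z ≤ 1) (t : ℝ) :
    Pr w (fun ω : Sym2 V → X => (∀ x ∈ e, Q (ω x)) ∧ (#(nb (gr Q' ω) a) : ℝ) ≤ t ∧
      (#(nb (gr Q' ω) b) : ℝ) ≤ t) ≤ mass w Q ^ #e *
        (z ^ (-(2 * t)) * Real.exp ((2 * #Cᶜ : ℕ) * mass w Q' * (z - 1))) := by
  -- Only the pairs from `a` and `b` to the complement of `C` are counted. They avoid the prescribed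
  -- edges, and the two stars are disjoint, so all the labels involved are independent.
  have hnot : ∀ x ∈ e, x ∉ star a Cᶜ ∪ star b Cᶜ := by
    intro x hx hmem
    rw [mem_union, mem_star, mem_star] at hmem
    rcases hmem with ⟨c, hc, rfl⟩ | ⟨c, hc, rfl⟩
    · exact mem_compl.1 hc (he _ hx c (by simp))
    · exact mem_compl.1 hc (he _ hx c (by simp))
  have hdisj : Disjoint (star a Cᶜ) (star b Cᶜ) := by
    rw [disjoint_left]
    intro x hx hx'
    obtain ⟨c, hc, rfl⟩ := mem_star.1 hx
    obtain ⟨c', hc', h⟩ := mem_star.1 hx'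
    rcases Sym2.eq_iff.1 h with ⟨h1, -⟩ | ⟨h1, -⟩
    · exact hab h1.symm
    · rw [h1] at hb
      exact mem_compl.1 hc hb
  have hcard : #(star a Cᶜ ∪ star b Cᶜ) = 2 * #Cᶜ := by
    rw [card_union_of_disjoint hdisj, card_star, card_star]; ring
  calc _ ≤ Pr w (fun ω : Sym2 V → X => (∀ x ∈ e, Q (ω x)) ∧
        (cnt Q' (star a Cᶜ ∪ star b Cᶜ) ω : ℝ) ≤ 2 * t) := by
        refine Pr_mono hw ?_
        rintro ω ⟨h1, h2, h3⟩
        refine ⟨h1, ?_⟩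
        have hcnt : cnt Q' (star a Cᶜ ∪ star b Cᶜ) ω ≤ #(nb (gr Q' ω) a) + #(nb (gr Q' ω) b) := by
          calc cnt Q' (star a Cᶜ ∪ star b Cᶜ) ω ≤ cnt Q' (star a Cᶜ) ω + cnt Q' (star b Cᶜ) ω := by
                classical
                unfold cnt
                rw [filter_union]
                exact card_union_le _ _
            _ ≤ _ := by
                rw [cnt_star Q' ω (by simpa using ha), cnt_star Q' ω (by simpa using hb)]
                exact add_le_add (card_le_card inter_subset_left) (card_le_card inter_subset_left)
        have : (cnt Q' (star a Cᶜ ∪ star b Cᶜ) ω : ℝ) ≤ #(nb (gr Q' ω) a) + #(nb (gr Q' ω) b) := by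
          exact_mod_cast hcnt
        linarith
    _ = Pr w (fun ω : Sym2 V → X => ∀ x ∈ e, Q (ω x)) *
        Pr w (fun ω : Sym2 V → X => (cnt Q' (star a Cᶜ ∪ star b Cᶜ) ω : ℝ) ≤ 2 * t) := by
        refine Pr_and_of_indep hw (star a Cᶜ ∪ star b Cᶜ) ?_ ?_
        · intro ω ω' h
          exact forall₂_congr fun x hx => by rw [h x (hnot x hx)]
        · intro ω ω' h
          rw [cnt_congr h]
    _ ≤ _ := by
        rw [Pr_forall_mem hw]
        have := hw.mass_nonneg Q
        gcongr
        refine (Pr_cnt_le_le_exp hw Q' _ hz hz1 _).trans (le_of_eq ?_)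
        rw [hcard]

end RandomGraph

end SeededMatching

namespace SeededMatching

open Finset

set_option linter.unusedSectionVars false

/-! ### Correctness of the algorithm on good samples -/

section Mask

variable {V : Type*} [Fintype V] [DecidableEq V]

/-- All pairs of vertices, except those that contain `r₁` or `r₂`, and except the pair `a, b`. -/
def mask (r₁ r₂ a b : V) : SimpleGraph V where
  Adj c d := c ≠ d ∧ (c ≠ r₁ ∧ c ≠ r₂) ∧ (d ≠ r₁ ∧ d ≠ r₂) ∧ s(c, d) ≠ s(a, b)
  symm := ⟨fun c d h => ⟨h.1.symm, h.2.2.1, h.2.1, by rw [Sym2.eq_swap]; exact h.2.2.2⟩⟩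
  loopless := ⟨fun _ h => h.1 rfl⟩

/-- The neighbourhoods of `i` without `u, x` and of `j` without `v, y` lie in a graph in which
the distance of `i` and `j` is larger than `L`. -/
def Separated (G : SimpleGraph V) (L : ℕ) (u v i j : V) : Prop :=
  ∃ x y, x ≠ i ∧ y ≠ j ∧ ∃ r₁ r₂ a b, removeVerts G {u, x} ≤ G ⊓ mask r₁ r₂ a b ∧
    removeVerts G {v, y} ≤ G ⊓ mask r₁ r₂ a b ∧
    ((L + 1 : ℕ) : ℕ∞) ≤ (G ⊓ mask r₁ r₂ a b).edist i j

lemma not_mem_nbhd_iff {G : SimpleGraph V} {L : ℕ} {i j : V} :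
    ((L + 1 : ℕ) : ℕ∞) ≤ G.edist i j ↔ j ∉ nbhd G L i := by
  rw [mem_nbhd, not_le]
  push_cast
  exact ENat.add_one_le_iff (ENat.natCast_ne_top L)

/-- Follow a path from `j` to `v` up to its first arrival at `v`. The vertex before is a neighbour
of `v`, is reached without `v`, and differs from `j` because `G'` lacks the edge between `v` and
`j`. -/
lemma mem_shortcut_of_mem_nbhd {G G' : SimpleGraph V} {v j : V} {L : ℕ} (hj : G.Adj v j)
    (hG : G' ≤ G) (hvj : ¬ G'.Adj v j) (h : j ∈ nbhd G' L v) : j ∈ shortcut G v L := by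
  have hjv : j ∉ ({v} : Set V) := by simpa using hj.ne'
  obtain ⟨m, hm, s, t, hs, ht, hst, -⟩ :=
    exists_first_entry (A := {v}) (z := v) rfl hjv (mem_nbhd_comm.1 h)
  rw [Set.mem_singleton_iff] at ht
  subst ht
  classical
  rw [shortcut, mem_filter]
  refine ⟨mem_nb.2 hj, s, mem_nb.2 (hG hst.symm), ?_, ?_⟩
  · rintro rfl
    exact hvj hst.symm
  · exact nbhd_mono_radius hm.le (nbhd_mono_graph (removeVerts_mono hG _) hs)

open Classical in
/-- All but boundedly many pairs of neighbours of two distinct vertices are separated. -/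
lemma card_not_separated_le {G : SimpleGraph V} {L K K' : ℕ}
    (hK : ∀ i a, i ≠ a → #(nb G a ∩ ball (removeVerts G {a}) (L + 1) i) ≤ K)
    (hK' : ∀ v, #(shortcut G v L) ≤ K') {u v : V} (huv : u ≠ v) :
    #{x ∈ nb G u ×ˢ nb G v | ¬ Separated G L u v x.1 x.2} ≤ K ^ 2 + 2 * K' + 1 := by
  have hsub : {x ∈ nb G u ×ˢ nb G v | ¬ Separated G L u v x.1 x.2} ⊆
      ((nb G u ∩ ball (removeVerts G {u}) (L + 1) v) ×ˢ
        (nb G v ∩ ball (removeVerts G {v}) (L + 1) u)) ∪ ({v} ×ˢ shortcut G v L) ∪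
        (shortcut G u L ×ˢ {u}) ∪ {(v, u)} := by
    rintro ⟨i, j⟩ hx
    rw [mem_filter, mem_product, mem_nb, mem_nb] at hx
    obtain ⟨⟨hi, hj⟩, hns⟩ := hx
    dsimp only at hi hj hns
    simp only [mem_union, mem_product, mem_singleton, mem_inter, mem_nb, mem_ball, Prod.mk.injEq]
    by_cases hiv : i = v
    · by_cases hju : j = u
      · exact Or.inr ⟨hiv, hju⟩
      · subst hiv
        left; left; right
        refine ⟨rfl, ?_⟩
        by_contra hsc
        -- With `i = v`, delete `x = j` on one side and `y = u` on the other. Both graphs then miss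
        -- `u` and the edge between `v` and `j`, so if `v` and `j` remain close, then `j` is a
        -- shortcut vertex of `v`. The case `j = u` below is the mirror image.
        refine hns ⟨j, u, hj.ne', fun h => hju h.symm, u, u, i, j, ?_, ?_, ?_⟩
        · intro c d hcd
          have h1 := hcd.2.1
          have h2 := hcd.2.2
          simp only [Set.mem_insert_iff, Set.mem_singleton_iff, not_or] at h1 h2
          refine ⟨hcd.1, hcd.1.ne, ⟨h1.1, h1.1⟩, ⟨h2.1, h2.1⟩, ?_⟩
          intro he
          rcases Sym2.eq_iff.1 he with ⟨-, h⟩ | ⟨h, -⟩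
          · exact h2.2 h
          · exact h1.2 h
        · intro c d hcd
          have h1 := hcd.2.1
          have h2 := hcd.2.2
          simp only [Set.mem_insert_iff, Set.mem_singleton_iff, not_or] at h1 h2
          refine ⟨hcd.1, hcd.1.ne, ⟨h1.2, h1.2⟩, ⟨h2.2, h2.2⟩, ?_⟩
          intro he
          rcases Sym2.eq_iff.1 he with ⟨h, -⟩ | ⟨-, h⟩
          · exact h1.1 h
          · exact h2.1 h
        · rw [not_mem_nbhd_iff]
          exact fun h => hsc (mem_shortcut_of_mem_nbhd (G' := G ⊓ mask u u i j) hj inf_le_left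
            (fun h' => h'.2.2.2.2 rfl) h)
    · by_cases hju : j = u
      · subst hju
        left; right
        refine ⟨?_, rfl⟩
        by_contra hsc
        refine hns ⟨v, i, fun h => hiv h.symm, hi.ne', v, v, i, j, ?_, ?_, ?_⟩
        · intro c d hcd
          have h1 := hcd.2.1
          have h2 := hcd.2.2
          simp only [Set.mem_insert_iff, Set.mem_singleton_iff, not_or] at h1 h2
          refine ⟨hcd.1, hcd.1.ne, ⟨h1.2, h1.2⟩, ⟨h2.2, h2.2⟩, ?_⟩
          intro he
          rcases Sym2.eq_iff.1 he with ⟨-, h⟩ | ⟨h, -⟩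
          · exact h2.1 h
          · exact h1.1 h
        · intro c d hcd
          have h1 := hcd.2.1
          have h2 := hcd.2.2
          simp only [Set.mem_insert_iff, Set.mem_singleton_iff, not_or] at h1 h2
          refine ⟨hcd.1, hcd.1.ne, ⟨h1.1, h1.1⟩, ⟨h2.1, h2.1⟩, ?_⟩
          intro he
          rcases Sym2.eq_iff.1 he with ⟨h, -⟩ | ⟨-, h⟩
          · exact h1.2 h
          · exact h2.2 h
        · rw [not_mem_nbhd_iff]
          intro h
          refine hsc (mem_shortcut_of_mem_nbhd (G' := G ⊓ mask v v i j) hi inf_le_left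
            (fun h' => h'.2.2.2.2 ?_) (mem_nbhd_comm.1 h))
          exact Sym2.eq_swap
      · left; left; left
        have hclose : j ∈ nbhd (removeVerts G {u, v}) L i := by
          by_contra hfar
          -- Deleting `x = v` and `y = u` makes both graphs equal to `G` without `u` and `v`. The
          -- diagonal pair `u, u` in the mask excludes nothing further. Closeness of `i` and `j`
          -- puts `i` near `v` and `j` near `u`, with at most `K` choices each.
          refine hns ⟨v, u, fun h => hiv h.symm, fun h => hju h.symm, u, v, u, u, ?_, ?_, ?_⟩
          · intro c d hcd
            have h1 := hcd.2.1
            have h2 := hcd.2.2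
            simp only [Set.mem_insert_iff, Set.mem_singleton_iff, not_or] at h1 h2
            refine ⟨hcd.1, hcd.1.ne, h1, h2, fun he => ?_⟩
            rcases Sym2.eq_iff.1 he with ⟨h, -⟩ | ⟨-, h⟩
            · exact h1.1 h
            · exact h2.1 h
          · intro c d hcd
            have h1 := hcd.2.1
            have h2 := hcd.2.2
            simp only [Set.mem_insert_iff, Set.mem_singleton_iff, not_or] at h1 h2
            refine ⟨hcd.1, hcd.1.ne, h1.symm, h2.symm, fun he => ?_⟩
            rcases Sym2.eq_iff.1 he with ⟨h, -⟩ | ⟨-, h⟩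
            · exact h1.2 h
            · exact h2.2 h
          · rw [not_mem_nbhd_iff]
            intro h
            refine hfar (nbhd_mono_graph ?_ h)
            intro c d hcd
            refine ⟨hcd.1, ?_, ?_⟩
            · simpa using hcd.2.2.1
            · simpa using hcd.2.2.2.1
        refine ⟨⟨hi, ?_⟩, hj, ?_⟩
        · rw [mem_nbhd_succ]
          refine Or.inr ⟨j, ⟨hj, by simpa using huv.symm, by simpa using hju⟩, ?_⟩
          rw [mem_nbhd_comm]
          exact nbhd_mono_graph (removeVerts_anti (by simp)) hclose
        · rw [mem_nbhd_succ]
          refine Or.inr ⟨i, ⟨hi, by simpa using huv, by simpa using hiv⟩, ?_⟩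
          exact nbhd_mono_graph (removeVerts_anti (by simp)) hclose
  refine (card_le_card hsub).trans ?_
  refine (card_union_le _ _).trans ?_
  refine Nat.add_le_add ?_ (by simp)
  refine (card_union_le _ _).trans ?_
  have h1 : #((nb G u ∩ ball (removeVerts G {u}) (L + 1) v) ×ˢ
      (nb G v ∩ ball (removeVerts G {v}) (L + 1) u)) ≤ K ^ 2 := by
    rw [card_product, sq]
    exact Nat.mul_le_mul (hK v u huv.symm) (hK u v huv)
  have h2 : #(({v} : Finset V) ×ˢ shortcut G v L) ≤ K' := by
    rw [card_product, card_singleton, one_mul]; exact hK' v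
  have h3 : #(shortcut G u L ×ˢ ({u} : Finset V)) ≤ K' := by
    rw [card_product, card_singleton, mul_one]; exact hK' u
  have h4 := card_union_le ((nb G u ∩ ball (removeVerts G {u}) (L + 1) v) ×ˢ
      (nb G v ∩ ball (removeVerts G {v}) (L + 1) u)) ({v} ×ˢ shortcut G v L)
  omega

end Mask

/-! ### Invariance of neighbourhoods under relabelling -/

section Relabel

variable {V : Type*}

lemma mem_nbhd_map_iff (G : SimpleGraph V) (π : Equiv.Perm V) {k : ℕ} {a b : V} :
    π b ∈ nbhd (G.map π.toEmbedding) k (π a) ↔ b ∈ nbhd G k a := by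
  induction k generalizing a with
  | zero => simp [mem_nbhd_zero]
  | succ k ih =>
    rw [mem_nbhd_succ, mem_nbhd_succ, π.injective.eq_iff]
    refine or_congr Iff.rfl ⟨?_, ?_⟩
    · rintro ⟨w, hw, hb⟩
      obtain ⟨w, rfl⟩ := π.surjective w
      exact ⟨w, (SimpleGraph.map_adj_apply (f := π.toEmbedding)).1 hw, ih.1 hb⟩
    · rintro ⟨w, hw, hb⟩
      exact ⟨π w, (SimpleGraph.map_adj_apply (f := π.toEmbedding)).2 hw, ih.2 hb⟩

lemma removeVerts_map (G : SimpleGraph V) (π : Equiv.Perm V) (u x : V) :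
    removeVerts (G.map π.toEmbedding) {π u, π x} = (removeVerts G {u, x}).map π.toEmbedding := by
  ext a b
  obtain ⟨a, rfl⟩ := π.surjective a
  obtain ⟨b, rfl⟩ := π.surjective b
  have e := SimpleGraph.map_adj_apply (f := π.toEmbedding) (G := removeVerts G {u, x})
    (a := a) (b := b)
  have e' := SimpleGraph.map_adj_apply (f := π.toEmbedding) (G := G) (a := a) (b := b)
  simp only [Equiv.coe_toEmbedding] at e e' ⊢
  rw [e]
  simp [removeVerts, e']

end Relabel

section Correct

variable {n : ℕ}

/-- If the assignments that are made agree with the latent permutation, so does the output. -/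
lemma output_eq_of_assigned_iff {I : Input n} {π : Equiv.Perm (Fin n)}
    (h : ∀ v u, I.assigned v u ↔ u = π v) : I.output = π := by
  have hs : I.Success := by
    refine ⟨fun v u u' h1 h2 => ?_, fun v v' u h1 h2 => ?_, fun v => ⟨π v, (h _ _).2 rfl⟩⟩
    · rw [(h _ _).1 h1, (h _ _).1 h2]
    · exact π.injective ((h _ _).1 h1 ▸ (h _ _).1 h2)
  rw [Input.output, dif_pos hs]
  ext v
  rw [(h _ _).1 (hs.exists_perm.choose_spec v)]

lemma Sample.G₁_adj (ω : Sample n) (a b : Fin n) :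
    ω.G₁.Adj (ω.latent a) (ω.latent b) ↔ ω.G₁star.Adj a b :=
  SimpleGraph.map_adj_apply (f := ω.latent.toEmbedding)

lemma Sample.π₀_eq_some (ω : Sample n) (k m : Fin n) :
    ω.π₀ k = some m ↔ k ∈ ω.seedSet ∧ ω.latent k = m := by
  unfold Sample.π₀
  split_ifs with h <;> simp [h]

lemma Sample.π₀_eq_none (ω : Sample n) (k : Fin n) : ω.π₀ k = none ↔ k ∉ ω.seedSet := by
  unfold Sample.π₀
  split_ifs with h <;> simp [h]

variable {ε p α : ℝ}

/-- Sufficient conditions for the algorithm to recover the latent permutation. -/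
lemma output_eq_latent_of_Z (ω : Sample n) (Lt : Finset (Fin n))
    (hhigh : ∀ v, v ∉ Lt → Input.threshold n ≤ (observed ε p α ω).Z (ω.latent v) v)
    (hfalse : ∀ u v, u ≠ v → ((observed ε p α ω).Z (ω.latent u) v : ℝ) < Input.threshold n)
    (hlow : ∀ v ∈ Lt, ∃ j, j ∉ Lt ∧ ω.G₁star.Adj v j ∧ ω.G₂.Adj v j)
    (hdisj : ∀ u ∈ Lt, ∀ v ∈ Lt, u ≠ v → ∀ j, ω.G₁star.Adj u j → ¬ ω.G₂.Adj v j) :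
    (observed ε p α ω).output = ω.latent := by
  set I := observed ε p α ω with hI
  have hπ₀ : I.π₀ = ω.π₀ := rfl
  have hm1 : ∀ v u, I.matched v u → u = ω.latent v := by
    rintro v u (⟨-, -, h⟩ | h)
    · obtain ⟨u, rfl⟩ := ω.latent.surjective u
      by_contra hne
      have := hfalse u v fun h => hne (by rw [h])
      linarith
    · rw [hπ₀, Sample.π₀_eq_some] at h
      exact h.2.symm
  have hm2 : ∀ v, v ∉ Lt → I.matched v (ω.latent v) := by
    intro v hv
    by_cases hs : v ∈ ω.seedSet
    · exact Or.inr (by rw [hπ₀, Sample.π₀_eq_some]; exact ⟨hs, rfl⟩)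
    · refine Or.inl ⟨by rw [hπ₀, Sample.π₀_eq_none]; exact hs, fun k hk => ?_, hhigh v hv⟩
      rw [hπ₀, Sample.π₀_eq_some] at hk
      exact hs (ω.latent.injective hk.2 ▸ hk.1)
  refine output_eq_of_assigned_iff fun v u => ⟨?_, ?_⟩
  · rintro (h | ⟨hv, hu, j₁, j₂, hj, h1, h2⟩)
    · exact hm1 v u h
    -- Whatever is still unmatched on either side is light, and two distinct light vertices have no
    -- neighbour in common across the two graphs.
    · obtain ⟨u, rfl⟩ := ω.latent.surjective u
      have hvL : v ∈ Lt := by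
        by_contra hv'
        exact hv _ (hm2 v hv')
      have huL : u ∈ Lt := by
        by_contra hu'
        exact hu _ (hm2 u hu')
      rw [hm1 _ _ hj] at h1
      by_contra hne
      exact hdisj u huL v hvL (fun h => hne (by rw [h])) j₂ ((ω.G₁_adj u j₂).1 h1) h2
  · rintro rfl
    by_cases hmv : I.matched v (ω.latent v)
    · exact Or.inl hmv
    · right
      have hvL : v ∈ Lt := by
        by_contra hv'
        exact hmv (hm2 v hv')
      refine ⟨fun u' h => ?_, fun v' h => ?_, ?_⟩
      · rw [hm1 _ _ h] at h
        exact hmv h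
      · have := ω.latent.injective (hm1 _ _ h)
        subst this
        exact hmv h
      · obtain ⟨j, hj, h1, h2⟩ := hlow v hvL
        exact ⟨ω.latent j, j, hm2 j hj, (ω.G₁_adj v j).2 h1, h2⟩

open Classical in
/-- The seeds as a finite set. -/
noncomputable def Sample.seeds (ω : Sample n) : Finset (Fin n) := univ.filter (· ∈ ω.seedSet)

/-- Undoing the latent relabelling puts both neighbourhoods on the same vertex set, where they can
be compared inside the parent graph. -/
lemma commonSeeds_observed (ω : Sample n) (u v i j x y : Fin n) :
    (observed ε p α ω).commonSeeds (ω.latent u) v (ω.latent i) j (ω.latent x) y =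
      #(ω.seeds ∩ (ball (removeVerts ω.G₁star {u, x}) (tunedEll ε n p) i ∩
        ball (removeVerts ω.G₂ {v, y}) (tunedEll ε n p) j)) := by
  rw [Input.commonSeeds, ← Set.ncard_coe_finset]
  congr 1
  ext k
  simp only [coe_inter, Set.mem_inter_iff, coe_ball, mem_coe, Sample.seeds, mem_filter, mem_univ,
    true_and, Set.mem_ofPred_eq]
  change (∃ m, ω.π₀ k = some m ∧ m ∈ nbhd (removeVerts ω.G₁ {ω.latent u, ω.latent x})
    (tunedEll ε n p) (ω.latent i) ∧ k ∈ nbhd (removeVerts ω.G₂ {v, y}) (tunedEll ε n p) j) ↔ _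
  rw [Sample.G₁, removeVerts_map]
  constructor
  · rintro ⟨m, hm, h1, h2⟩
    rw [Sample.π₀_eq_some] at hm
    rw [← hm.2, mem_nbhd_map_iff] at h1
    exact ⟨hm.1, h1, h2⟩
  · rintro ⟨hk, h1, h2⟩
    exact ⟨_, (ω.π₀_eq_some k _).2 ⟨hk, rfl⟩, (mem_nbhd_map_iff _ _).2 h1, h2⟩

/-- The graph of the pairs that are edges of both subsamples. -/
def Sample.common (ω : Sample n) : SimpleGraph (Fin n) := ω.G₁star ⊓ ω.G₂

/-- The deterministic core. For a true pair and a heavy common neighbour `i`, both neighbourhoods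
defining `w` at `(i, i)` contain the ball of the common graph without the deleted vertices, for
every `x, y`; at most one common neighbour is light, which is the `+ 1` in `hdeg`. For a wrong pair
a separated `(i, j)` is not counted, because the minimum `w` is at most its value at the `x, y`
supplied by `Separated`. Light vertices have a heavy common neighbour and are left to step 2. -/
theorem output_eq_latent (ω : Sample n) (Lt : Finset (Fin n)) {L K K' : ℕ}
    (hsep : ∀ r₁ r₂ a b i j : Fin n,
      ((L + 1 : ℕ) : ℕ∞) ≤ (ω.parent ⊓ mask r₁ r₂ a b).edist i j →
      (#(ω.seeds ∩ (ball (ω.parent ⊓ mask r₁ r₂ a b) (tunedEll ε n p) i ∩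
        ball (ω.parent ⊓ mask r₁ r₂ a b) (tunedEll ε n p) j)) : ℝ) < tunedEta ε n p α)
    (hK : ∀ i a, i ≠ a → #(nb ω.parent a ∩ ball (removeVerts ω.parent {a}) (L + 1) i) ≤ K)
    (hK' : ∀ v, #(shortcut ω.parent v L) ≤ K')
    (hthr : (K : ℝ) ^ 2 + 2 * K' + 1 < Input.threshold n)
    (hball : ∀ i, i ∉ Lt → ∀ u x y, u ≠ i → x ≠ i → y ≠ i → tunedEta ε n p α ≤
      #(ω.seeds ∩ ball (removeVerts ω.common {u, x, y}) (tunedEll ε n p) i))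
    (hdeg : ∀ v, v ∉ Lt → Input.threshold n + 1 ≤ #(nb ω.common v))
    (hiso : ∀ v, nb ω.common v ≠ ∅)
    (hLt : ∀ a ∈ Lt, ∀ b ∈ Lt, a ≠ b → ¬ ω.parent.Adj a b ∧
      ∀ m, ω.parent.Adj a m → ¬ ω.parent.Adj b m) :
    (observed ε p α ω).output = ω.latent := by
  classical
  have hle₁ : ω.G₁star ≤ ω.parent := inf_le_left
  have hle₂ : ω.G₂ ≤ ω.parent := inf_le_left
  have hc₁ : ω.common ≤ ω.G₁star := inf_le_left
  have hc₂ : ω.common ≤ ω.G₂ := inf_le_right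
  set I := observed ε p α ω with hI
  have hη : I.η = tunedEta ε n p α := rfl
  refine output_eq_latent_of_Z ω Lt ?_ ?_ ?_ ?_
  · intro v hv
    have hw : ∀ i ∈ nb ω.common v \ Lt, I.η ≤ (I.w (ω.latent v) v (ω.latent i) i : ℝ) := by
      intro i hi
      rw [mem_sdiff, mem_nb] at hi
      have hvi : v ≠ i := hi.1.ne
      have : Nonempty ({x : Fin n // x ≠ ω.latent i} × {y : Fin n // y ≠ i}) :=
        ⟨⟨⟨ω.latent v, fun h => hvi (ω.latent.injective h)⟩, ⟨v, hvi⟩⟩⟩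
      rw [hη, ← Nat.ceil_le, Input.w]
      refine le_ciInf fun xy => ?_
      obtain ⟨⟨x, hx⟩, ⟨y, hy⟩⟩ := xy
      obtain ⟨x, rfl⟩ := ω.latent.surjective x
      rw [Nat.ceil_le]
      dsimp only
      rw [hI, commonSeeds_observed]
      refine (hball i hi.2 v x y hvi (fun h => hx (by rw [h])) hy).trans ?_
      norm_cast
      refine card_le_card (inter_subset_inter_left (subset_inter ?_ ?_))
      · refine ball_subset_of_le ((removeVerts_mono hc₁ _).trans (removeVerts_anti ?_)) _ _
        intro z hz
        simp only [Set.mem_insert_iff, Set.mem_singleton_iff] at *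
        tauto
      · refine ball_subset_of_le ((removeVerts_mono hc₂ _).trans (removeVerts_anti ?_)) _ _
        intro z hz
        simp only [Set.mem_insert_iff, Set.mem_singleton_iff] at *
        tauto
    have hlt1 : #(nb ω.common v ∩ Lt) ≤ 1 := by
      rw [card_le_one]
      intro a ha b hb
      rw [mem_inter, mem_nb] at ha hb
      by_contra hab
      exact (hLt a ha.2 b hb.2 hab).2 v (hle₁ (hc₁ ha.1.symm)) (hle₁ (hc₁ hb.1.symm))
    have hcard : (#(nb ω.common v) : ℝ) ≤ #(nb ω.common v \ Lt) + 1 := by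
      have := card_sdiff_add_card_inter (nb ω.common v) Lt
      norm_cast
      omega
    have hZ : #(nb ω.common v \ Lt) ≤ I.Z (ω.latent v) v := by
      rw [Input.Z]
      calc #(nb ω.common v \ Lt) = ∑ i ∈ nb ω.common v \ Lt, 1 := by simp
        _ ≤ ∑ i ∈ nb ω.common v \ Lt, ∑ j ∈ univ.filter (I.G₂.Adj v),
            (if I.η ≤ (I.w (ω.latent v) v (ω.latent i) j : ℝ) then 1 else 0) := by
          refine sum_le_sum fun i hi => ?_
          have hmem : i ∈ univ.filter (I.G₂.Adj v) := by
            rw [mem_sdiff, mem_nb] at hi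
            exact mem_filter.2 ⟨mem_univ i, hc₂ hi.1⟩
          refine le_trans ?_ (single_le_sum (fun _ _ => Nat.zero_le _) hmem)
          rw [if_pos (hw i hi)]
        _ = ∑ i' ∈ (nb ω.common v \ Lt).map ω.latent.toEmbedding,
            ∑ j ∈ univ.filter (I.G₂.Adj v),
            (if I.η ≤ (I.w (ω.latent v) v i' j : ℝ) then 1 else 0) := by
          rw [sum_map]; rfl
        _ ≤ _ := by
          refine sum_le_sum_of_subset fun i' hi' => ?_
          obtain ⟨i, hi, rfl⟩ := mem_map.1 hi'
          rw [mem_sdiff, mem_nb] at hi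
          simp only [mem_filter, mem_univ, true_and]
          exact (ω.G₁_adj v i).2 (hc₁ hi.1)
    have h1 := hdeg v hv
    have h2 : (#(nb ω.common v \ Lt) : ℝ) ≤ I.Z (ω.latent v) v := by exact_mod_cast hZ
    linarith
  · intro u v huv
    refine lt_of_le_of_lt ?_ hthr
    have hcard := card_not_separated_le hK hK' huv
    have hZ : I.Z (ω.latent u) v ≤
        #{x ∈ nb ω.parent u ×ˢ nb ω.parent v | ¬ Separated ω.parent L u v x.1 x.2} := by
      have hsep' : ∀ i j, Separated ω.parent L u v i j →
          ¬ I.η ≤ (I.w (ω.latent u) v (ω.latent i) j : ℝ) := by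
        rintro i j ⟨x, y, hx, hy, r₁, r₂, a, b, h1, h2, hfar⟩
        rw [not_le, hη]
        refine lt_of_le_of_lt ?_ (hsep r₁ r₂ a b i j hfar)
        have hle : I.w (ω.latent u) v (ω.latent i) j ≤
            I.commonSeeds (ω.latent u) v (ω.latent i) j (ω.latent x) y :=
          ciInf_le (OrderBot.bddBelow _)
            (⟨⟨ω.latent x, fun h => hx (ω.latent.injective h)⟩, ⟨y, hy⟩⟩ :
              {x : Fin n // x ≠ ω.latent i} × {y : Fin n // y ≠ j})
        rw [hI, commonSeeds_observed] at hle
        norm_cast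
        refine hle.trans (card_le_card (inter_subset_inter_left (inter_subset_inter ?_ ?_)))
        · exact ball_subset_of_le ((removeVerts_mono hle₁ _).trans h1) _ _
        · exact ball_subset_of_le ((removeVerts_mono hle₂ _).trans h2) _ _
      rw [Input.Z, ← sum_product', sum_boole]
      simp only [Nat.cast_id]
      refine card_le_card_of_injOn (fun x => (ω.latent.symm x.1, x.2)) ?_ ?_
      · rintro ⟨i, j⟩ hx
        obtain ⟨i, rfl⟩ := ω.latent.surjective i
        simp only [coe_filter, mem_product, mem_filter, mem_univ, true_and,
          Set.mem_ofPred_eq] at hx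
        simp only [coe_filter, mem_product, mem_nb, Set.mem_ofPred_eq, Equiv.symm_apply_apply]
        exact ⟨⟨hle₁ ((ω.G₁_adj u i).1 hx.1.1), hle₂ hx.1.2⟩, fun h => hsep' i j h hx.2⟩
      · rintro ⟨a, b⟩ _ ⟨c, d⟩ _ h
        simpa using h
    have : (I.Z (ω.latent u) v : ℝ) ≤ ((K ^ 2 + 2 * K' + 1 : ℕ) : ℝ) := by
      exact_mod_cast hZ.trans hcard
    push_cast at this
    exact this
  · intro v hv
    obtain ⟨j, hj⟩ := nonempty_iff_ne_empty.2 (hiso v)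
    rw [mem_nb] at hj
    refine ⟨j, fun hjL => ?_, hc₁ hj, hc₂ hj⟩
    exact (hLt v hv j hjL hj.ne).1 (hle₁ (hc₁ hj))
  · intro u hu v hv huv j h1 h2
    exact (hLt u hu v hv huv).2 j (hle₁ h1) (hle₂ h2)

end Correct

end SeededMatching

namespace SeededMatching

open Finset MeasureTheory ProbabilityTheory SimpleGraph

set_option linter.unusedSectionVars false

/-! ### The model as a product of independent labels -/

/-- The Bernoulli probability vector. -/
def bernoulliWeight (p : ℝ) (b : Bool) : ℝ := if b then p else 1 - p

/-- The law of the labels of a vertex pair: membership in the parent graph and in the two graphs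
of retained pairs. -/
def edgeWeight (p s : ℝ) (x : Bool × Bool × Bool) : ℝ :=
  bernoulliWeight p x.1 * (bernoulliWeight s x.2.1 * bernoulliWeight s x.2.2)

lemma bernoulliWeight_isWeight (p : unitInterval) : IsWeight (bernoulliWeight p) where
  nonneg b := by
    unfold bernoulliWeight
    split_ifs
    exacts [p.2.1, by linarith [p.2.2]]
  sum_eq := by simp [bernoulliWeight]

lemma edgeWeight_isWeight (p s : unitInterval) : IsWeight (edgeWeight p s) where
  nonneg x := mul_nonneg ((bernoulliWeight_isWeight p).nonneg _)
    (mul_nonneg ((bernoulliWeight_isWeight s).nonneg _) ((bernoulliWeight_isWeight s).nonneg _))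
  sum_eq := by
    simp [edgeWeight, Fintype.sum_prod_type, bernoulliWeight]
    ring

lemma mass_bernoulliWeight (p : ℝ) : mass (bernoulliWeight p) (· = true) = p := by
  simp [mass, bernoulliWeight]

/-- The pair belongs to the parent graph. -/
def InParent (x : Bool × Bool × Bool) : Prop := x.1 = true

/-- The pair belongs to the parent graph and is retained twice. -/
def InCommon (x : Bool × Bool × Bool) : Prop := x.1 = true ∧ x.2.1 = true ∧ x.2.2 = true

lemma mass_inParent (p s : ℝ) : mass (edgeWeight p s) InParent = p := by
  simp [mass, edgeWeight, InParent, Fintype.sum_prod_type, bernoulliWeight]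
  ring

lemma mass_inCommon (p s : ℝ) : mass (edgeWeight p s) InCommon = p * s ^ 2 := by
  simp only [mass, edgeWeight, InCommon, Fintype.sum_prod_type, bernoulliWeight]
  simp
  ring_nf
  simp

variable {n : ℕ}

/-- The probability of a given graph, as a product over the pairs. -/
lemma binomialRandom_real_singleton_eq_prod (p : unitInterval) (G : SimpleGraph (Fin n))
    [DecidableRel G.Adj] :
    (binomialRandom (Fin n) p).real {G} = ∏ e : Sym2 (Fin n),
      if e.IsDiag then 1 else bernoulliWeight p (decide (e ∈ G.edgeSet)) := by
  classical
  have h1 : (binomialRandom (Fin n) p).real {G} = (p : ℝ) ^ G.edgeSet.ncard *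
      (1 - p : ℝ) ^ ((Sym2.diagSetᶜ : Set (Sym2 (Fin n))) \ G.edgeSet).ncard := by
    rw [measureReal_def, binomialRandom_apply', Set.image_singleton, ← measureReal_def,
      setBernoulli_real_singleton p (by simp) (Set.toFinite _)]
  have h2 : ∀ e : Sym2 (Fin n),
      (if e.IsDiag then (1 : ℝ) else bernoulliWeight p (decide (e ∈ G.edgeSet))) =
      (if e ∈ G.edgeSet then (p : ℝ) else 1) *
        (if e ∈ ((Sym2.diagSetᶜ : Set (Sym2 (Fin n))) \ G.edgeSet) then (1 - p : ℝ) else 1) := by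
    intro e
    by_cases hd : e.IsDiag
    · have : e ∉ G.edgeSet := fun h => G.not_isDiag_of_mem_edgeSet h hd
      simp [hd, this]
    · by_cases he : e ∈ G.edgeSet <;> simp [hd, he, bernoulliWeight]
  rw [h1]
  simp_rw [h2]
  rw [prod_mul_distrib]
  congr 1
  · rw [prod_ite, prod_const, prod_const_one, mul_one, ← Set.ncard_coe_finset]
    congr 2
    ext e; simp
  · rw [prod_ite, prod_const, prod_const_one, mul_one, ← Set.ncard_coe_finset]
    congr 2
    ext e; simp

lemma gr_eq_iff {X : Type*} [Fintype X] (Q : X → Prop) (ω : Sym2 (Fin n) → X) (G : SimpleGraph (Fin n)) :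
    gr Q ω = G ↔ ∀ e : Sym2 (Fin n), ¬ e.IsDiag → (Q (ω e) ↔ e ∈ G.edgeSet) := by
  constructor
  · rintro rfl e he
    induction e with
    | h a b =>
      rw [Sym2.mk_isDiag_iff] at he
      rw [mem_edgeSet, gr_adj]
      exact (and_iff_right he).symm
  · intro h
    ext a b
    rw [gr_adj]
    by_cases hab : a = b
    · simp [hab]
    · have := h s(a, b) (by simpa using hab)
      simp [hab, this]

/-- The three graphs that are given by the labels. -/
def parentGraph (ω : Sym2 (Fin n) → Bool × Bool × Bool) : SimpleGraph (Fin n) := gr InParent ω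

/-- The first graph of retained pairs. -/
def keepGraph₁ (ω : Sym2 (Fin n) → Bool × Bool × Bool) : SimpleGraph (Fin n) :=
  gr (fun x => x.2.1 = true) ω

/-- The second graph of retained pairs. -/
def keepGraph₂ (ω : Sym2 (Fin n) → Bool × Bool × Bool) : SimpleGraph (Fin n) :=
  gr (fun x => x.2.2 = true) ω

lemma bool_eq_decide_iff {b : Bool} {P : Prop} [Decidable P] :
    b = decide P ↔ (b = true ↔ P) := by
  cases b <;> simp

/-- The event is a product over the pairs. Diagonal pairs carry labels that no graph sees; they
contribute the factor `1` on both sides. -/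
lemma Pr_graphs_eq (p s : unitInterval) (G K₁ K₂ : SimpleGraph (Fin n)) :
    Pr (edgeWeight p s) (fun ω => parentGraph ω = G ∧ keepGraph₁ ω = K₁ ∧ keepGraph₂ ω = K₂) =
      (binomialRandom (Fin n) p).real {G} * ((binomialRandom (Fin n) s).real {K₁} *
        (binomialRandom (Fin n) s).real {K₂}) := by
  classical
  let R : Sym2 (Fin n) → Bool × Bool × Bool → Prop := fun e x => ¬ e.IsDiag →
    x.1 = decide (e ∈ G.edgeSet) ∧ x.2.1 = decide (e ∈ K₁.edgeSet) ∧
    x.2.2 = decide (e ∈ K₂.edgeSet)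
  have h : (fun ω : Sym2 (Fin n) → Bool × Bool × Bool =>
      parentGraph ω = G ∧ keepGraph₁ ω = K₁ ∧ keepGraph₂ ω = K₂) = fun ω => ∀ e, R e (ω e) := by
    ext ω
    simp only [R]
    rw [parentGraph, keepGraph₁, keepGraph₂, gr_eq_iff, gr_eq_iff, gr_eq_iff]
    simp only [InParent, bool_eq_decide_iff]
    constructor
    · rintro ⟨h1, h2, h3⟩ e he
      exact ⟨h1 e he, h2 e he, h3 e he⟩
    · intro h
      exact ⟨fun e he => (h e he).1, fun e he => (h e he).2.1, fun e he => (h e he).2.2⟩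
  rw [h]
  refine (Pr_forall (w := edgeWeight p s) R).trans ?_
  rw [binomialRandom_real_singleton_eq_prod, binomialRandom_real_singleton_eq_prod,
    binomialRandom_real_singleton_eq_prod, ← prod_mul_distrib, ← prod_mul_distrib]
  refine prod_congr rfl fun e _ => ?_
  by_cases hd : e.IsDiag
  · simp only [R, hd, not_true_eq_false, false_implies, if_true, mul_one]
    simpa [mass] using (edgeWeight_isWeight p s).sum_eq
  · simp only [R, hd, not_false_eq_true, true_implies, if_false]
    unfold mass
    rw [Finset.sum_eq_single
      (decide (e ∈ G.edgeSet), decide (e ∈ K₁.edgeSet), decide (e ∈ K₂.edgeSet))]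
    · simp [edgeWeight]
    · rintro ⟨a, b, c⟩ _ hne
      rw [if_neg]
      rintro ⟨h1, h2, h3⟩
      exact hne (by simp only at h1 h2 h3; rw [h1, h2, h3])
    · simp

lemma setBernoulli_real_eq_Pr (α : unitInterval) (B : Set (Fin n) → Prop) :
    (setBernoulli (Set.univ : Set (Fin n)) α).real {S | B S} =
      Pr (bernoulliWeight α) (fun σ : Fin n → Bool => B {i | σ i = true}) := by
  classical
  have hS : ∀ σ : Fin n → Bool, (setBernoulli (Set.univ : Set (Fin n)) α).real
      {{i | σ i = true}} = ∏ i, bernoulliWeight α (σ i) := by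
    intro σ
    rw [setBernoulli_real_singleton α (Set.subset_univ _) (Set.toFinite _)]
    unfold bernoulliWeight
    rw [prod_ite, prod_const, prod_const, ← Set.ncard_coe_finset, ← Set.ncard_coe_finset]
    congr 3
    · ext i; simp
    · ext i; simp
  let φ : (Fin n → Bool) ≃ Set (Fin n) :=
    { toFun := fun σ => {i | σ i = true}
      invFun := fun S i => decide (i ∈ S)
      left_inv := fun σ => by ext i; simp
      right_inv := fun S => by ext i; simp }
  have hfin : {S : Set (Fin n) | B S} = ((univ.filter B : Finset (Set (Fin n))) : Set _) := by
    ext S; simp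
  rw [hfin, ← sum_measureReal_singleton, sum_filter, Pr, Ex, ← φ.sum_comp]
  refine sum_congr rfl fun σ _ => ?_
  change (if B {i | σ i = true} then _ else _) = _
  split_ifs
  · rw [mul_one]
    exact hS σ
  · rw [mul_zero]

lemma prod_real_eq_sum {A B : Type*} [Fintype A] [MeasurableSpace A] [MeasurableSingletonClass A]
    [Finite B] [MeasurableSpace B] [MeasurableSingletonClass B] (μ : Measure A) (ν : Measure B)
    [IsProbabilityMeasure μ] [IsProbabilityMeasure ν] (S : Set (A × B)) :
    (μ.prod ν).real S = ∑ a, μ.real {a} * ν.real {b | (a, b) ∈ S} := by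
  have hS : MeasurableSet S := S.toFinite.measurableSet
  rw [measureReal_def, Measure.prod_apply hS, lintegral_fintype, ENNReal.toReal_sum]
  · refine sum_congr rfl fun a _ => ?_
    rw [ENNReal.toReal_mul, mul_comm]
    rfl
  · intro a _
    exact ENNReal.mul_ne_top (measure_ne_top _ _) (measure_ne_top _ _)

instance : MeasurableSingletonClass (Equiv.Perm (Fin n)) := ⟨fun _ => trivial⟩

instance : MeasurableSingletonClass (SimpleGraph (Fin n)) := ⟨fun G => by
  have h := (MeasurableEmbedding.measurableSet_image
    (SimpleGraph.measurableEmbedding_edgeSet (V := Fin n)) (s := {G})).1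
  refine h ?_
  rw [Set.image_singleton]
  exact measurableSet_singleton _⟩

/-- The failure probability of an event that holds whenever a graph event `¬ B₁` and a seed event
`¬ B₂` hold. -/
theorem one_sub_prob_le (p s α : unitInterval) (E : Sample n → Prop)
    (B₁ : (Sym2 (Fin n) → Bool × Bool × Bool) → Prop)
    (B₂ : (Sym2 (Fin n) → Bool × Bool × Bool) → Set (Fin n) → Prop) {δ : ℝ}
    (hB₂ : ∀ ω, ¬ B₁ ω → Pr (bernoulliWeight α) (fun σ : Fin n → Bool => B₂ ω {i | σ i = true}) ≤ δ)
    (hδ : 0 ≤ δ)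
    (hE : ∀ ω S π π', ¬ B₁ ω → ¬ B₂ ω S →
      E ⟨parentGraph ω, keepGraph₁ ω, keepGraph₂ ω, S, π, π'⟩) :
    1 - prob n p s α E ≤ Pr (edgeWeight p s) B₁ + δ := by
  classical
  have hwt := edgeWeight_isWeight p s
  set ν := (PMF.uniformOfFintype (Equiv.Perm (Fin n))).toMeasure with hν
  have hprob : prob n p s α E = 1 - (coordinateLaw n p s α).real
      {x | ¬ E ⟨x.1, x.2.1, x.2.2.1, x.2.2.2.1, x.2.2.2.2.1, x.2.2.2.2.2⟩} := by
    have : IsProbabilityMeasure (coordinateLaw n p s α) := by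
      unfold coordinateLaw; infer_instance
    rw [prob, ← probReal_compl_eq_one_sub (Set.toFinite _).measurableSet]
    congr 1
    ext x; simp
  have hsplit : (coordinateLaw n p s α).real
      {x | ¬ E ⟨x.1, x.2.1, x.2.2.1, x.2.2.2.1, x.2.2.2.2.1, x.2.2.2.2.2⟩} =
      ∑ G, ∑ K₁, ∑ K₂, (binomialRandom (Fin n) p).real {G} *
        ((binomialRandom (Fin n) s).real {K₁} * ((binomialRandom (Fin n) s).real {K₂} *
        ((setBernoulli Set.univ α).prod (ν.prod ν)).real
          {y | ¬ E ⟨G, K₁, K₂, y.1, y.2.1, y.2.2⟩})) := by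
    rw [coordinateLaw, prod_real_eq_sum]
    refine sum_congr rfl fun G _ => ?_
    rw [prod_real_eq_sum, mul_sum]
    refine sum_congr rfl fun K₁ _ => ?_
    rw [prod_real_eq_sum, mul_sum, mul_sum]
    rfl
  have hsum : ∑ G, ∑ K₁, ∑ K₂, (binomialRandom (Fin n) p).real {G} *
        ((binomialRandom (Fin n) s).real {K₁} * ((binomialRandom (Fin n) s).real {K₂} *
        ((setBernoulli Set.univ α).prod (ν.prod ν)).real
          {y | ¬ E ⟨G, K₁, K₂, y.1, y.2.1, y.2.2⟩})) =
      Ex (edgeWeight p s) fun ω => ((setBernoulli Set.univ α).prod (ν.prod ν)).real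
          {y | ¬ E ⟨parentGraph ω, keepGraph₁ ω, keepGraph₂ ω, y.1, y.2.1, y.2.2⟩} := by
    -- Each labelling determines exactly one triple of graphs, so the sum over triples is an
    -- expectation over labellings.
    have h1 : ∀ G K₁ K₂ : SimpleGraph (Fin n), (binomialRandom (Fin n) p).real {G} *
        ((binomialRandom (Fin n) s).real {K₁} * ((binomialRandom (Fin n) s).real {K₂} *
        ((setBernoulli Set.univ α).prod (ν.prod ν)).real
          {y | ¬ E ⟨G, K₁, K₂, y.1, y.2.1, y.2.2⟩})) =
        Ex (edgeWeight p s) fun ω =>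
          if parentGraph ω = G ∧ keepGraph₁ ω = K₁ ∧ keepGraph₂ ω = K₂ then
            ((setBernoulli Set.univ α).prod (ν.prod ν)).real
              {y | ¬ E ⟨parentGraph ω, keepGraph₁ ω, keepGraph₂ ω, y.1, y.2.1, y.2.2⟩} else 0 := by
      intro G K₁ K₂
      rw [← mul_assoc ((binomialRandom (Fin n) s).real {K₁}), ← mul_assoc, ← Pr_graphs_eq, Pr,
        ← Ex_mul_const]
      congr 1
      ext ω
      split_ifs with h
      · rw [h.1, h.2.1, h.2.2, one_mul]
      · rw [zero_mul]
    simp_rw [h1]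
    simp_rw [← Ex_sum]
    congr 1
    ext ω
    rw [sum_eq_single (parentGraph ω), sum_eq_single (keepGraph₁ ω), sum_eq_single (keepGraph₂ ω)]
    · simp
    · intro K _ hK
      rw [if_neg (fun h => hK h.2.2.symm)]
    · simp
    · intro K _ hK
      exact sum_eq_zero fun K' _ => if_neg (fun h => hK h.2.1.symm)
    · simp
    · intro G _ hG
      exact sum_eq_zero fun K _ => sum_eq_zero fun K' _ => if_neg (fun h => hG h.1.symm)
    · simp
  rw [hprob, hsplit, hsum]
  have hle : ∀ ω, ((setBernoulli Set.univ α).prod (ν.prod ν)).real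
      {y | ¬ E ⟨parentGraph ω, keepGraph₁ ω, keepGraph₂ ω, y.1, y.2.1, y.2.2⟩} ≤
      (if B₁ ω then 1 else 0) + δ := by
    intro ω
    by_cases hb : B₁ ω
    · rw [if_pos hb]
      refine measureReal_le_one.trans (by linarith)
    · rw [if_neg hb, zero_add]
      calc _ ≤ ((setBernoulli Set.univ α).prod (ν.prod ν)).real ({S | B₂ ω S} ×ˢ Set.univ) := by
            refine measureReal_mono (fun y hy => ?_) (measure_ne_top _ _)
            simp only [Set.mem_prod, Set.mem_univ, and_true, Set.mem_ofPred_eq]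
            by_contra hS
            exact hy (hE ω y.1 y.2.1 y.2.2 hb hS)
        _ = (setBernoulli Set.univ α).real {S | B₂ ω S} := by
            rw [measureReal_prod_prod, probReal_univ, mul_one]
        _ ≤ δ := by
            rw [setBernoulli_real_eq_Pr]
            exact hB₂ ω hb
  have := Ex_mono hwt hle
  have hadd : Ex (edgeWeight p s) (fun ω : Sym2 (Fin n) → Bool × Bool × Bool =>
      (if B₁ ω then (1 : ℝ) else 0) + δ) = Pr (edgeWeight p s) B₁ + δ := by
    rw [← Ex_const (ι := Sym2 (Fin n)) hwt δ, Pr, Ex, Ex, Ex, ← sum_add_distrib]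
    refine sum_congr rfl fun ω _ => ?_
    rw [← Ex, Ex_const hwt, mul_add]
  linarith

end SeededMatching

namespace SeededMatching

open Finset

set_option linter.unusedSectionVars false

/-! ### The failure probability for a fixed number of vertices -/

section Failure

variable {n : ℕ}

/-- The membership of each vertex pair in the parent graph and in the two graphs of retained pairs. -/
abbrev Labels (n : ℕ) := Sym2 (Fin n) → Bool × Bool × Bool

/-- The graph of common edges that is given by the labels. -/
def commonGraph (ω : Labels n) : SimpleGraph (Fin n) := gr InCommon ω

lemma common_eq_commonGraph (ω : Labels n) (S : Set (Fin n)) (π π' : Equiv.Perm (Fin n)) :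
    (⟨parentGraph ω, keepGraph₁ ω, keepGraph₂ ω, S, π, π'⟩ : Sample n).common = commonGraph ω := by
  ext a b
  simp only [Sample.common, Sample.G₁star, Sample.G₂, parentGraph, keepGraph₁, keepGraph₂,
    commonGraph, SimpleGraph.inf_adj, gr_adj, InParent, InCommon]
  tauto

lemma commonGraph_le (ω : Labels n) : commonGraph ω ≤ parentGraph ω :=
  fun _ _ h => ⟨h.1, h.2.1⟩

/-- The graph event under which the algorithm may fail. -/
def BadGraph (d h B q : ℝ) (ℓ L K t : ℕ) (M Ks : ℝ) (ω : Labels n) : Prop :=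
  (∃ a, 3 * d < #(nb (parentGraph ω) a)) ∨
  ((∀ a, (#(nb (parentGraph ω) a) : ℝ) ≤ 3 * d) ∧ ∃ x : Fin n × Fin n, x.1 ≠ x.2 ∧
    2 * h ≤ #(nb (parentGraph ω) x.2 ∩ ball (removeVerts (parentGraph ω) {x.2}) ℓ x.1)) ∨
  ((∀ a, (#(nb (parentGraph ω) a) : ℝ) ≤ 3 * d) ∧ ∃ x : Fin n × Fin n, x.1 ≠ x.2 ∧
    (K : ℝ) ≤ #(nb (parentGraph ω) x.2 ∩ ball (removeVerts (parentGraph ω) {x.2}) (L + 1) x.1)) ∨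
  (∃ x : (Fin n × Fin n × Fin n × Fin n × Fin n × Fin n) × Fin ℓ,
    (∀ a, (#(nb (parentGraph ω) a) : ℝ) ≤ 3 * d) ∧
    x.1.2.2.2.2.2 ∉ ball (parentGraph ω ⊓ mask x.1.1 x.1.2.1 x.1.2.2.1 x.1.2.2.2.1) ℓ
      x.1.2.2.2.2.1 ∧
    h ^ ((x.2 : ℕ) + 1) + B * (3 * d) ^ ((x.2 : ℕ) + 1) ≤
      #(edgesBetween (parentGraph ω ⊓ mask x.1.1 x.1.2.1 x.1.2.2.1 x.1.2.2.2.1)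
        (ball (removeVerts (parentGraph ω ⊓ mask x.1.1 x.1.2.1 x.1.2.2.1 x.1.2.2.2.1)
          (ball (parentGraph ω ⊓ mask x.1.1 x.1.2.1 x.1.2.2.1 x.1.2.2.2.1) ℓ x.1.2.2.2.2.1))
          x.2 x.1.2.2.2.2.2)
        (sphere (parentGraph ω ⊓ mask x.1.1 x.1.2.1 x.1.2.2.1 x.1.2.2.2.1) ℓ x.1.2.2.2.2.1))) ∨
  ((∀ a, (#(nb (parentGraph ω) a) : ℝ) ≤ 3 * d) ∧ ∃ v, ∃ P : Finset (Fin n × Fin n),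
    #P = t ∧ #(endpoints P) = 2 * t ∧ endpoints P ⊆ nb (parentGraph ω) v ∧
    ∀ x ∈ P, x.2 ∈ nbhd (removeVerts (parentGraph ω) {v}) L x.1) ∨
  (∃ W : Finset (Fin n), W.Nonempty ∧ (#W : ℝ) ≤ M ∧ Ks * #W ≤ cnt InParent W.sym2 ω) ∨
  (∃ a, nb (commonGraph ω) a = ∅) ∨
  (∃ x : Fin n × Fin n, x.1 ≠ x.2 ∧ (parentGraph ω).Adj x.1 x.2 ∧
    (#(nb (commonGraph ω) x.1) : ℝ) ≤ n * q / 20 ∧ (#(nb (commonGraph ω) x.2) : ℝ) ≤ n * q / 20) ∨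
  (∃ x : Fin n × Fin n × Fin n, x.1 ≠ x.2.1 ∧
    ((parentGraph ω).Adj x.1 x.2.2 ∧ (parentGraph ω).Adj x.2.1 x.2.2) ∧
    (#(nb (commonGraph ω) x.1) : ℝ) ≤ n * q / 20 ∧ (#(nb (commonGraph ω) x.2.1) : ℝ) ≤ n * q / 20)

open Classical in
/-- A finite set from a set. -/
noncomputable def finsetOf (S : Set (Fin n)) : Finset (Fin n) := univ.filter (· ∈ S)

/-- The seed event under which the algorithm may fail. -/
def BadSeeds (ℓ : ℕ) (η Mx My : ℝ) (ω : Labels n) (S : Set (Fin n)) : Prop :=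
  (∃ x : Fin n × Fin n × Fin n × Fin n × Fin n × Fin n,
    (#(ball (parentGraph ω ⊓ mask x.1 x.2.1 x.2.2.1 x.2.2.2.1) ℓ x.2.2.2.2.1 ∩
      ball (parentGraph ω ⊓ mask x.1 x.2.1 x.2.2.1 x.2.2.2.1) ℓ x.2.2.2.2.2) : ℝ) ≤ Mx ∧
    η ≤ #(finsetOf S ∩ (ball (parentGraph ω ⊓ mask x.1 x.2.1 x.2.2.1 x.2.2.2.1) ℓ x.2.2.2.2.1 ∩
      ball (parentGraph ω ⊓ mask x.1 x.2.1 x.2.2.1 x.2.2.2.1) ℓ x.2.2.2.2.2))) ∨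
  (∃ x : Fin n × Fin n × Fin n × Fin n,
    My ≤ #(ball (removeVerts (commonGraph ω) {x.2.1, x.2.2.1, x.2.2.2}) ℓ x.1) ∧
    (#(finsetOf S ∩ ball (removeVerts (commonGraph ω) {x.2.1, x.2.2.1, x.2.2.2}) ℓ x.1) : ℝ) ≤ η)

lemma nb_subset_of_le {V : Type*} [Fintype V] {G G' : SimpleGraph V} (h : G ≤ G') (a : V) :
    nb G a ⊆ nb G' a := fun b hb => by
  classical
  rw [mem_nb] at *
  exact h hb

/-- On the complement of the bad events the algorithm succeeds. -/
theorem output_eq_latent_of_good {ε p α d h B q M Ks Mx My : ℝ} {L K t : ℕ} (ω : Labels n)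
    (S : Set (Fin n)) (π π' : Equiv.Perm (Fin n))
    (hG : ¬ BadGraph d h B q (tunedEll ε n p) L K t M Ks ω)
    (hS : ¬ BadSeeds (tunedEll ε n p) (tunedEta ε n p α) Mx My ω S)
    (hd : h ^ 8 = d) (hh : 2 ≤ h) (hB : 0 ≤ B) (hBℓ : tunedEll ε n p * B ≤ 1 / 8)
    (hℓ : 1 ≤ tunedEll ε n p)
    (hMx : (12 * h ^ 5) ^ tunedEll ε n p * (h ^ 3) ^ (tunedEll ε n p - (L + 1)) +
      4 * B * (3 * h ^ 8 + 2 * h) ^ tunedEll ε n p ≤ Mx)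
    (hthr : (K : ℝ) ^ 2 + 2 * (2 * t * K : ℕ) + 1 < Input.threshold n)
    (hdeg : Input.threshold n + 1 ≤ n * q / 20)
    (hKs : 0 < Ks) (hD : 8 * Ks ≤ n * q / 20 - 3)
    (hM : My ≤ M) (hMy : My ≤ ((n * q / 20 - 3) / (4 * Ks)) ^ tunedEll ε n p) :
    (observed ε p α (⟨parentGraph ω, keepGraph₁ ω, keepGraph₂ ω, S, π, π'⟩ : Sample n)).output
      = π := by
  classical
  simp only [BadGraph, not_or] at hG
  -- In order: degrees, backward edges at radius `ℓ`, backward edges at radius `L + 1`, entry edges,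
  -- disjoint pairs of shortcuts, dense sets, isolated vertices, adjacent light vertices, light
  -- vertices with a common neighbour.
  obtain ⟨g1, g2, g3, g4, g5, g6, g7, g8, g9⟩ := hG
  simp only [BadSeeds, not_or] at hS
  obtain ⟨s1, s2⟩ := hS
  push Not at g1
  set ℓ := tunedEll ε n p with hℓdef
  set G := parentGraph ω with hGdef
  have hd1 : ∀ a, (#(nb G a) : ℝ) ≤ 3 * d := g1
  have hback : ∀ i a, i ≠ a → (#(nb G a ∩ ball (removeVerts G {a}) ℓ i) : ℝ) < 2 * h := by
    intro i a hia
    by_contra hcon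
    exact g2 ⟨hd1, (i, a), hia, not_lt.1 hcon⟩
  have hKc : ∀ i a, i ≠ a → #(nb G a ∩ ball (removeVerts G {a}) (L + 1) i) ≤ K := by
    intro i a hia
    by_contra hcon
    refine g3 ⟨hd1, (i, a), hia, ?_⟩
    exact_mod_cast (not_le.1 hcon).le
  have hentry : ∀ r₁ r₂ a b i c, c ∉ ball (G ⊓ mask r₁ r₂ a b) ℓ i → ∀ m < ℓ,
      (#(edgesBetween (G ⊓ mask r₁ r₂ a b) (ball (removeVerts (G ⊓ mask r₁ r₂ a b)
        (ball (G ⊓ mask r₁ r₂ a b) ℓ i)) m c) (sphere (G ⊓ mask r₁ r₂ a b) ℓ i)) : ℝ) ≤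
        h ^ (m + 1) + B * (3 * h ^ 8) ^ (m + 1) := by
    intro r₁ r₂ a b i c hc m hm
    by_contra hcon
    refine g4 ⟨((r₁, r₂, a, b, i, c), ⟨m, hm⟩), hd1, hc, ?_⟩
    rw [hd] at hcon
    exact (not_le.1 hcon).le
  have hlight : ∀ a b, a ≠ b → (#(nb (commonGraph ω) a) : ℝ) ≤ n * q / 20 →
      (#(nb (commonGraph ω) b) : ℝ) ≤ n * q / 20 →
      ¬ G.Adj a b ∧ ∀ m, G.Adj a m → ¬ G.Adj b m := by
    intro a b hab ha hb
    refine ⟨fun h => g8 ⟨(a, b), hab, h, ha, hb⟩, fun m h1 h2 => g9 ⟨(a, b, m), hab, ⟨h1, h2⟩,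
      ha, hb⟩⟩
  set Lt : Finset (Fin n) := univ.filter fun a => (#(nb (commonGraph ω) a) : ℝ) ≤ n * q / 20
    with hLtdef
  have hLtmem : ∀ a, a ∈ Lt ↔ (#(nb (commonGraph ω) a) : ℝ) ≤ n * q / 20 := fun a => by
    simp [hLtdef]
  have hcom := common_eq_commonGraph ω S π π'
  refine output_eq_latent (⟨parentGraph ω, keepGraph₁ ω, keepGraph₂ ω, S, π, π'⟩ : Sample n) Lt
    (L := L) (K := K) (K' := 2 * t * K) ?_ hKc ?_ hthr ?_ ?_ ?_ ?_
  · intro r₁ r₂ a b i j hfar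
    by_contra hcon
    refine s1 ⟨(r₁, r₂, a, b, i, j), ?_, not_lt.1 hcon⟩
    refine le_trans ?_ hMx
    refine card_ball_inter_ball_le_of_far hℓ hh hB hBℓ ?_ ?_ (hentry r₁ r₂ a b i) hfar
    · intro c
      rw [hd]
      exact le_trans (Nat.cast_le.2 (card_le_card (nb_subset_of_le inf_le_left c))) (hd1 c)
    · intro c hci
      refine le_trans (Nat.cast_le.2 (card_le_card ?_)) (hback i c hci.symm).le
      exact inter_subset_inter (nb_subset_of_le inf_le_left c)
        (ball_subset_of_le (removeVerts_mono inf_le_left _) _ _)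
  · intro v
    by_contra hcon
    obtain ⟨P, h1, h2, h3, h4⟩ := exists_disjoint_pairs (G := G) (v := v) (L := L) (t := t) (K := K)
      (fun c hc => (card_le_card (inter_subset_inter_left
        (ball_mono (Nat.le_succ L) c))).trans (hKc c v (mem_nb.1 hc).ne')) (not_le.1 hcon)
    exact g5 ⟨hd1, v, P, h1, h2, h3, h4⟩
  · intro i hi u x y hu hx hy
    rw [hcom]
    by_contra hcon
    refine s2 ⟨(i, u, x, y), ?_, (not_le.1 hcon).le⟩
    dsimp only
    set J := removeVerts (commonGraph ω) {u, x, y} with hJ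
    have hJle : J ≤ G := (removeVerts_le _).trans (commonGraph_le ω)
    have hi' : i ∉ ({u, x, y} : Set (Fin n)) := by
      simp only [Set.mem_insert_iff, Set.mem_singleton_iff, not_or]
      exact ⟨hu.symm, hx.symm, hy.symm⟩
    -- Deleting three vertices lowers the common degree of a remaining vertex by at most `3`, hence
    -- the value of `D`.
    have key := card_ball_ge_of_sparse (G := J) (i := i) (Lt := Lt) (M := M) (K := Ks)
      (D := n * q / 20 - 3) hKs hD ?_ hi ?_ ?_ ℓ
    · rcases key with h | h
      · exact hM.trans h
      · exact hMy.trans h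
    · intro W hW
      rcases W.eq_empty_or_nonempty with rfl | hne
      · simp [edgesBetween]
      · have h1 : #(edgesBetween J W W) ≤ 2 * cnt InParent W.sym2 ω := by
          refine le_trans (card_le_card ?_) (card_edgesBetween_self_le InParent ω W)
          intro e he
          rw [mem_edgesBetween] at *
          exact ⟨he.1, hJle he.2⟩
        have h2 : (cnt InParent W.sym2 ω : ℝ) ≤ Ks * #W := by
          by_contra hc
          exact g6 ⟨W, hne, hW, (not_le.1 hc).le⟩
        have h3 : (#(edgesBetween J W W) : ℝ) ≤ 2 * cnt InParent W.sym2 ω := by exact_mod_cast h1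
        linarith
    · intro k a ha haL
      have haS : a ∉ ({u, x, y} : Set (Fin n)) :=
        notMem_of_mem_nbhd_removeVerts hi' (mem_ball.1 ha)
      rw [hLtmem, not_le] at haL
      have hsub : nb (commonGraph ω) a ⊆ nb J a ∪ {u, x, y} := by
        intro b hb
        rw [mem_nb] at hb
        rw [mem_union, mem_nb]
        by_cases hbS : b ∈ ({u, x, y} : Set (Fin n))
        · right; simpa using hbS
        · exact Or.inl ⟨hb, haS, hbS⟩
      have hc : #(nb (commonGraph ω) a) ≤ #(nb J a) + 3 :=
        (card_le_card hsub).trans ((card_union_le _ _).trans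
          (Nat.add_le_add_left card_le_three _))
      have hc' : (#(nb (commonGraph ω) a) : ℝ) ≤ #(nb J a) + 3 := by exact_mod_cast hc
      linarith
    · intro a
      rw [card_le_one]
      intro b hb c hc
      rw [mem_inter, mem_nb, hLtmem] at hb hc
      by_contra hbc
      exact (hlight b c hbc hb.2 hc.2).2 a (hJle hb.1.symm) (hJle hc.1.symm)
  · intro v hv
    rw [hcom]
    rw [hLtmem, not_le] at hv
    linarith
  · intro v
    rw [hcom]
    exact fun h => g7 ⟨v, h⟩
  · intro a ha b hb hab
    exact hlight a b hab ((hLtmem a).1 ha) ((hLtmem b).1 hb)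

/-- For small intersections the level `η` is at least four times the mean, whence the base `e/4`.
For large balls it is at most half the mean, and `z = 1/2` gives the rate `log 2 - 1 < -3/10`. The
powers of `n` count the tuples of vertices. -/
lemma Pr_badSeeds_le {α : unitInterval} {ℓ : ℕ} {η Mx My : ℝ} (ω : Labels n) (hα : 0 < (α : ℝ))
    (hη : 0 < η) (hMx : 4 * (α * Mx) ≤ η) (hMy : 2 * η ≤ α * My) :
    Pr (bernoulliWeight α) (fun σ : Fin n → Bool => BadSeeds ℓ η Mx My ω {i | σ i = true}) ≤
      (n : ℝ) ^ 6 * (Real.exp 1 / 4) ^ η + (n : ℝ) ^ 4 * Real.exp (-(3 / 10 * η)) := by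
  have hw := bernoulliWeight_isWeight α
  have hcnt : ∀ (σ : Fin n → Bool) (Y : Finset (Fin n)),
      #(finsetOf {i | σ i = true} ∩ Y) = cnt (· = true) Y σ := by
    intro σ Y
    unfold cnt finsetOf
    congr 1
    ext i
    simp [and_comm]
  refine (Pr_or_le hw _ _).trans (add_le_add ?_ ?_)
  · refine (Pr_exists_le hw _ ((Real.exp 1 / 4) ^ η) fun x => ?_).trans (le_of_eq ?_)
    · set Y := ball (parentGraph ω ⊓ mask x.1 x.2.1 x.2.2.1 x.2.2.2.1) ℓ x.2.2.2.2.1 ∩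
        ball (parentGraph ω ⊓ mask x.1 x.2.1 x.2.2.1 x.2.2.2.1) ℓ x.2.2.2.2.2
      by_cases hY : (#Y : ℝ) ≤ Mx
      · simp only [hY, true_and, hcnt]
        refine (Pr_le_cnt_le_rpow hw _ Y (μ := η / 4) (by positivity) hη ?_).trans (le_of_eq ?_)
        · rw [mass_bernoulliWeight]
          have : (#Y : ℝ) * α ≤ Mx * α := by gcongr
          linarith
        · congr 1
          field_simp
      · simp only [hY, false_and]
        have : Pr (bernoulliWeight α) (fun _ : Fin n → Bool => False) = 0 := by simp [Pr, Ex]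
        rw [this]
        positivity
    · congr 1
      simp only [Fintype.card_prod, Fintype.card_fin]
      push_cast
      ring
  · refine (Pr_exists_le hw _ (Real.exp (-(3 / 10 * η))) fun x => ?_).trans (le_of_eq ?_)
    · set Y := ball (removeVerts (commonGraph ω) {x.2.1, x.2.2.1, x.2.2.2}) ℓ x.1
      by_cases hY : My ≤ (#Y : ℝ)
      · simp only [hY, true_and, hcnt]
        refine (Pr_cnt_le_le_exp hw _ Y (z := 1 / 2) (by norm_num) (by norm_num) η).trans ?_
        rw [mass_bernoulliWeight]
        have h1 : 2 * η ≤ #Y * (α : ℝ) := by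
          have : (α : ℝ) * My ≤ α * #Y := by gcongr
          linarith
        have h2 : ((1 : ℝ) / 2) ^ (-η) = Real.exp (Real.log 2 * η) := by
          rw [one_div, Real.inv_rpow (by norm_num), Real.rpow_neg (by norm_num), inv_inv,
            Real.rpow_def_of_pos (by norm_num)]
        rw [h2, ← Real.exp_add]
        apply Real.exp_le_exp.2
        have := Real.log_two_lt_d9
        nlinarith
      · simp only [hY, false_and]
        have : Pr (bernoulliWeight α) (fun _ : Fin n → Bool => False) = 0 := by simp [Pr, Ex]
        rw [this]
        positivity
    · congr 1
      simp only [Fintype.card_prod, Fintype.card_fin]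
      push_cast
      ring

/-- Union bound over the nine events, with the Chernoff terms kept abstract as `θ₀, …, θ₃`. In the
last term `n²p` stands for one edge between two light vertices and `n³p²` for a path of two edges.
The degree bound is used at `z = 1/8`, and at least `n - 3` pairs at each light vertex avoid the
prescribed configuration. -/
lemma Pr_badGraph_le {p s : unitInterval} {d h B q M Ks θ₀ θ₁ θ₂ θ₃ : ℝ} {ℓ L K t : ℕ}
    (hd : n * (p : ℝ) = d) (hq : (p : ℝ) * (s : ℝ) ^ 2 = q) (hp : 0 < (p : ℝ)) (hd1 : 1 ≤ d)
    (hh : 0 < h) (hB : 0 ≤ B) (hK : 0 < K) (hKs : 0 < Ks) (hM : 0 < M) (hn : 3 ≤ n)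
    (h₁ : (Real.exp 1 * (2 * (3 * d) ^ ℓ * p) / (2 * h)) ^ (2 * h) ≤ θ₀)
    (h₂ : (Real.exp 1 * (2 * (3 * d) ^ (L + 1) * p) / K) ^ (K : ℝ) ≤ θ₁)
    (h₃ : ∀ m < ℓ, (Real.exp 1 * (4 * (3 * d) ^ (m + ℓ) * p) /
      (h ^ (m + 1) + B * (3 * d) ^ (m + 1))) ^ (h ^ (m + 1) + B * (3 * d) ^ (m + 1)) ≤ θ₂)
    (h₄ : n * (Real.exp 1 * (M * p) / Ks) ^ Ks ≤ θ₃) (hθ₃ : θ₃ ≤ 1) :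
    Pr (edgeWeight p s) (fun ω : Labels n => BadGraph d h B q ℓ L K t M Ks ω) ≤
      n * ((3 : ℝ) ^ (-(3 * d)) * Real.exp (2 * d)) + (n : ℝ) ^ 2 * θ₀ + (n : ℝ) ^ 2 * θ₁ +
      (n : ℝ) ^ 6 * ℓ * θ₂ + n * (n * (2 * (3 * d) ^ L) * p ^ 2) ^ t + n * θ₃ +
      n * Real.exp (-((n - 1 : ℝ) * q)) +
      ((n : ℝ) ^ 2 * p + (n : ℝ) ^ 3 * p ^ 2) *
        (((1 : ℝ) / 8) ^ (-(2 * (n * q / 20))) * Real.exp (-(7 / 4 * ((n - 3) * q)))) := by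
  have hw := edgeWeight_isWeight p s
  have hmP : mass (edgeWeight p s) InParent = p := mass_inParent p s
  have hmC : mass (edgeWeight p s) InCommon = q := by rw [mass_inCommon, hq]
  have hq0 : 0 ≤ q := by rw [← hmC]; exact hw.mass_nonneg _
  have hcard : (Fintype.card (Fin n) : ℝ) = n := by simp
  have hP0 : 0 < mass (edgeWeight p s) InParent := by rw [hmP]; exact hp
  have hΔ : 2 ≤ 3 * d := by linarith
  have hn3 : (3 : ℝ) ≤ n := by exact_mod_cast hn
  have b1 := Pr_exists_degree_gt_le (V := Fin n) hw InParent (d := d) (by rw [hcard, hmP, hd])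
  have b2 := Pr_exists_nb_inter_ball_ge_le (V := Fin n) hw InParent hΔ (t := 2 * h) (by positivity)
    ℓ hP0
  have b3 := Pr_exists_nb_inter_ball_ge_le (V := Fin n) hw InParent hΔ (t := K)
    (by exact_mod_cast hK) (L + 1) hP0
  have b5 := Pr_exists_disjoint_pairs_le (V := Fin n) hw InParent hΔ L t
  have b6 := Pr_exists_dense_le (V := Fin n) hw InParent (M := M) (K := Ks) (θ := θ₃) hKs hM hP0
    hθ₃ (by rw [hcard, hmP]; exact h₄)
  have b7 := Pr_exists_isolated_le (V := Fin n) hw InCommon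
  rw [hcard] at b1 b2 b3 b5 b6 b7
  rw [hmP] at b2 b3 b5
  rw [hmC] at b7
  have hnat : ((Fintype.card (Fin n) - 1 : ℕ) : ℝ) = n - 1 := by
    rw [Fintype.card_fin, Nat.cast_sub (by omega)]; simp
  rw [hnat] at b7
  have b4 : Pr (edgeWeight p s) (fun ω : Labels n =>
      ∃ x : (Fin n × Fin n × Fin n × Fin n × Fin n × Fin n) × Fin ℓ,
    (∀ a, (#(nb (parentGraph ω) a) : ℝ) ≤ 3 * d) ∧
    x.1.2.2.2.2.2 ∉ ball (parentGraph ω ⊓ mask x.1.1 x.1.2.1 x.1.2.2.1 x.1.2.2.2.1) ℓ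
      x.1.2.2.2.2.1 ∧
    h ^ ((x.2 : ℕ) + 1) + B * (3 * d) ^ ((x.2 : ℕ) + 1) ≤
      #(edgesBetween (parentGraph ω ⊓ mask x.1.1 x.1.2.1 x.1.2.2.1 x.1.2.2.2.1)
        (ball (removeVerts (parentGraph ω ⊓ mask x.1.1 x.1.2.1 x.1.2.2.1 x.1.2.2.2.1)
          (ball (parentGraph ω ⊓ mask x.1.1 x.1.2.1 x.1.2.2.1 x.1.2.2.2.1) ℓ x.1.2.2.2.2.1))
          x.2 x.1.2.2.2.2.2)
        (sphere (parentGraph ω ⊓ mask x.1.1 x.1.2.1 x.1.2.2.1 x.1.2.2.2.1) ℓ x.1.2.2.2.2.1)))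
      ≤ (n : ℝ) ^ 6 * ℓ * θ₂ := by
    refine (Pr_exists_le hw _ θ₂ fun x => ?_).trans (le_of_eq ?_)
    · have hd0 : 0 ≤ B * (3 * d) ^ ((x.2 : ℕ) + 1) := by positivity
      have hh0 : 0 < h ^ ((x.2 : ℕ) + 1) := by positivity
      refine (Pr_entry_ge_le (V := Fin n) hw InParent hΔ (by linarith) _ _ _ _ _ hP0).trans ?_
      rw [hmP]
      exact h₃ x.2 x.2.2
    · congr 1
      simp only [Fintype.card_prod, Fintype.card_fin]
      push_cast
      ring
  have b8 : Pr (edgeWeight p s) (fun ω : Labels n => ∃ x : Fin n × Fin n, x.1 ≠ x.2 ∧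
      (parentGraph ω).Adj x.1 x.2 ∧ (#(nb (commonGraph ω) x.1) : ℝ) ≤ n * q / 20 ∧
      (#(nb (commonGraph ω) x.2) : ℝ) ≤ n * q / 20) ≤ (n : ℝ) ^ 2 * (p *
        (((1 : ℝ) / 8) ^ (-(2 * (n * q / 20))) * Real.exp (-(7 / 4 * ((n - 3) * q))))) := by
    refine (Pr_exists_le hw _ (p *
        (((1 : ℝ) / 8) ^ (-(2 * (n * q / 20))) * Real.exp (-(7 / 4 * ((n - 3) * q)))))
        fun x => ?_).trans (le_of_eq ?_)
    · obtain ⟨a, b⟩ := x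
      by_cases hab : a = b
      · simp only [hab, ne_eq, not_true_eq_false, false_and]
        have : Pr (edgeWeight p s) (fun _ : Labels n => False) = 0 := by simp [Pr, Ex]
        rw [this]
        positivity
      have := Pr_two_light_le (V := Fin n) hw InParent InCommon hab {a, b} (by simp) (by simp)
        {s(a, b)} (by simp) (z := 1 / 8) (by norm_num) (by norm_num) (n * q / 20)
      rw [hmP, hmC, card_singleton, pow_one] at this
      refine (Pr_mono hw ?_).trans (this.trans ?_)
      · rintro ω ⟨-, hadj, h1, h2⟩
        refine ⟨?_, h1, h2⟩
        intro x hx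
        rw [mem_singleton.1 hx]
        exact hadj.2
      · gcongr
        rw [card_compl, card_pair hab, Fintype.card_fin, Nat.cast_mul, Nat.cast_sub (by omega)]
        push_cast
        nlinarith
    · congr 1
      simp only [Fintype.card_prod, Fintype.card_fin]
      push_cast
      ring
  have b9 : Pr (edgeWeight p s) (fun ω : Labels n => ∃ x : Fin n × Fin n × Fin n, x.1 ≠ x.2.1 ∧
      ((parentGraph ω).Adj x.1 x.2.2 ∧ (parentGraph ω).Adj x.2.1 x.2.2) ∧
      (#(nb (commonGraph ω) x.1) : ℝ) ≤ n * q / 20 ∧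
      (#(nb (commonGraph ω) x.2.1) : ℝ) ≤ n * q / 20) ≤ (n : ℝ) ^ 3 * (p ^ 2 *
        (((1 : ℝ) / 8) ^ (-(2 * (n * q / 20))) * Real.exp (-(7 / 4 * ((n - 3) * q))))) := by
    refine (Pr_exists_le hw _ (p ^ 2 *
        (((1 : ℝ) / 8) ^ (-(2 * (n * q / 20))) * Real.exp (-(7 / 4 * ((n - 3) * q)))))
        fun x => ?_).trans (le_of_eq ?_)
    · obtain ⟨a, b, c⟩ := x
      dsimp only
      by_cases hab : a ≠ b ∧ a ≠ c ∧ b ≠ c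
      swap
      · have h0 : Pr (edgeWeight p s) (fun _ : Labels n => False) = 0 := by simp [Pr, Ex]
        refine (Pr_mono hw (F := fun _ => False) ?_).trans (h0.le.trans (by positivity))
        rintro ω ⟨h1, ⟨h2, h3⟩, -⟩
        exact hab ⟨h1, h2.ne, h3.ne⟩
      obtain ⟨hab, hac, hbc⟩ := hab
      have hcc : #({a, b, c} : Finset (Fin n)) = 3 := card_eq_three.2 ⟨a, b, c, hab, hac, hbc, rfl⟩
      have hne : s(a, c) ≠ s(b, c) := by
        intro h
        rcases Sym2.eq_iff.1 h with ⟨h, -⟩ | ⟨h, -⟩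
        exacts [hab h, hac h]
      have := Pr_two_light_le (V := Fin n) hw InParent InCommon hab {a, b, c} (by simp) (by simp)
        {s(a, c), s(b, c)} (by simp) (z := 1 / 8) (by norm_num) (by norm_num) (n * q / 20)
      rw [hmP, hmC, card_pair hne] at this
      refine (Pr_mono hw ?_).trans (this.trans ?_)
      · rintro ω ⟨-, hadj, h1, h2⟩
        refine ⟨?_, h1, h2⟩
        intro x hx
        rw [mem_insert, mem_singleton] at hx
        rcases hx with rfl | rfl
        exacts [hadj.1.2, hadj.2.2]
      · gcongr
        rw [card_compl, hcc, Fintype.card_fin, Nat.cast_mul, Nat.cast_sub (by omega)]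
        push_cast
        nlinarith
    · congr 1
      simp only [Fintype.card_prod, Fintype.card_fin]
      push_cast
      ring
  unfold BadGraph
  refine (Pr_or_le hw _ _).trans ?_
  refine (add_le_add b1 ((Pr_or_le hw _ _).trans (add_le_add b2 ((Pr_or_le hw _ _).trans
    (add_le_add b3 ((Pr_or_le hw _ _).trans (add_le_add b4 ((Pr_or_le hw _ _).trans
    (add_le_add b5 ((Pr_or_le hw _ _).trans (add_le_add b6 ((Pr_or_le hw _ _).trans
    (add_le_add b7 ((Pr_or_le hw _ _).trans (add_le_add b8 b9))))))))))))))).trans ?_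
  have c1 : (n : ℝ) ^ 2 * (Real.exp 1 * (2 * (3 * d) ^ ℓ * p) / (2 * h)) ^ (2 * h)
      ≤ (n : ℝ) ^ 2 * θ₀ := by gcongr
  have c2 : (n : ℝ) ^ 2 * (Real.exp 1 * (2 * (3 * d) ^ (L + 1) * p) / K) ^ (K : ℝ)
      ≤ (n : ℝ) ^ 2 * θ₁ := by gcongr
  linarith

end Failure

end SeededMatching

namespace SeededMatching

open Finset Filter

set_option linter.unusedSectionVars false

/-! ### Asymptotics in the sparse regime -/

section Asymptotics

/-- The growth conditions on the expected degree `d` of the parent graph and on the radius `ℓ`. -/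
structure Regime (ε : ℝ) (d : ℕ → ℝ) (ℓ : ℕ → ℕ) : Prop where
  eps_pos : 0 < ε
  eps_lt : ε < 1 / 6
  log_le : ∀ᶠ n : ℕ in atTop, Real.log n ≤ d n
  log_d_le : ∀ᶠ n : ℕ in atTop, Real.log (d n) ≤ ε * Real.log n
  ell_mul_le : ∀ᶠ n : ℕ in atTop, ℓ n * Real.log (d n) ≤ (1 - ε) * Real.log n
  lt_ell_mul : ∀ᶠ n : ℕ in atTop, (1 - ε) * Real.log n < (ℓ n + 1) * Real.log (d n)

lemma tendsto_log_nat : Tendsto (fun n : ℕ => Real.log n) atTop atTop :=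
  Real.tendsto_log_atTop.comp tendsto_natCast_atTop_atTop

lemma eventually_log_pow_le (k : ℕ) (C : ℝ) {c : ℝ} (hc : 0 < c) :
    ∀ᶠ n : ℕ in atTop, C * Real.log n ^ k ≤ Real.exp (c * Real.log n) := by
  have h := (isLittleO_pow_exp_pos_mul_atTop k hc).comp_tendsto tendsto_log_nat
  have h2 := h.bound (c := 1 / (|C| + 1)) (by positivity)
  filter_upwards [h2, tendsto_log_nat.eventually_ge_atTop 0] with n hn h0
  simp only [Function.comp, Real.norm_eq_abs, Real.abs_exp] at hn
  rw [abs_of_nonneg (by positivity)] at hn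
  have h3 : (|C| + 1) * Real.log n ^ k ≤ Real.exp (c * Real.log n) := by
    calc _ ≤ (|C| + 1) * (1 / (|C| + 1) * Real.exp (c * Real.log n)) := by gcongr
      _ = _ := by field_simp
  refine le_trans ?_ h3
  have := le_abs_self C
  gcongr
  linarith

lemma log_three_ge : (1.09 : ℝ) ≤ Real.log 3 := by
  have h := Real.log_le_sub_one_of_pos (x := Real.exp 1 / 3) (by positivity)
  rw [Real.log_div (Real.exp_pos 1).ne' (by norm_num), Real.log_exp] at h
  have := Real.exp_one_lt_d9
  linarith

/-- Chernoff's bound when the level is large compared with `Λ`. -/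
lemma tail_le_of_large {μ t Λ : ℝ} (hμ : 0 < μ) (h3 : 3 * μ ≤ t) (hΛ : 200 * Λ ≤ t) :
    (Real.exp 1 * μ / t) ^ t ≤ Real.exp (-(10 * Λ)) := by
  have ht : 0 < t := by linarith
  rw [Real.rpow_def_of_pos (by positivity), Real.exp_le_exp]
  have h1 : Real.log (Real.exp 1 * μ / t) ≤ -0.09 := by
    calc Real.log (Real.exp 1 * μ / t) ≤ Real.log (Real.exp 1 / 3) := by
          apply Real.log_le_log (by positivity)
          rw [div_le_div_iff₀ ht (by norm_num)]
          nlinarith [Real.exp_pos 1]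
      _ = 1 - Real.log 3 := by
          rw [Real.log_div (Real.exp_pos 1).ne' (by norm_num), Real.log_exp]
      _ ≤ _ := by have := log_three_ge; linarith
  nlinarith

/-- Chernoff's bound when the mean is polynomially small. -/
lemma tail_le_of_small {μ t a Λ : ℝ} (hμ : 0 < μ) (h3 : 3 ≤ t) (hΛ : 0 ≤ Λ)
    (hμa : μ ≤ Real.exp (-(a * Λ))) (ha : 10 ≤ a * t) :
    (Real.exp 1 * μ / t) ^ t ≤ Real.exp (-(10 * Λ)) := by
  have ht : 0 < t := by linarith
  have he := Real.exp_one_lt_d9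
  calc (Real.exp 1 * μ / t) ^ t ≤ (Real.exp (-(a * Λ))) ^ t := by
        apply Real.rpow_le_rpow (by positivity) _ ht.le
        rw [div_le_iff₀ ht]
        have := Real.exp_pos (-(a * Λ))
        nlinarith [Real.exp_pos 1]
    _ = Real.exp (-(a * Λ) * t) := by rw [← Real.exp_mul]
    _ ≤ _ := by
        rw [Real.exp_le_exp]
        nlinarith

namespace Regime

variable {ε : ℝ} {d : ℕ → ℝ} {ℓ : ℕ → ℕ}

lemma tendsto_d (r : Regime ε d ℓ) : Tendsto d atTop atTop :=
  tendsto_atTop_mono' _ r.log_le tendsto_log_nat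

lemma tendsto_log_d (r : Regime ε d ℓ) : Tendsto (fun n => Real.log (d n)) atTop atTop :=
  Real.tendsto_log_atTop.comp r.tendsto_d

/-- As `log d ≤ ε log n`, the number `ℓ + 1` exceeds `(1 - ε)/ε > 5`. -/
lemma five_le_ell (r : Regime ε d ℓ) : ∀ᶠ n in atTop, 5 ≤ ℓ n := by
  filter_upwards [r.log_d_le, r.lt_ell_mul, tendsto_log_nat.eventually_gt_atTop 0] with n h1 h2 h3
  by_contra hcon
  have h5 : (ℓ n : ℝ) + 1 ≤ 5 := by
    have : ℓ n + 1 ≤ 5 := by omega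
    exact_mod_cast this
  have := r.eps_pos
  have := r.eps_lt
  have h6 : (ℓ n + 1) * Real.log (d n) ≤ 5 * (ε * Real.log n) := by
    have : (0 : ℝ) ≤ ℓ n + 1 := by positivity
    calc _ ≤ ((ℓ n : ℝ) + 1) * (ε * Real.log n) := by gcongr
      _ ≤ _ := by gcongr
  nlinarith

/-- Since `log d → ∞`, the radius is `o(log n)`. Hence every factor `X^ℓ` is smaller than any power
of `n`, and constants multiplying `d` inside an `ℓ`-th power can be absorbed. -/
lemma mul_ell_le (r : Regime ε d ℓ) (X : ℝ) {c : ℝ} (hc : 0 < c) :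
    ∀ᶠ n in atTop, X * ℓ n ≤ c * Real.log n := by
  filter_upwards [r.ell_mul_le, r.tendsto_log_d.eventually_ge_atTop ((|X| + 1) / c),
    tendsto_log_nat.eventually_gt_atTop 0] with n h1 h2 h3
  have hX := le_abs_self X
  have := r.eps_pos
  rw [div_le_iff₀ hc] at h2
  have hl : (0 : ℝ) ≤ ℓ n := by positivity
  calc X * ℓ n ≤ (Real.log (d n) * c) * ℓ n := by
        apply mul_le_mul_of_nonneg_right _ hl
        linarith
    _ = c * (ℓ n * Real.log (d n)) := by ring
    _ ≤ c * ((1 - ε) * Real.log n) := by gcongr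
    _ ≤ c * Real.log n := by
        gcongr
        nlinarith

lemma const_mul_pow_ell_le (r : Regime ε d ℓ) (C : ℝ) {X : ℝ} (hX : 0 < X) {c : ℝ} (hc : 0 < c) :
    ∀ᶠ n in atTop, C * X ^ ℓ n ≤ Real.exp (c * Real.log n) := by
  filter_upwards [r.mul_ell_le (Real.log X) (half_pos hc),
    eventually_log_pow_le 0 C (half_pos hc)] with n h1 h2
  rw [pow_zero, mul_one] at h2
  calc C * X ^ ℓ n ≤ Real.exp (c / 2 * Real.log n) * Real.exp (Real.log X * ℓ n) := by
        have : X ^ ℓ n = Real.exp (Real.log X * ℓ n) := by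
          rw [mul_comm, Real.exp_nat_mul, Real.exp_log hX]
        rw [this]
        gcongr
    _ ≤ Real.exp (c / 2 * Real.log n) * Real.exp (c / 2 * Real.log n) := by gcongr
    _ = _ := by rw [← Real.exp_add]; ring_nf

lemma d_pow_eq {x : ℝ} (hx : 0 < x) (k : ℕ) : x ^ k = Real.exp (k * Real.log x) := by
  rw [Real.exp_nat_mul, Real.exp_log hx]

/-- The volume of the balls of radius `ℓ` exceeds `n ^ (1 - 2ε)` by a power of `n`. -/
lemma exists_gap (r : Regime ε d ℓ) :
    ∃ γ > 0, ∀ᶠ n : ℕ in atTop, (1 - 2 * ε + γ) * Real.log n ≤ ℓ n * Real.log (d n) := by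
  have hε := r.eps_pos
  have hε' := r.eps_lt
  -- The gap comes from integrality. Since `ℓ ≥ N`, `d^ℓ` is at least `n` to the power `(1 - ε) N/(N
  -- + 1)`, and this exponent exceeds `1 - 2ε` exactly when `ε (N + 1) > 1 - ε`, which holds by the
  -- choice of `N`.
  set N := ⌊(1 - ε) / ε⌋₊ with hN
  have h1 : (N : ℝ) ≤ (1 - ε) / ε := Nat.floor_le (div_nonneg (by linarith) hε.le)
  have h2 : (1 - ε) / ε < N + 1 := Nat.lt_floor_add_one _
  rw [le_div_iff₀ hε] at h1
  rw [div_lt_iff₀ hε] at h2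
  refine ⟨(1 - ε) * N / (N + 1) - (1 - 2 * ε), ?_, ?_⟩
  · rw [gt_iff_lt, sub_pos, lt_div_iff₀ (by positivity)]
    nlinarith
  filter_upwards [r.log_d_le, r.lt_ell_mul, tendsto_log_nat.eventually_gt_atTop 0] with n g1 g2 g3
  have g4 : (N : ℝ) ≤ ℓ n := by
    by_contra hcon
    have : ℓ n + 1 ≤ N := by
      have : ℓ n < N := by exact_mod_cast not_le.1 hcon
      omega
    have : (ℓ n : ℝ) + 1 ≤ N := by exact_mod_cast this
    have : (ℓ n + 1) * Real.log (d n) ≤ N * (ε * Real.log n) :=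
      (mul_le_mul_of_nonneg_left g1 (by positivity)).trans
        (mul_le_mul_of_nonneg_right this (by positivity))
    nlinarith
  have g5 : (1 - ε) * N / (N + 1) ≤ (1 - ε) * ℓ n / (ℓ n + 1) := by
    rw [div_le_div_iff₀ (by positivity) (by positivity)]
    nlinarith
  have g6 : (1 - ε) * ℓ n / (ℓ n + 1) * Real.log n ≤ ℓ n * Real.log (d n) := by
    rw [div_mul_eq_mul_div, div_le_iff₀ (by positivity)]
    have : (0 : ℝ) ≤ ℓ n := by positivity
    nlinarith
  have g7 := mul_le_mul_of_nonneg_right g5 g3.le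
  linarith

end Regime

end Asymptotics

end SeededMatching

/-! ### Ball volumes and tail probabilities in the regime -/

namespace SeededMatching

open Finset Filter

set_option linter.unusedSectionVars false

section Asymptotics

namespace Regime

variable {ε : ℝ} {d : ℕ → ℝ} {ℓ : ℕ → ℕ}

lemma nat_pos_of_log_pos {n : ℕ} (h : 0 < Real.log n) : (0 : ℝ) < n := by
  rcases Nat.eq_zero_or_pos n with rfl | h0
  · simp at h
  · exact_mod_cast h0

lemma root_pow_eight {x : ℝ} (hx : 0 < x) : (x ^ (1 / 8 : ℝ)) ^ 8 = x := by
  rw [← Real.rpow_natCast, ← Real.rpow_mul hx.le]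
  norm_num

lemma tendsto_root (r : Regime ε d ℓ) : Tendsto (fun n => d n ^ (1 / 8 : ℝ)) atTop atTop :=
  (tendsto_rpow_atTop (by norm_num)).comp r.tendsto_d

/-- The proportion of the vertex set in a ball of radius `ℓ`. -/
lemma ball_density_le (r : Regime ε d ℓ) :
    ∀ᶠ n : ℕ in atTop, d n ^ ℓ n / n ≤ Real.exp (-(ε * Real.log n)) := by
  filter_upwards [r.ell_mul_le, r.tendsto_d.eventually_gt_atTop 0,
    tendsto_log_nat.eventually_gt_atTop 0] with n h1 h2 h3
  have hn := nat_pos_of_log_pos h3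
  rw [d_pow_eq h2]
  nth_rw 1 [← Real.exp_log hn]
  rw [← Real.exp_sub, Real.exp_le_exp]
  linarith

lemma ell_mul_bulk_le (r : Regime ε d ℓ) :
    ∀ᶠ n : ℕ in atTop, ℓ n * (4 * (3 * d n) ^ ℓ n / n) ≤ 1 / 8 := by
  filter_upwards [r.ball_density_le, r.const_mul_pow_ell_le 32 (X := 6) (by norm_num) r.eps_pos,
    r.tendsto_d.eventually_gt_atTop 0, tendsto_log_nat.eventually_gt_atTop 0] with n h1 h2 h3 h4
  have hn := nat_pos_of_log_pos h4
  have h5 : (ℓ n : ℝ) ≤ 2 ^ ℓ n := by exact_mod_cast (Nat.lt_two_pow_self).le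
  calc ℓ n * (4 * (3 * d n) ^ ℓ n / n) ≤ 2 ^ ℓ n * (4 * (3 * d n) ^ ℓ n / n) := by gcongr
    _ = 1 / 8 * (32 * 6 ^ ℓ n) * (d n ^ ℓ n / n) := by
        rw [mul_pow, show (6 : ℝ) = 2 * 3 by norm_num, mul_pow]; ring
    _ ≤ 1 / 8 * Real.exp (ε * Real.log n) * Real.exp (-(ε * Real.log n)) := by gcongr
    _ = 1 / 8 := by rw [mul_assoc, ← Real.exp_add]; simp

lemma pow_sum_le {k : ℕ} (hk : 5 ≤ k) : 16 * (9.3 : ℝ) ^ k + 1 ≤ 4 * 16 ^ k := by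
  induction k, hk using Nat.le_induction with
  | base => norm_num
  | succ k _ ih =>
    rw [pow_succ, pow_succ]
    have : (0 : ℝ) < 9.3 ^ k := by positivity
    linarith

/-- The radius up to which balls hardly meet. -/
noncomputable def innerRadius (ε : ℝ) (d : ℕ → ℝ) (n : ℕ) : ℕ :=
  ⌊(0.97 - 2 * ε) * Real.log n / Real.log (d n)⌋₊

lemma innerRadius_mul_le (r : Regime ε d ℓ) : ∀ᶠ n : ℕ in atTop,
    innerRadius ε d n * Real.log (d n) ≤ (0.97 - 2 * ε) * Real.log n ∧
    (0.97 - 2 * ε) * Real.log n < (innerRadius ε d n + 1) * Real.log (d n) := by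
  filter_upwards [r.tendsto_log_d.eventually_gt_atTop 0,
    tendsto_log_nat.eventually_gt_atTop 0] with n h1 h2
  have := r.eps_lt
  refine ⟨(le_div_iff₀ h1).1 (Nat.floor_le (div_nonneg (mul_nonneg (by linarith) h2.le) h1.le)),
    (div_lt_iff₀ h1).1 (Nat.lt_floor_add_one _)⟩

lemma innerRadius_le (r : Regime ε d ℓ) : ∀ᶠ n : ℕ in atTop, innerRadius ε d n ≤ ℓ n := by
  filter_upwards [r.innerRadius_mul_le, r.lt_ell_mul, r.tendsto_log_d.eventually_gt_atTop 0,
    tendsto_log_nat.eventually_gt_atTop 0] with n h1 h2 h3 h4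
  have := r.eps_pos
  by_contra hcon
  have : (ℓ n : ℝ) + 1 ≤ innerRadius ε d n := by exact_mod_cast not_le.1 hcon
  nlinarith

/-- The first summand is `12^ℓ d^(ℓ - 3(L+1)/8)` when `L + 1 ≤ ℓ`; with `d^ℓ ≤ n^(1-ε)` and `d^(L+1)
> n^(0.97-2ε)` it is below `n^(1-2ε)`, as `ε < 1/6`. The second is at most `16 · 9.3^ℓ d^(2ℓ)/n`,
where `9.3 = 3 · 3.1`; this is the bulk term. The factor `16^ℓ`, which also appears in `η`, absorbs
both. -/
lemma intersection_bound_le (r : Regime ε d ℓ) : ∀ᶠ n : ℕ in atTop,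
    (12 * (d n ^ (1 / 8 : ℝ)) ^ 5) ^ ℓ n *
        ((d n ^ (1 / 8 : ℝ)) ^ 3) ^ (ℓ n - (innerRadius ε d n + 1)) +
      4 * (4 * (3 * d n) ^ ℓ n / n) * (3 * (d n ^ (1 / 8 : ℝ)) ^ 8 + 2 * d n ^ (1 / 8 : ℝ)) ^ ℓ n ≤
      4 * 16 ^ ℓ n * (n : ℝ) ^ (1 - 2 * ε) := by
  filter_upwards [r.innerRadius_mul_le, r.ell_mul_le, r.tendsto_d.eventually_gt_atTop 0,
    r.tendsto_log_d.eventually_gt_atTop 0, r.tendsto_root.eventually_ge_atTop 2, r.five_le_ell,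
    tendsto_log_nat.eventually_gt_atTop 0,
    r.const_mul_pow_ell_le 1 (X := 12) (by norm_num) (c := 0.03) (by norm_num)]
    with n h1 h2 h3 h4 h5 h6 h7 h8
  have hn := nat_pos_of_log_pos h7
  have hε := r.eps_pos
  have hε' := r.eps_lt
  have hroot := root_pow_eight h3
  have hlogh : Real.log (d n ^ (1 / 8 : ℝ)) = 1 / 8 * Real.log (d n) := Real.log_rpow h3 _
  set h := d n ^ (1 / 8 : ℝ) with hh
  have hpos : 0 < h := by linarith
  set L := innerRadius ε d n
  have hrpow : (n : ℝ) ^ (1 - 2 * ε) = Real.exp ((1 - 2 * ε) * Real.log n) := by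
    rw [Real.rpow_def_of_pos hn, mul_comm]
  have hA : (12 * h ^ 5) ^ ℓ n * (h ^ 3) ^ (ℓ n - (L + 1)) ≤ (n : ℝ) ^ (1 - 2 * ε) := by
    rw [mul_pow, ← pow_mul, ← pow_mul, mul_assoc, ← pow_add, d_pow_eq hpos, hlogh, hrpow]
    rw [one_mul] at h8
    calc _ ≤ Real.exp (0.03 * Real.log n) * _ := mul_le_mul_of_nonneg_right h8 (by positivity)
      _ ≤ _ := by
        rw [← Real.exp_add, Real.exp_le_exp]
        rcases le_or_gt (L + 1) (ℓ n) with hle | hlt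
        · obtain ⟨m, hm⟩ := Nat.exists_eq_add_of_le hle
          have hm' : (ℓ n : ℝ) = L + 1 + m := by exact_mod_cast hm
          rw [show ℓ n - (L + 1) = m by omega]
          push_cast
          have e1 : (5 * (ℓ n : ℝ) + 3 * m) * (1 / 8 * Real.log (d n)) =
              ℓ n * Real.log (d n) - 3 / 8 * ((L + 1) * Real.log (d n)) := by
            rw [show (m : ℝ) = ℓ n - (L + 1) by linarith]; ring
          have e2 := mul_pos (sub_pos.2 hε') h7
          linarith
        · rw [Nat.sub_eq_zero_of_le hlt.le]
          push_cast
          nlinarith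
  have hB : 3 * h ^ 8 + 2 * h ≤ 3.1 * d n := by
    rw [hroot]
    have : (2 : ℝ) ^ 7 ≤ h ^ 7 := by gcongr
    nlinarith
  have hC : (4 * (4 * (3 * d n) ^ ℓ n / n) * (3 * h ^ 8 + 2 * h) ^ ℓ n) ≤
      16 * 9.3 ^ ℓ n * (n : ℝ) ^ (1 - 2 * ε) := by
    calc _ ≤ 4 * (4 * (3 * d n) ^ ℓ n / n) * (3.1 * d n) ^ ℓ n := by gcongr
      _ = 16 * 9.3 ^ ℓ n * (d n ^ ℓ n * d n ^ ℓ n / n) := by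
          rw [mul_pow, mul_pow, show (9.3 : ℝ) = 3 * 3.1 by norm_num, mul_pow]; ring
      _ ≤ _ := by
          gcongr
          rw [hrpow, d_pow_eq h3]
          nth_rw 1 [← Real.exp_log hn]
          rw [← Real.exp_add, ← Real.exp_sub, Real.exp_le_exp]
          linarith
  calc _ ≤ (n : ℝ) ^ (1 - 2 * ε) + 16 * 9.3 ^ ℓ n * (n : ℝ) ^ (1 - 2 * ε) := add_le_add hA hC
    _ = (16 * 9.3 ^ ℓ n + 1) * (n : ℝ) ^ (1 - 2 * ε) := by ring
    _ ≤ _ := by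
      gcongr
      exact pow_sum_le h6

lemma volume_le_mass (r : Regime ε d ℓ) : ∀ᶠ n : ℕ in atTop,
    32 * 16 ^ ℓ n * (n : ℝ) ^ (1 - 2 * ε) ≤ (n : ℝ) ^ (1 - 3 / 2 * ε) := by
  filter_upwards [r.const_mul_pow_ell_le 32 (X := 16) (by norm_num) (half_pos r.eps_pos),
    tendsto_log_nat.eventually_gt_atTop 0] with n h1 h2
  have hn := nat_pos_of_log_pos h2
  rw [Real.rpow_def_of_pos hn, Real.rpow_def_of_pos hn]
  calc _ ≤ Real.exp (ε / 2 * Real.log n) * Real.exp (Real.log n * (1 - 2 * ε)) := by gcongr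
    _ = _ := by rw [← Real.exp_add]; ring_nf

/-- The polynomial gap of `exists_gap` beats the subpolynomial factor `32 (16/κ)^ℓ`. -/
lemma volume_le_growth (r : Regime ε d ℓ) {κ : ℝ} (hκ : 0 < κ) : ∀ᶠ n : ℕ in atTop,
    32 * 16 ^ ℓ n * (n : ℝ) ^ (1 - 2 * ε) ≤ (κ * d n) ^ ℓ n := by
  obtain ⟨γ, hγ, hgap⟩ := r.exists_gap
  filter_upwards [r.const_mul_pow_ell_le 32 (X := 16 / κ) (by positivity) hγ, hgap,
    r.tendsto_d.eventually_gt_atTop 0,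
    tendsto_log_nat.eventually_gt_atTop 0] with n h1 h2 h3 h4
  have hn := nat_pos_of_log_pos h4
  rw [Real.rpow_def_of_pos hn, mul_pow, d_pow_eq h3]
  calc _ = κ ^ ℓ n * (32 * (16 / κ) ^ ℓ n * Real.exp (Real.log n * (1 - 2 * ε))) := by
        rw [div_pow]; field_simp
    _ ≤ κ ^ ℓ n * (Real.exp (γ * Real.log n) * Real.exp (Real.log n * (1 - 2 * ε))) := by gcongr
    _ ≤ _ := by
        rw [← Real.exp_add]
        gcongr
        linarith

/-- Two cases. If `h` is at least of order `log n`, a level that exceeds three times the mean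
already gives `n^(-10)`. Otherwise `d` is polylogarithmic, the mean is at most `n^(-ε/2)`, and a
level of at least `20/ε` suffices. -/
lemma return_tail_le (r : Regime ε d ℓ) : ∀ᶠ n : ℕ in atTop,
    (Real.exp 1 * (2 * (3 * d n) ^ ℓ n * (d n / n)) / (2 * d n ^ (1 / 8 : ℝ))) ^
      (2 * d n ^ (1 / 8 : ℝ)) ≤ Real.exp (-(10 * Real.log n)) := by
  have hε := r.eps_pos
  filter_upwards [r.ball_density_le, r.log_d_le, r.tendsto_d.eventually_gt_atTop 0,
    r.tendsto_root.eventually_ge_atTop (3 + 20 / ε),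
    tendsto_log_nat.eventually_gt_atTop 0,
    r.const_mul_pow_ell_le 3 (X := 3) (by norm_num) (c := ε / 8) (by positivity),
    r.const_mul_pow_ell_le 2 (X := 3) (by norm_num) (c := ε / 4) (by positivity),
    eventually_log_pow_le 8 (100 ^ 8) (c := ε / 4) (by positivity)]
    with n h1 h2 h3 h4 h5 h6 h7 h8
  have hn := nat_pos_of_log_pos h5
  have hroot := root_pow_eight h3
  have hlogh : Real.log (d n ^ (1 / 8 : ℝ)) = 1 / 8 * Real.log (d n) := Real.log_rpow h3 _
  set h := d n ^ (1 / 8 : ℝ) with hh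
  have h20 : 0 < 20 / ε := by positivity
  have hpos : 0 < h := by linarith
  rcases le_or_gt (200 * Real.log n) (2 * h) with hbig | hsmall
  · refine tail_le_of_large (by positivity) ?_ hbig
    have h9 : h ^ 7 ≤ Real.exp (7 / 8 * ε * Real.log n) := by
      rw [d_pow_eq hpos, hlogh, Real.exp_le_exp]
      push_cast
      linarith
    calc 3 * (2 * (3 * d n) ^ ℓ n * (d n / n)) = 2 * (3 * 3 ^ ℓ n * h ^ 7 * (d n ^ ℓ n / n)) * h := by
          rw [mul_pow]; nth_rw 2 [← hroot]; ring
      _ ≤ 2 * (Real.exp (ε / 8 * Real.log n) * Real.exp (7 / 8 * ε * Real.log n) *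
          Real.exp (-(ε * Real.log n))) * h := by gcongr
      _ = 2 * h := by
          rw [← Real.exp_add, ← Real.exp_add]
          ring_nf
          simp
  · have h9 : d n ≤ Real.exp (ε / 4 * Real.log n) := by
      rw [← hroot]
      calc h ^ 8 ≤ (100 * Real.log n) ^ 8 := by gcongr; linarith
        _ = 100 ^ 8 * Real.log n ^ 8 := mul_pow _ _ _
        _ ≤ _ := h8
    refine tail_le_of_small (a := ε / 2) (by positivity) (by linarith) h5.le ?_ ?_
    · calc 2 * (3 * d n) ^ ℓ n * (d n / n) = 2 * 3 ^ ℓ n * d n * (d n ^ ℓ n / n) := by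
            rw [mul_pow]; ring
        _ ≤ Real.exp (ε / 4 * Real.log n) * Real.exp (ε / 4 * Real.log n) *
            Real.exp (-(ε * Real.log n)) := by gcongr
        _ = _ := by
            rw [← Real.exp_add, ← Real.exp_add]
            ring_nf
    · have : 20 / ε ≤ h := by linarith
      rw [div_le_iff₀ hε] at this
      linarith

/-- By the choice of `B`, the level is `h^(m+1) + 3μ` with `μ` the bound on the mean. It is
therefore always at least `3μ`, and the same dichotomy applies. -/
lemma entry_tail_le (r : Regime ε d ℓ) : ∀ᶠ n : ℕ in atTop, ∀ m < ℓ n,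
    (Real.exp 1 * (4 * (3 * d n) ^ (m + ℓ n) * (d n / n)) / ((d n ^ (1 / 8 : ℝ)) ^ (m + 1) +
      4 * (3 * d n) ^ ℓ n / n * (3 * d n) ^ (m + 1))) ^ ((d n ^ (1 / 8 : ℝ)) ^ (m + 1) +
      4 * (3 * d n) ^ ℓ n / n * (3 * d n) ^ (m + 1)) ≤ Real.exp (-(10 * Real.log n)) := by
  have hε := r.eps_pos
  filter_upwards [r.ball_density_le, r.tendsto_d.eventually_gt_atTop 0,
    r.tendsto_root.eventually_ge_atTop (3 + 20 / ε),
    tendsto_log_nat.eventually_gt_atTop 0,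
    r.const_mul_pow_ell_le 4 (X := 9) (by norm_num) (c := ε / 4) (by positivity),
    eventually_log_pow_le 8 (200 ^ 8) (c := ε / 4) (by positivity)]
    with n h1 h3 h4 h5 h7 h8 m hm
  have hn := nat_pos_of_log_pos h5
  have hroot := root_pow_eight h3
  set h := d n ^ (1 / 8 : ℝ) with hh
  have h20 : 0 < 20 / ε := by positivity
  have hpos : 0 < h := by linarith
  have hhm : h ≤ h ^ (m + 1) := le_self_pow₀ (by linarith) (by omega)
  set μ := 4 * (3 * d n) ^ (m + ℓ n) * (d n / n) with hμ
  have hμpos : 0 < μ := by positivity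
  have hsum : h ^ (m + 1) + 4 * (3 * d n) ^ ℓ n / n * (3 * d n) ^ (m + 1) = h ^ (m + 1) + 3 * μ := by
    rw [hμ]; ring
  rw [hsum]
  rcases le_or_gt (200 * Real.log n) (h ^ (m + 1) + 3 * μ) with hbig | hsmall
  · exact tail_le_of_large hμpos (by linarith) hbig
  · have h9 : d n ^ (m + 1) ≤ Real.exp (ε / 4 * Real.log n) := by
      rw [← hroot, ← pow_mul, mul_comm 8, pow_mul]
      calc (h ^ (m + 1)) ^ 8 ≤ (200 * Real.log n) ^ 8 := by gcongr; linarith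
        _ = 200 ^ 8 * Real.log n ^ 8 := mul_pow _ _ _
        _ ≤ _ := h8
    refine tail_le_of_small (a := ε / 2) hμpos (by linarith) h5.le ?_ ?_
    · calc μ = 4 * (3 ^ m * 3 ^ ℓ n) * d n ^ (m + 1) * (d n ^ ℓ n / n) := by
            rw [hμ, mul_pow]; ring
        _ ≤ 4 * (3 ^ ℓ n * 3 ^ ℓ n) * d n ^ (m + 1) * (d n ^ ℓ n / n) := by
            gcongr
            norm_num
        _ = 4 * 9 ^ ℓ n * d n ^ (m + 1) * (d n ^ ℓ n / n) := by
            rw [← mul_pow]; norm_num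
        _ ≤ Real.exp (ε / 4 * Real.log n) * Real.exp (ε / 4 * Real.log n) *
            Real.exp (-(ε * Real.log n)) := by gcongr
        _ = _ := by
            rw [← Real.exp_add, ← Real.exp_add]
            ring_nf
    · have : 20 / ε ≤ h := by linarith
      rw [div_le_iff₀ hε] at this
      nlinarith

/-- The expected number of edges from a vertex to a ball of the inner radius is small. -/
lemma inner_density_le (r : Regime ε d ℓ) : ∀ᶠ n : ℕ in atTop,
    2 * (3 * d n) ^ (innerRadius ε d n + 1) * (d n / n) ≤ Real.exp (-(0.02 * Real.log n)) := by
  filter_upwards [r.innerRadius_mul_le, r.innerRadius_le, r.log_d_le,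
    r.tendsto_d.eventually_gt_atTop 0, tendsto_log_nat.eventually_gt_atTop 0,
    r.const_mul_pow_ell_le 6 (X := 3) (by norm_num) (c := 0.01) (by norm_num)]
    with n h1 h2 h3 h4 h5 h6
  have hn := nat_pos_of_log_pos h5
  -- The inner radius accounts for `n^(0.97-2ε)` and the two extra factors `d` for at most `n^(2ε)`.
  have h7 : d n ^ (innerRadius ε d n + 2) / n ≤ Real.exp (-(0.03 * Real.log n)) := by
    rw [d_pow_eq h4]
    nth_rw 1 [← Real.exp_log hn]
    rw [← Real.exp_sub, Real.exp_le_exp]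
    push_cast
    linarith
  calc _ = 6 * 3 ^ innerRadius ε d n * (d n ^ (innerRadius ε d n + 2) / n) := by
        rw [mul_pow]; ring
    _ ≤ 6 * 3 ^ ℓ n * (d n ^ (innerRadius ε d n + 2) / n) := by
        gcongr
        norm_num
    _ ≤ Real.exp (0.01 * Real.log n) * Real.exp (-(0.03 * Real.log n)) := by gcongr
    _ = _ := by rw [← Real.exp_add]; ring_nf

/-- The level `500` is `10/0.02`, for a mean of at most `n^(-0.02)`. -/
lemma inner_tail_le (r : Regime ε d ℓ) : ∀ᶠ n : ℕ in atTop,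
    (Real.exp 1 * (2 * (3 * d n) ^ (innerRadius ε d n + 1) * (d n / n)) / (500 : ℕ)) ^
      ((500 : ℕ) : ℝ) ≤ Real.exp (-(10 * Real.log n)) := by
  filter_upwards [r.inner_density_le, r.tendsto_d.eventually_gt_atTop 0,
    tendsto_log_nat.eventually_gt_atTop 0] with n h1 h2 h3
  have hn := nat_pos_of_log_pos h3
  exact tail_le_of_small (by positivity) (by norm_num) h3.le h1 (by norm_num)

/-- With `100` pairs, each costing `n^(-0.02)`, the bound is `n · n^(-2)`. -/
lemma pairs_tail_le (r : Regime ε d ℓ) : ∀ᶠ n : ℕ in atTop,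
    n * (n * (2 * (3 * d n) ^ innerRadius ε d n) * (d n / n) ^ 2) ^ 100 ≤
      Real.exp (-Real.log n) := by
  filter_upwards [r.inner_density_le, r.tendsto_d.eventually_gt_atTop 0,
    tendsto_log_nat.eventually_gt_atTop 0] with n h1 h2 h3
  have hn := nat_pos_of_log_pos h3
  have h4 : n * (2 * (3 * d n) ^ innerRadius ε d n) * (d n / n) ^ 2 ≤
      Real.exp (-(0.02 * Real.log n)) := by
    refine le_trans ?_ h1
    calc _ = 2 * (3 * d n) ^ innerRadius ε d n * d n * (d n / n) := by field_simp
      _ ≤ 2 * (3 * d n) ^ innerRadius ε d n * (3 * d n) * (d n / n) := by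
          gcongr
          linarith
      _ = _ := by ring
  calc _ ≤ n * Real.exp (-(0.02 * Real.log n)) ^ 100 := by gcongr
    _ = Real.exp (Real.log n) * Real.exp (-(0.02 * Real.log n)) ^ 100 := by
        rw [Real.exp_log hn]
    _ = _ := by
        rw [← Real.exp_nat_mul, ← Real.exp_add]
        push_cast
        ring_nf

/-- Here `M p ≤ n^(-ε/2)`, and raising this to the power `3 + 6/ε` gives less than `n^(-3)`. -/
lemma dense_tail_le (r : Regime ε d ℓ) : ∀ᶠ n : ℕ in atTop,
    n * (Real.exp 1 * ((n : ℝ) ^ (1 - 3 / 2 * ε) * (d n / n)) / (3 + 6 / ε)) ^ (3 + 6 / ε) ≤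
      Real.exp (-(2 * Real.log n)) := by
  have hε := r.eps_pos
  filter_upwards [r.log_d_le, r.tendsto_d.eventually_gt_atTop 0,
    tendsto_log_nat.eventually_gt_atTop 0] with n h1 h2 h3
  have hn := nat_pos_of_log_pos h3
  have hk : (0 : ℝ) < 6 / ε := by positivity
  have he := Real.exp_one_lt_d9
  have h4 : (n : ℝ) ^ (1 - 3 / 2 * ε) * (d n / n) ≤ Real.exp (-(ε / 2 * Real.log n)) := by
    rw [Real.rpow_def_of_pos hn]
    nth_rw 2 [← Real.exp_log hn]
    nth_rw 1 [← Real.exp_log h2]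
    rw [← Real.exp_sub, ← Real.exp_add, Real.exp_le_exp]
    linarith
  have h5 : Real.exp 1 * ((n : ℝ) ^ (1 - 3 / 2 * ε) * (d n / n)) / (3 + 6 / ε) ≤
      Real.exp (-(ε / 2 * Real.log n)) := by
    rw [div_le_iff₀ (by positivity), mul_comm]
    apply mul_le_mul h4 (by linarith) (by positivity) (by positivity)
  calc _ ≤ n * Real.exp (-(ε / 2 * Real.log n)) ^ (3 + 6 / ε) := by
        gcongr
    _ = Real.exp (Real.log n) * Real.exp (-(ε / 2 * Real.log n)) ^ (3 + 6 / ε) := by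
        rw [Real.exp_log hn]
    _ ≤ _ := by
        rw [← Real.exp_mul, ← Real.exp_add, Real.exp_le_exp]
        have : -(ε / 2 * Real.log n) * (3 + 6 / ε) = -(3 * Real.log n) - 3 / 2 * ε * Real.log n := by
          field_simp
          ring
        rw [this]
        nlinarith

end Regime

end Asymptotics

end SeededMatching

/-! ### Collecting the error terms and convergence of the success probability -/

namespace SeededMatching

open Finset Filter

set_option linter.unusedSectionVars false

section Asymptotics

lemma tendsto_log_log_nat : Tendsto (fun n : ℕ => Real.log (Real.log n)) atTop atTop :=
  Real.tendsto_log_atTop.comp tendsto_log_nat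

lemma eventually_lt_threshold (C : ℝ) : ∀ᶠ n : ℕ in atTop, C < Input.threshold n := by
  have h := (Real.isLittleO_log_id_atTop.comp_tendsto tendsto_log_nat).bound
    (c := 1 / (|C| + 2)) (by positivity)
  filter_upwards [h, tendsto_log_nat.eventually_gt_atTop 0,
    tendsto_log_log_nat.eventually_gt_atTop 0] with n h1 h2 h3
  simp only [Function.comp, id, Real.norm_eq_abs, abs_of_pos h2, abs_of_pos h3] at h1
  have h4 : |C| + 2 ≤ Real.log n / Real.log (Real.log n) := by
    rw [le_div_iff₀ h3]
    calc _ ≤ (|C| + 2) * (1 / (|C| + 2) * Real.log n) := by gcongr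
      _ = _ := by field_simp
  have := le_abs_self C
  unfold Input.threshold
  linarith

lemma eventually_threshold_le : ∀ᶠ n : ℕ in atTop, Input.threshold n + 1 ≤ Real.log n / 20 := by
  filter_upwards [tendsto_log_nat.eventually_gt_atTop 0,
    tendsto_log_log_nat.eventually_ge_atTop 20] with n h2 h3
  unfold Input.threshold
  rw [sub_add_cancel]
  gcongr

/-- Connectivity forces `np ≥ log n`, which is incompatible with `np ≤ n^ε ≤ 1`. -/
lemma eps_pos_of_dense {ε : ℝ} {p s : ℕ → unitInterval}
    (hp : ∀ᶠ n : ℕ in atTop, (n : ℝ) * (p n : ℝ) ≤ (n : ℝ) ^ ε)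
    (hIT : Tendsto (fun n : ℕ => (n : ℝ) * (p n : ℝ) * (s n : ℝ) ^ 2 - Real.log n) atTop atTop) :
    0 < ε := by
  by_contra hcon
  obtain ⟨n, h1, h2, h3⟩ := (hp.and ((hIT.eventually_ge_atTop 0).and
    (tendsto_log_nat.eventually_ge_atTop 2))).exists
  have hn := Regime.nat_pos_of_log_pos (by linarith : 0 < Real.log n)
  have h4 : (n : ℝ) ^ ε ≤ 1 :=
    Real.rpow_le_one_of_one_le_of_nonpos (by exact_mod_cast hn) (not_lt.1 hcon)
  have h5 : (s n : ℝ) ^ 2 ≤ 1 := pow_le_one₀ (s n).2.1 (s n).2.2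
  have h6 : (n : ℝ) * (p n : ℝ) * (s n : ℝ) ^ 2 ≤ (n : ℝ) * (p n : ℝ) :=
    mul_le_of_le_one_right (mul_nonneg hn.le (p n).2.1) h5
  linarith

lemma regime_tunedEll {ε : ℝ} (hε : ε < 1 / 6) {p s : ℕ → unitInterval}
    (hp : ∀ᶠ n : ℕ in atTop, (n : ℝ) * (p n : ℝ) ≤ (n : ℝ) ^ ε)
    (hIT : Tendsto (fun n : ℕ => (n : ℝ) * (p n : ℝ) * (s n : ℝ) ^ 2 - Real.log n) atTop atTop) :
    Regime ε (fun n => n * (p n : ℝ)) (fun n => tunedEll ε n (p n)) := by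
  have hε0 := eps_pos_of_dense hp hIT
  have hd : ∀ᶠ n : ℕ in atTop, Real.log n ≤ (n : ℝ) * (p n : ℝ) := by
    filter_upwards [hIT.eventually_ge_atTop 0] with n h1
    have h5 : (s n : ℝ) ^ 2 ≤ 1 := pow_le_one₀ (s n).2.1 (s n).2.2
    have h6 : (n : ℝ) * (p n : ℝ) * (s n : ℝ) ^ 2 ≤ (n : ℝ) * (p n : ℝ) :=
      mul_le_of_le_one_right (mul_nonneg n.cast_nonneg (p n).2.1) h5
    linarith
  have hlog : ∀ᶠ n : ℕ in atTop, 0 < Real.log ((n : ℝ) * (p n : ℝ)) := by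
    filter_upwards [hd, tendsto_log_nat.eventually_ge_atTop 2] with n h1 h2
    exact Real.log_pos (by linarith)
  refine ⟨hε0, hε, hd, ?_, ?_, ?_⟩
  · filter_upwards [hp, hd, tendsto_log_nat.eventually_gt_atTop 0] with n h1 h2 h3
    have hn := Regime.nat_pos_of_log_pos h3
    rw [← Real.log_rpow hn]
    exact Real.log_le_log (by linarith) h1
  · filter_upwards [hlog, tendsto_log_nat.eventually_gt_atTop 0] with n h1 h2
    exact (le_div_iff₀ h1).1 (Nat.floor_le (div_nonneg (mul_nonneg (by linarith) h2.le) h1.le))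
  · filter_upwards [hlog] with n h1
    exact (div_lt_iff₀ h1).1 (Nat.lt_floor_add_one _)

lemma degree_tail_le {d Λ x : ℝ} (hx : 0 < x) (hΛ : Real.log x = Λ) (hd : Λ ≤ d) (h0 : 0 ≤ Λ) :
    x * ((3 : ℝ) ^ (-(3 * d)) * Real.exp (2 * d)) ≤ Real.exp (-(1 / 6 * Λ)) := by
  rw [Real.rpow_def_of_pos (by norm_num), ← Real.exp_add]
  nth_rw 1 [← Real.exp_log hx]
  rw [hΛ, ← Real.exp_add, Real.exp_le_exp]
  have := log_three_ge
  nlinarith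

lemma isolated_tail_le {x q Λ : ℝ} (hx : 0 < x) (hΛ : Real.log x = Λ) (hq : q ≤ 1) :
    x * Real.exp (-((x - 1) * q)) ≤ Real.exp 1 * Real.exp (-(x * q - Λ)) := by
  nth_rw 1 [← Real.exp_log hx]
  rw [hΛ, ← Real.exp_add, ← Real.exp_add, Real.exp_le_exp]
  linarith

lemma log_eight_le : Real.log 8 ≤ 2.1 := by
  rw [show (8 : ℝ) = 2 ^ 3 by norm_num, Real.log_pow]
  have := Real.log_two_lt_d9
  push_cast
  linarith

/-- Two light vertices at prescribed places have probability at most `e^6 n^(-3/2)`, while the edge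
factors are at most `2 n d² ≤ 2 n^(4/3)` because `ε < 1/6`. The remainder is of order `n^(-1/6)`. -/
lemma low_degree_tail_le {ε x d q Λ : ℝ} (hx : 0 < x) (hΛ : Real.log x = Λ) (hε : ε < 1 / 6)
    (hd1 : 1 ≤ d) (hd : Real.log d ≤ ε * Λ) (hq : q ≤ 1) (hxq : Λ ≤ x * q) (h0 : 0 ≤ Λ) :
    (x ^ 2 * (d / x) + x ^ 3 * (d / x) ^ 2) *
      (((1 : ℝ) / 8) ^ (-(2 * (x * q / 20))) * Real.exp (-(7 / 4 * ((x - 3) * q)))) ≤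
      2 * Real.exp 6 * Real.exp (-(1 / 6 * Λ)) := by
  have hdpos : 0 < d := by linarith
  have h1 : x ^ 2 * (d / x) + x ^ 3 * (d / x) ^ 2 ≤ 2 * Real.exp (4 / 3 * Λ) := by
    have : x * d ^ 2 ≤ Real.exp (4 / 3 * Λ) := by
      nth_rw 1 [← Real.exp_log hx]
      rw [Regime.d_pow_eq hdpos, ← Real.exp_add, hΛ, Real.exp_le_exp]
      push_cast
      nlinarith
    calc _ = x * d + x * d ^ 2 := by field_simp
      _ ≤ x * d ^ 2 + x * d ^ 2 := by
          gcongr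
          exact le_self_pow₀ hd1 (by norm_num)
      _ ≤ _ := by linarith
  have h2 : ((1 : ℝ) / 8) ^ (-(2 * (x * q / 20))) * Real.exp (-(7 / 4 * ((x - 3) * q))) ≤
      Real.exp (6 - 3 / 2 * Λ) := by
    rw [Real.rpow_def_of_pos (by norm_num), ← Real.exp_add, Real.exp_le_exp, one_div, Real.log_inv]
    have := log_eight_le
    nlinarith
  calc _ ≤ 2 * Real.exp (4 / 3 * Λ) * Real.exp (6 - 3 / 2 * Λ) := by gcongr
    _ = _ := by
        rw [mul_assoc, mul_assoc, ← Real.exp_add, ← Real.exp_add]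
        ring_nf

lemma seeds_tail_le {x η Λ : ℝ} (hx : 0 < x) (hΛ : Real.log x = Λ) (h0 : 0 ≤ Λ)
    (hη : 30 * Λ ≤ η) :
    x ^ 6 * (Real.exp 1 / 4) ^ η + x ^ 4 * Real.exp (-(3 / 10 * η)) ≤
      2 * Real.exp (-(1 / 6 * Λ)) := by
  have h1 : Real.log (Real.exp 1 / 4) ≤ -0.3 := by
    have h := Real.log_le_sub_one_of_pos (x := Real.exp 1 / 4) (by positivity)
    have := Real.exp_one_lt_d9
    linarith
  have h2 : x ^ 6 * (Real.exp 1 / 4) ^ η ≤ Real.exp (-(1 / 6 * Λ)) := by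
    rw [Regime.d_pow_eq hx, Real.rpow_def_of_pos (by positivity), ← Real.exp_add,
      Real.exp_le_exp, hΛ]
    push_cast
    nlinarith
  have h3 : x ^ 4 * Real.exp (-(3 / 10 * η)) ≤ Real.exp (-(1 / 6 * Λ)) := by
    rw [Regime.d_pow_eq hx, ← Real.exp_add, Real.exp_le_exp, hΛ]
    push_cast
    nlinarith
  linarith

lemma tunedEta_eq (ε : ℝ) (n : ℕ) (p α : ℝ) :
    tunedEta ε n p α = 16 * 16 ^ tunedEll ε n p * (n : ℝ) ^ (1 - 2 * ε) * α := by
  unfold tunedEta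
  rw [pow_add, pow_mul, show (4 : ℝ) ^ 2 = 16 by norm_num]
  ring

-- Every error term is at most a constant times `n^(-1/6)` except the one for isolated vertices of
-- the common graph, which is `e^(-(nps² - log n))` up to a constant. In `8 + 2e^6`, the seeds
-- contribute `2`, the pairs of light vertices `2e^6`, and six further events `1` each.
set_option maxHeartbeats 1000000 in
lemma one_sub_prob_output_le {ε : ℝ} (hε : ε < 1 / 6) {p s α : ℕ → unitInterval}
    (hp : ∀ᶠ n : ℕ in atTop, (n : ℝ) * (p n : ℝ) ≤ (n : ℝ) ^ ε)
    (hs : ∃ s₀ : ℝ, 0 < s₀ ∧ ∀ᶠ n : ℕ in atTop, s₀ ≤ (s n : ℝ))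
    (hIT : Tendsto (fun n : ℕ => (n : ℝ) * (p n : ℝ) * (s n : ℝ) ^ 2 - Real.log n) atTop atTop)
    (hα : ∀ᶠ n : ℕ in atTop, (n : ℝ) ^ (-1 + 3 * ε) ≤ (α n : ℝ)) :
    ∀ᶠ n : ℕ in atTop, 1 - prob n (p n) (s n) (α n)
        (fun ω => (observed ε (p n) (α n) ω).output = ω.latent) ≤
      (8 + 2 * Real.exp 6) * Real.exp (-(1 / 6 * Real.log n)) +
        Real.exp 1 * Real.exp (-(n * (p n : ℝ) * (s n : ℝ) ^ 2 - Real.log n)) := by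
  have r := regime_tunedEll hε hp hIT
  have hε0 := r.eps_pos
  obtain ⟨s₀, hs₀, hs⟩ := hs
  set Ks : ℝ := 3 + 6 / ε with hKs
  have hKs0 : 0 < Ks := by positivity
  filter_upwards [hp, hs, hIT.eventually_ge_atTop 0, hα, r.log_d_le, r.ell_mul_bulk_le, r.five_le_ell,
    r.intersection_bound_le, r.volume_le_mass,
    r.volume_le_growth (κ := s₀ ^ 2 / (160 * Ks)) (by positivity),
    r.return_tail_le, r.entry_tail_le, r.inner_tail_le, r.pairs_tail_le, r.dense_tail_le,
    r.tendsto_root.eventually_ge_atTop 2, eventually_threshold_le,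
    eventually_lt_threshold ((500 : ℕ) ^ 2 + 2 * (2 * 100 * 500 : ℕ) + 1),
    tendsto_log_nat.eventually_ge_atTop (320 * Ks + 200), r.mul_ell_le 1 (c := 1) one_pos,
    eventually_log_pow_le 1 2 hε0, tendsto_natCast_atTop_atTop.eventually_ge_atTop (3 : ℝ),
    r.log_le]
    with n g_p g_s g_IT g_α g_logd g_B g_ℓ g_Mx g_M g_My g_θ₀ g_θ₂ g_θ₁ g_t g_θ₃ g_h g_thr g_thr' g_log
      g_ellle g_logpow g_n g_d
  have hΛ : 0 < Real.log n := by linarith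
  have hn := Regime.nat_pos_of_log_pos hΛ
  set q : ℝ := (p n : ℝ) * (s n : ℝ) ^ 2 with hq
  set d : ℝ := n * (p n : ℝ) with hd
  set h : ℝ := d ^ (1 / 8 : ℝ) with hh
  set ℓ := tunedEll ε n (p n) with hℓ
  set L := Regime.innerRadius ε (fun n => n * (p n : ℝ)) n with hL
  have hd1 : 1 ≤ d := by linarith
  have hpd : d / n = p n := by rw [hd]; field_simp
  have hp0 : 0 < (p n : ℝ) := by rw [← hpd]; positivity
  have hnq : n * q = d * (s n : ℝ) ^ 2 := by rw [hq, hd]; ring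
  have hnq' : Real.log n ≤ n * q := by rw [hnq]; linarith
  have hq1 : q ≤ 1 := mul_le_one₀ (p n).2.2 (sq_nonneg _) (pow_le_one₀ (s n).2.1 (s n).2.2)
  have hlogd : Real.log d ≤ ε * Real.log n := g_logd
  simp only [hpd] at g_θ₀ g_θ₁ g_θ₂ g_t g_θ₃
  have hα0 : 0 < (α n : ℝ) := lt_of_lt_of_le (Real.rpow_pos_of_pos hn _) g_α
  set η := tunedEta ε n (p n) (α n) with hη
  have hηeq : η = 16 * 16 ^ ℓ * (n : ℝ) ^ (1 - 2 * ε) * α n := tunedEta_eq _ _ _ _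
  have hηge : 30 * Real.log n ≤ η := by
    rw [pow_one] at g_logpow
    have h1 : (n : ℝ) ^ (1 - 2 * ε) * (n : ℝ) ^ (-1 + 3 * ε) = Real.exp (ε * Real.log n) := by
      rw [← Real.rpow_add hn, Real.rpow_def_of_pos hn]
      ring_nf
    calc 30 * Real.log n ≤ 16 * 1 * Real.exp (ε * Real.log n) := by linarith
      _ = 16 * 1 * ((n : ℝ) ^ (1 - 2 * ε) * (n : ℝ) ^ (-1 + 3 * ε)) := by rw [h1]
      _ ≤ 16 * 16 ^ ℓ * ((n : ℝ) ^ (1 - 2 * ε) * α n) := by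
          gcongr
          exact one_le_pow₀ (by norm_num)
      _ = η := by rw [hηeq]; ring
  have hη0 : 0 < η := by linarith
  set B : ℝ := 4 * (3 * d) ^ ℓ / n with hB
  have hB0 : 0 ≤ B := by positivity
  have hgood := one_sub_prob_le (p n) (s n) (α n)
    (fun ω => (observed ε (p n) (α n) ω).output = ω.latent)
    (fun ω => BadGraph d h B q ℓ L 500 100 ((n : ℝ) ^ (1 - 3 / 2 * ε)) Ks ω)
    (fun ω S => BadSeeds ℓ η (4 * 16 ^ ℓ * (n : ℝ) ^ (1 - 2 * ε))
      (32 * 16 ^ ℓ * (n : ℝ) ^ (1 - 2 * ε)) ω S)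
    (δ := (n : ℝ) ^ 6 * (Real.exp 1 / 4) ^ η + (n : ℝ) ^ 4 * Real.exp (-(3 / 10 * η)))
    (fun ω _ => Pr_badSeeds_le ω hα0 hη0 (le_of_eq (by rw [hηeq]; ring))
      (le_of_eq (by rw [hηeq]; ring)))
    (by positivity)
    (fun ω S π π' hG hS => output_eq_latent_of_good ω S π π' hG hS
      (Regime.root_pow_eight (by linarith)) g_h hB0 g_B (by omega) g_Mx g_thr' (by linarith) hKs0
      (by linarith) g_M (by
        refine g_My.trans ?_
        -- For large `n`, `nq/20 - 3 ≥ nq/40 ≥ s₀² d/40`, and `160 = 4 · 40`.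
        have h1 : s₀ ^ 2 / (160 * Ks) * d ≤ (n * q / 20 - 3) / (4 * Ks) := by
          rw [div_mul_eq_mul_div, div_le_div_iff₀ (by positivity) (by positivity)]
          have h2 : s₀ ^ 2 * d ≤ n * q := by
            rw [hnq, mul_comm]; gcongr
          have h3 : s₀ ^ 2 * d ≤ 40 * (n * q / 20 - 3) := by linarith
          have h4 := mul_le_mul_of_nonneg_right h3 (by positivity : 0 ≤ 4 * Ks)
          linarith
        exact pow_le_pow_left₀ (by positivity) h1 _))
  have hbad := Pr_badGraph_le (n := n) (p := p n) (s := s n) (d := d) (h := h) (B := B) (q := q)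
    (M := (n : ℝ) ^ (1 - 3 / 2 * ε)) (Ks := Ks) (ℓ := ℓ) (L := L) (K := 500) (t := 100)
    hd.symm hq.symm hp0 hd1 (by linarith) hB0 (by norm_num) hKs0 (Real.rpow_pos_of_pos hn _)
    (by exact_mod_cast g_n) g_θ₀ g_θ₁ g_θ₂ g_θ₃
    (Real.exp_le_one_iff.2 (by linarith))
  have e1 := degree_tail_le hn rfl (show Real.log n ≤ d by linarith) hΛ.le
  have e2 := isolated_tail_le hn rfl hq1
  have e3 := low_degree_tail_le hn rfl hε hd1 hlogd hq1 hnq' hΛ.le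
  rw [hpd] at e3
  have e4 := seeds_tail_le hn rfl hΛ.le hηge
  have hpow : ∀ k : ℕ, k ≤ 9 → (n : ℝ) ^ k * Real.exp (-(10 * Real.log n)) ≤
      Real.exp (-(1 / 6 * Real.log n)) := by
    intro k hk
    rw [Regime.d_pow_eq hn, ← Real.exp_add, Real.exp_le_exp]
    have : (k : ℝ) ≤ 9 := by exact_mod_cast hk
    have := mul_le_mul_of_nonneg_right this hΛ.le
    linarith
  have e5 : (n : ℝ) ^ 6 * ℓ * Real.exp (-(10 * Real.log n)) ≤ Real.exp (-(1 / 6 * Real.log n)) := by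
    refine le_trans ?_ (hpow 7 (by norm_num))
    have : (ℓ : ℝ) ≤ n := by
      have := Real.log_le_sub_one_of_pos hn
      have : 1 * (ℓ : ℝ) ≤ 1 * Real.log n := g_ellle
      linarith
    calc _ ≤ (n : ℝ) ^ 6 * n * Real.exp (-(10 * Real.log n)) := by gcongr
      _ = _ := by ring
  have e6 : Real.exp (-Real.log n) ≤ Real.exp (-(1 / 6 * Real.log n)) := by
    rw [Real.exp_le_exp]; linarith
  have e7 : n * Real.exp (-(2 * Real.log n)) ≤ Real.exp (-(1 / 6 * Real.log n)) := by
    nth_rw 1 [← Real.exp_log hn]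
    rw [← Real.exp_add, Real.exp_le_exp]; linarith
  have e8 := hpow 2 (by norm_num)
  have e9 : (n * q - Real.log n) = n * (p n : ℝ) * (s n : ℝ) ^ 2 - Real.log n := by rw [hnq, hd]
  rw [e9] at e2
  linarith

/-- The algorithm recovers the latent permutation with high probability. -/
theorem tendsto_prob_output {ε : ℝ} (hε : ε < 1 / 6) {p s α : ℕ → unitInterval}
    (hp : ∀ᶠ n : ℕ in atTop, (n : ℝ) * (p n : ℝ) ≤ (n : ℝ) ^ ε)
    (hs : ∃ s₀ : ℝ, 0 < s₀ ∧ ∀ᶠ n : ℕ in atTop, s₀ ≤ (s n : ℝ))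
    (hIT : Tendsto (fun n : ℕ => (n : ℝ) * (p n : ℝ) * (s n : ℝ) ^ 2 - Real.log n) atTop atTop)
    (hα : ∀ᶠ n : ℕ in atTop, (n : ℝ) ^ (-1 + 3 * ε) ≤ (α n : ℝ)) :
    Tendsto (fun n : ℕ => prob n (p n) (s n) (α n)
      (fun ω => (observed ε (p n) (α n) ω).output = ω.latent)) atTop (nhds 1) := by
  have hle : ∀ n : ℕ, prob n (p n) (s n) (α n)
      (fun ω => (observed ε (p n) (α n) ω).output = ω.latent) ≤ 1 := fun n => by
    have : MeasureTheory.IsProbabilityMeasure (coordinateLaw n (p n) (s n) (α n)) := by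
      unfold coordinateLaw; infer_instance
    exact MeasureTheory.measureReal_le_one
  have hlim : Tendsto (fun n : ℕ => 1 - ((8 + 2 * Real.exp 6) * Real.exp (-(1 / 6 * Real.log n)) +
      Real.exp 1 * Real.exp (-(n * (p n : ℝ) * (s n : ℝ) ^ 2 - Real.log n)))) atTop (nhds 1) := by
    have h1 : Tendsto (fun n : ℕ => Real.exp (-(1 / 6 * Real.log n))) atTop (nhds 0) :=
      Real.tendsto_exp_neg_atTop_nhds_zero.comp (tendsto_log_nat.const_mul_atTop (by norm_num))
    have h2 := Real.tendsto_exp_neg_atTop_nhds_zero.comp hIT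
    have h3 := ((h1.const_mul (8 + 2 * Real.exp 6)).add (h2.const_mul (Real.exp 1))).const_sub 1
    simpa using h3
  refine tendsto_of_tendsto_of_tendsto_of_le_of_le' hlim tendsto_const_nhds ?_
    (Eventually.of_forall hle)
  filter_upwards [one_sub_prob_output_le hε hp hs hIT hα] with n hn
  linarith

end Asymptotics

end SeededMatching

namespace SeededMatching

open Finset

/-! ### Execution and cost of programs -/

section Machine

/-- The memory after the execution of a command. -/
def Cmd.exec (c : Cmd) (σ : Store) : Store := (c.run σ).1

/-- The expression for the number of vertices. -/
def sizeExpr : Expr := .read 0 (.const 0) (.const 0)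

lemma Store.write_self (σ : Store) (a i j x : ℕ) : σ.write a i j x a i j = x := by
  simp [Store.write]

lemma Store.write_array_ne (σ : Store) {a b : ℕ} (h : b ≠ a) (i j x : ℕ) :
    σ.write a i j x b = σ b := by
  funext i' j'
  simp [Store.write, h]

lemma Store.write_entry_ne (σ : Store) (a : ℕ) {i i' : ℕ} (h : i' ≠ i) (j j' x : ℕ) :
    σ.write a i j x a i' j' = σ a i' j' := by
  simp [Store.write, h]

lemma Cmd.exec_seq (c d : Cmd) (σ : Store) : (Cmd.seq c d).exec σ = d.exec (c.exec σ) := rfl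

lemma Cmd.exec_skip (σ : Store) : Cmd.skip.exec σ = σ := rfl

lemma Cmd.exec_ifLt (e f : Expr) (c d : Cmd) (σ : Store) :
    (Cmd.ifLt e f c d).exec σ = if e.eval σ < f.eval σ then c.exec σ else d.exec σ := by
  simp only [Cmd.exec, Cmd.run]
  split_ifs <;> rfl

/-- The body of a loop, as a transformation of the memory and the step counter. -/
def loopStep (a : ℕ) (c : Cmd) (st : Store × ℕ) (k : ℕ) : Store × ℕ :=
  ((c.run (st.1.write a 0 0 k)).1, st.2 + (c.run (st.1.write a 0 0 k)).2 + 1)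

lemma foldl_range_induction {β : Type*} (f : β → ℕ → β) (b : β) (N : ℕ) (Inv : ℕ → β → Prop)
    (h0 : Inv 0 b) (hs : ∀ k < N, ∀ x, Inv k x → Inv (k + 1) (f x k)) :
    Inv N ((List.range N).foldl f b) := by
  induction N with
  | zero => simpa using h0
  | succ N ih =>
    rw [List.range_succ, List.foldl_append]
    exact hs N (by omega) _ (ih fun k hk => hs k (by omega))

lemma Cmd.exec_loop_induction {a : ℕ} {e : Expr} {c : Cmd} {σ : Store} (Inv : ℕ → Store → Prop)
    (h0 : Inv 0 σ)
    (hs : ∀ k < e.eval σ, ∀ τ, Inv k τ → Inv (k + 1) (c.exec (τ.write a 0 0 k))) :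
    Inv (e.eval σ) ((Cmd.loop a e c).exec σ) :=
  foldl_range_induction (loopStep a c) (σ, e.cost + 1) _ (fun k st => Inv k st.1) h0
    fun k hk st hst => hs k hk st.1 hst

/-- All loops run over the vertices, and the number of vertices is never overwritten. -/
def Cmd.SizeBounded : Cmd → Prop
  | .skip => True
  | .assign a _ _ _ => a ≠ 0
  | .seq c d => c.SizeBounded ∧ d.SizeBounded
  | .ifLt _ _ c d => c.SizeBounded ∧ d.SizeBounded
  | .loop a e c => a ≠ 0 ∧ e = sizeExpr ∧ c.SizeBounded

lemma Cmd.SizeBounded.exec_zero {c : Cmd} (h : c.SizeBounded) (σ : Store) :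
    c.exec σ 0 = σ 0 := by
  induction c generalizing σ with
  | skip => rfl
  | assign a i j e => exact Store.write_array_ne _ (Ne.symm h) _ _ _
  | seq c d ihc ihd => rw [Cmd.exec_seq, ihd h.2, ihc h.1]
  | ifLt e f c d ihc ihd =>
    rw [Cmd.exec_ifLt]
    split_ifs
    exacts [ihc h.1 σ, ihd h.2 σ]
  | loop a e c ih =>
    refine Cmd.exec_loop_induction (fun _ τ => τ 0 = σ 0) rfl fun k _ τ hτ => ?_
    rw [ih h.2.2, Store.write_array_ne _ (Ne.symm h.1), hτ]

/-- Array `0` is never written, so every loop at every time has the same length `n`. Each level of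
nesting raises the degree by one. -/
lemma Cmd.SizeBounded.exists_cost_le {c : Cmd} (h : c.SizeBounded) :
    ∃ K D : ℕ, ∀ σ : Store, (c.run σ).2 ≤ K * (σ 0 0 0 + 1) ^ D := by
  induction c with
  | skip => exact ⟨1, 0, fun σ => by simp [Cmd.run]⟩
  | assign a i j e => exact ⟨i.cost + j.cost + e.cost + 1, 0, fun σ => by simp [Cmd.run]⟩
  | seq c d ihc ihd =>
    obtain ⟨K, D, hc⟩ := ihc h.1
    obtain ⟨K', D', hd⟩ := ihd h.2
    refine ⟨K + K' + 1, D + D', fun σ => ?_⟩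
    have h1 := hc σ
    have h2 := hd (c.exec σ)
    rw [h.1.exec_zero] at h2
    have hpos : 1 ≤ σ 0 0 0 + 1 := by omega
    have e1 : (σ 0 0 0 + 1) ^ D ≤ (σ 0 0 0 + 1) ^ (D + D') := Nat.pow_le_pow_right hpos (by omega)
    have e2 : (σ 0 0 0 + 1) ^ D' ≤ (σ 0 0 0 + 1) ^ (D + D') := Nat.pow_le_pow_right hpos (by omega)
    have e3 : 1 ≤ (σ 0 0 0 + 1) ^ (D + D') := Nat.one_le_pow _ _ hpos
    change (c.run σ).2 + (d.run (c.exec σ)).2 + 1 ≤ _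
    nlinarith [Nat.mul_le_mul_left K e1, Nat.mul_le_mul_left K' e2]
  | ifLt e f c d ihc ihd =>
    obtain ⟨K, D, hc⟩ := ihc h.1
    obtain ⟨K', D', hd⟩ := ihd h.2
    refine ⟨K + K' + e.cost + f.cost + 1, D + D', fun σ => ?_⟩
    have h1 := hc σ
    have h2 := hd σ
    have hpos : 1 ≤ σ 0 0 0 + 1 := by omega
    have e1 : (σ 0 0 0 + 1) ^ D ≤ (σ 0 0 0 + 1) ^ (D + D') := Nat.pow_le_pow_right hpos (by omega)
    have e2 : (σ 0 0 0 + 1) ^ D' ≤ (σ 0 0 0 + 1) ^ (D + D') := Nat.pow_le_pow_right hpos (by omega)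
    have e3 : 1 ≤ (σ 0 0 0 + 1) ^ (D + D') := Nat.one_le_pow _ _ hpos
    have e4 := Nat.mul_le_mul_left K e1
    have e5 := Nat.mul_le_mul_left K' e2
    have e6 := Nat.mul_le_mul_left (e.cost + f.cost + 1) e3
    rw [Cmd.run]
    split_ifs <;> simp only <;> nlinarith
  | loop a e c ih =>
    obtain ⟨ha, rfl, hb⟩ := h
    obtain ⟨K, D, hc⟩ := ih hb
    refine ⟨K + sizeExpr.cost + 2, D + 1, fun σ => ?_⟩
    set M := (σ 0 0 0 + 1) ^ D with hM
    have key := foldl_range_induction (loopStep a c) (σ, sizeExpr.cost + 1) (sizeExpr.eval σ)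
      (fun k st => st.1 0 = σ 0 ∧ st.2 ≤ sizeExpr.cost + 1 + k * (K * M + 1)) (by simp) (by
        rintro k - st ⟨h1, h2⟩
        refine ⟨?_, ?_⟩
        · change c.exec _ 0 = _
          rw [hb.exec_zero, Store.write_array_ne _ (Ne.symm ha), h1]
        · have h3 := hc (st.1.write a 0 0 k)
          rw [Store.write_array_ne _ (Ne.symm ha), h1] at h3
          change st.2 + (c.run (st.1.write a 0 0 k)).2 + 1 ≤ _
          rw [← hM] at h3
          have : (k + 1) * (K * M + 1) = k * (K * M + 1) + (K * M + 1) := by ring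
          omega)
    refine key.2.trans ?_
    have hs : sizeExpr.eval σ = σ 0 0 0 := rfl
    rw [hs, pow_succ, ← hM]
    have hM1 : 1 ≤ M := Nat.one_le_pow _ _ (by omega)
    set n := σ 0 0 0
    set C := sizeExpr.cost
    have e1 : n * (K * M + 1) ≤ (K + 1) * (M * (n + 1)) := by nlinarith
    have e2 : C + 1 ≤ (C + 1) * (M * (n + 1)) :=
      Nat.le_mul_of_pos_right _ (Nat.mul_pos hM1 (Nat.succ_pos n))
    nlinarith

lemma succ_pow_le (n D : ℕ) : (n + 1) ^ D ≤ 2 ^ D * n ^ D + 2 ^ D := by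
  rcases Nat.eq_zero_or_pos n with rfl | h
  · have : 1 ≤ 2 ^ D := Nat.one_le_two_pow
    rw [Nat.zero_add, one_pow]
    omega
  · calc (n + 1) ^ D ≤ (2 * n) ^ D := Nat.pow_le_pow_left (by omega) _
      _ = 2 ^ D * n ^ D := mul_pow _ _ _
      _ ≤ _ := Nat.le_add_right _ _

end Machine

end SeededMatching

namespace SeededMatching

open Finset

/-! ### A language of bounded counting terms and its compilation -/

section Terms

/-- Loop-free expressions in the input arrays, the bound variables and the tables. -/
inductive Atom where
  | const (c : ℕ)
  | var (x : ℕ)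
  | data (a : ℕ) (i j : Atom)
  | tab (q x : ℕ)
  | succ (e : Atom)

/-- Terms. Bound variables range over the vertices and are numbered by their binding depth. In
`iterate step body` the body refers to a table that is obtained from the zero table by as many
applications of `step` as there are vertices. -/
inductive Tm where
  | atom (e : Atom)
  | lt (s t : Tm)
  | ite (c s t : Tm)
  | count (t : Tm)
  | countPairs (t : Tm)
  | iterate (step body : Tm)

def Atom.val (D : Store) (env : ℕ → ℕ) (tab : ℕ → ℕ → ℕ) : Atom → ℕ
  | .const c => c
  | .var x => env x
  | .data a i j => D a (i.val D env tab) (j.val D env tab)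
  | .tab q x => tab q (env x)
  | .succ e => e.val D env tab + 1

/-- The successive tables of an iteration. -/
def tableSeq (f : ℕ → (ℕ → ℕ) → ℕ → ℕ) : ℕ → ℕ → ℕ
  | 0 => fun _ => 0
  | s + 1 => f s (tableSeq f s)

/-- The value of a term below `k` bound variables and `q` tables. -/
def Tm.val (D : Store) (n : ℕ) : ℕ → ℕ → (ℕ → ℕ) → (ℕ → ℕ → ℕ) → Tm → ℕ
  | _, _, env, tab, .atom e => e.val D env tab
  | k, q, env, tab, .lt s t => if s.val D n k q env tab < t.val D n k q env tab then 1 else 0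
  | k, q, env, tab, .ite c s t =>
      if 0 < c.val D n k q env tab then s.val D n k q env tab else t.val D n k q env tab
  | k, q, env, tab, .count t =>
      ∑ i ∈ range n, if 0 < t.val D n (k + 1) q (Function.update env k i) tab then 1 else 0
  | k, q, env, tab, .countPairs t => ∑ i ∈ range n, ∑ j ∈ range n,
      if 0 < t.val D n (k + 2) q (Function.update (Function.update env k i) (k + 1) j) tab
      then 1 else 0
  | k, q, env, tab, .iterate step body =>
      body.val D n k (q + 1) env (Function.update tab q (tableSeq (fun s X m =>
        step.val D n (k + 2) (q + 1) (Function.update (Function.update env k s) (k + 1) m)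
          (Function.update tab q X)) n))

def Atom.WF (k q : ℕ) : Atom → Prop
  | .const _ => True
  | .var x => x < k
  | .data a i j => a < 100 ∧ i.WF k q ∧ j.WF k q
  | .tab j x => j < q ∧ x < k
  | .succ e => e.WF k q

/-- A term refers only to variables and tables in whose scope it is. -/
def Tm.WF : ℕ → ℕ → Tm → Prop
  | k, q, .atom e => e.WF k q
  | k, q, .lt s t => s.WF k q ∧ t.WF k q
  | k, q, .ite c s t => c.WF k q ∧ s.WF k q ∧ t.WF k q
  | k, q, .count t => t.WF (k + 1) q
  | k, q, .countPairs t => t.WF (k + 2) q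
  | k, q, .iterate step body => step.WF (k + 2) (q + 1) ∧ body.WF k (q + 1)

/-- The array of a bound variable. -/
def varArr (x : ℕ) : ℕ := 4 * x + 100

/-- The array of a table. -/
def tabArr (q : ℕ) : ℕ := 4 * q + 101

/-- The array in which the next version of a table is prepared. -/
def bufArr (q : ℕ) : ℕ := 4 * q + 102

/-- The array of an intermediate result. -/
def regArr (r : ℕ) : ℕ := 4 * r + 103

/-- A scalar as an expression. -/
def scalar (a : ℕ) : Expr := .read a (.const 0) (.const 0)

def Atom.toExpr : Atom → Expr
  | .const c => .const c
  | .var x => scalar (varArr x)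
  | .data a i j => .read a i.toExpr j.toExpr
  | .tab q x => .read (tabArr q) (scalar (varArr x)) (.const 0)
  | .succ e => .succ e.toExpr

/-- Assignment to a scalar. -/
def setScalar (a : ℕ) (e : Expr) : Cmd := .assign a (.const 0) (.const 0) e

/-- Assignment to the entry of a one-dimensional array at a bound variable. -/
def setEntry (a x : ℕ) (e : Expr) : Cmd := .assign a (scalar (varArr x)) (.const 0) e

/-- The command that evaluates a term and leaves its value in register `r`. -/
def Tm.compile : ℕ → ℕ → ℕ → Tm → Cmd
  | _, _, r, .atom e => setScalar (regArr r) e.toExpr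
  | k, q, r, .lt s t =>
      .seq (s.compile k q r) (.seq (t.compile k q (r + 1))
        (.ifLt (scalar (regArr r)) (scalar (regArr (r + 1)))
          (setScalar (regArr r) (.const 1)) (setScalar (regArr r) (.const 0))))
  | k, q, r, .ite c s t =>
      .seq (c.compile k q r) (.ifLt (.const 0) (scalar (regArr r)) (s.compile k q r)
        (t.compile k q r))
  | k, q, r, .count t =>
      .seq (setScalar (regArr r) (.const 0)) (.loop (varArr k) sizeExpr
        (.seq (t.compile (k + 1) q (r + 1)) (.ifLt (.const 0) (scalar (regArr (r + 1)))
          (setScalar (regArr r) (.succ (scalar (regArr r)))) .skip)))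
  | k, q, r, .countPairs t =>
      .seq (setScalar (regArr r) (.const 0)) (.loop (varArr k) sizeExpr
        (.loop (varArr (k + 1)) sizeExpr
          (.seq (t.compile (k + 2) q (r + 1)) (.ifLt (.const 0) (scalar (regArr (r + 1)))
            (setScalar (regArr r) (.succ (scalar (regArr r)))) .skip))))
  | k, q, r, .iterate step body =>
      .seq (.loop (varArr k) sizeExpr (.seq .skip (setEntry (tabArr q) k (.const 0)))) (.seq
        (.loop (varArr k) sizeExpr (.seq
          (.loop (varArr (k + 1)) sizeExpr (.seq (step.compile (k + 2) (q + 1) r)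
            (setEntry (bufArr q) (k + 1) (scalar (regArr r)))))
          (.loop (varArr (k + 1)) sizeExpr (.seq .skip (setEntry (tabArr q) (k + 1)
            (.read (bufArr q) (scalar (varArr (k + 1))) (.const 0)))))))
        (body.compile k (q + 1) r))

lemma Tm.sizeBounded_compile (t : Tm) (k q r : ℕ) : (t.compile k q r).SizeBounded := by
  induction t generalizing k q r <;>
    simp_all [Tm.compile, Cmd.SizeBounded, setScalar, setEntry, varArr, tabArr, bufArr, regArr]

/-- The arrays that a command for a term below `k` variables, `q` tables and `r` registers must
not change. -/
def Kept (k q r a : ℕ) : Prop :=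
  a < 100 ∨ (a % 4 = 0 ∧ a < varArr k) ∨ (a % 4 = 1 ∧ a < tabArr q) ∨ (a % 4 = 2 ∧ a < bufArr q) ∨
    (a % 4 = 3 ∧ a < regArr r)

/-- Two memories agree on the arrays that must be kept. -/
def Agree (k q r : ℕ) (σ τ : Store) : Prop := ∀ a, Kept k q r a → τ a = σ a

/-- The memory contains the input, the values of the variables and the tables. -/
structure Represents (D : Store) (n k q : ℕ) (env : ℕ → ℕ) (tab : ℕ → ℕ → ℕ) (σ : Store) :
    Prop where
  size : D 0 0 0 = n
  data : ∀ a < 100, σ a = D a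
  env_lt : ∀ x < k, env x < n
  var : ∀ x < k, σ (varArr x) 0 0 = env x
  tab : ∀ j < q, ∀ i < n, σ (tabArr j) i 0 = tab j i

lemma Kept.mono {k q r k' q' r' a : ℕ} (hk : k ≤ k') (hq : q ≤ q') (hr : r ≤ r')
    (h : Kept k q r a) : Kept k' q' r' a := by
  unfold Kept varArr tabArr bufArr regArr at *
  omega

lemma Agree.mono {k q r k' q' r' : ℕ} {σ τ : Store} (hk : k ≤ k') (hq : q ≤ q') (hr : r ≤ r')
    (h : Agree k' q' r' σ τ) : Agree k q r σ τ := fun a ha => h a (ha.mono hk hq hr)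

lemma Agree.refl (k q r : ℕ) (σ : Store) : Agree k q r σ σ := fun _ _ => rfl

lemma Agree.trans {k q r : ℕ} {σ τ υ : Store} (h : Agree k q r σ τ) (h' : Agree k q r τ υ) :
    Agree k q r σ υ := fun a ha => (h' a ha).trans (h a ha)

lemma Agree.write {k q r : ℕ} {σ τ : Store} (h : Agree k q r σ τ) {a : ℕ} (ha : ¬ Kept k q r a)
    (i j x : ℕ) : Agree k q r σ (τ.write a i j x) := fun b hb => by
  rw [Store.write_array_ne _ (fun e : b = a => ha (e ▸ hb)), h b hb]

/-- Variables, tables, buffers and registers occupy the residue classes `0, 1, 2, 3` modulo `4` from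
`100` on, so they never collide with each other or with the input. -/
lemma kept_varArr {k q r x : ℕ} : Kept k q r (varArr x) ↔ x < k := by
  unfold Kept varArr tabArr bufArr regArr; omega

lemma kept_tabArr {k q r x : ℕ} : Kept k q r (tabArr x) ↔ x < q := by
  unfold Kept varArr tabArr bufArr regArr; omega

lemma kept_bufArr {k q r x : ℕ} : Kept k q r (bufArr x) ↔ x < q := by
  unfold Kept varArr tabArr bufArr regArr; omega

lemma kept_regArr {k q r x : ℕ} : Kept k q r (regArr x) ↔ x < r := by
  unfold Kept varArr tabArr bufArr regArr; omega

lemma kept_of_lt {k q r a : ℕ} (h : a < 100) : Kept k q r a := Or.inl h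

lemma Represents.of_agree {D : Store} {n k q r : ℕ} {env : ℕ → ℕ} {tab : ℕ → ℕ → ℕ} {σ τ : Store}
    (h : Represents D n k q env tab σ) (ha : Agree k q r σ τ) :
    Represents D n k q env tab τ where
  size := h.size
  data a h' := by rw [ha a (kept_of_lt h'), h.data a h']
  env_lt := h.env_lt
  var x hx := by rw [ha _ (kept_varArr.2 hx), h.var x hx]
  tab j hj i hi := by rw [ha _ (kept_tabArr.2 hj), h.tab j hj i hi]

lemma Represents.eval_size {D : Store} {n k q : ℕ} {env : ℕ → ℕ} {tab : ℕ → ℕ → ℕ} {σ : Store}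
    (h : Represents D n k q env tab σ) : sizeExpr.eval σ = n := by
  rw [← h.size, ← h.data 0 (by norm_num)]
  rfl

/-- Binding a variable. -/
lemma Represents.bind {D : Store} {n k q : ℕ} {env : ℕ → ℕ} {tab : ℕ → ℕ → ℕ} {σ : Store}
    (h : Represents D n k q env tab σ) {i : ℕ} (hi : i < n) :
    Represents D n (k + 1) q (Function.update env k i) tab (σ.write (varArr k) 0 0 i) where
  size := h.size
  data a h' := by
    rw [Store.write_array_ne _ (by unfold varArr; omega), h.data a h']
  env_lt x hx := by
    rcases eq_or_ne x k with rfl | hne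
    · simpa using hi
    · rw [Function.update_of_ne hne]
      exact h.env_lt x (by omega)
  var x hx := by
    rcases eq_or_ne x k with rfl | hne
    · rw [Store.write_self, Function.update_self]
    · rw [Function.update_of_ne hne, Store.write_array_ne _ (by unfold varArr; omega)]
      exact h.var x (by omega)
  tab j hj i hi := by
    rw [Store.write_array_ne _ (by unfold tabArr varArr; omega), h.tab j hj i hi]

/-- Introducing a table. -/
lemma Represents.setTab {D : Store} {n k q : ℕ} {env : ℕ → ℕ} {tab : ℕ → ℕ → ℕ} {σ : Store}
    (h : Represents D n k q env tab σ) {X : ℕ → ℕ} (hX : ∀ i < n, σ (tabArr q) i 0 = X i) :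
    Represents D n k (q + 1) env (Function.update tab q X) σ where
  size := h.size
  data := h.data
  env_lt := h.env_lt
  var := h.var
  tab j hj i hi := by
    rcases eq_or_ne j q with rfl | hne
    · rw [Function.update_self, hX i hi]
    · rw [Function.update_of_ne hne, h.tab j (by omega) i hi]

lemma eval_scalar (σ : Store) (a : ℕ) : (scalar a).eval σ = σ a 0 0 := rfl

lemma Atom.eval_toExpr {D : Store} {n k q : ℕ} {env : ℕ → ℕ} {tab : ℕ → ℕ → ℕ} {σ : Store}
    (h : Represents D n k q env tab σ) (e : Atom) (he : e.WF k q) :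
    e.toExpr.eval σ = e.val D env tab := by
  induction e with
  | const c => rfl
  | var x => exact h.var x he
  | data a i j hi hj =>
    obtain ⟨h1, h2, h3⟩ := he
    rw [Atom.toExpr, Expr.eval, hi h2, hj h3, h.data a h1]
    rfl
  | tab j x =>
    rw [Atom.toExpr, Expr.eval, eval_scalar, h.var x he.2, Expr.eval,
      h.tab j he.1 _ (h.env_lt x he.2)]
    rfl
  | succ e ih =>
    rw [Atom.toExpr, Expr.eval, ih he]
    rfl

lemma exec_setScalar (a : ℕ) (e : Expr) (σ : Store) :
    (setScalar a e).exec σ = σ.write a 0 0 (e.eval σ) := rfl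

lemma exec_setEntry (a x : ℕ) (e : Expr) (σ : Store) :
    (setEntry a x e).exec σ = σ.write a (σ (varArr x) 0 0) 0 (e.eval σ) := rfl

/-- A command evaluates a term, whatever the memory. -/
def Computes (D : Store) (n k q r : ℕ) (env : ℕ → ℕ) (tab : ℕ → ℕ → ℕ) (c : Cmd) (x : ℕ) : Prop :=
  ∀ σ, Represents D n k q env tab σ → c.exec σ (regArr r) 0 0 = x ∧ Agree k q r σ (c.exec σ)

/-- A loop that increases a register by the given amounts. -/
lemma exec_loop_add {D : Store} {n k q r : ℕ} {env : ℕ → ℕ} {tab : ℕ → ℕ → ℕ} {σ : Store}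
    (h : Represents D n k q env tab σ) {c : Cmd} {f : ℕ → ℕ}
    (hc : ∀ i < n, ∀ τ, Represents D n (k + 1) q (Function.update env k i) tab τ →
      c.exec τ (regArr r) 0 0 = τ (regArr r) 0 0 + f i ∧ Agree (k + 1) q r τ (c.exec τ)) :
    (Cmd.loop (varArr k) sizeExpr c).exec σ (regArr r) 0 0 =
        σ (regArr r) 0 0 + ∑ i ∈ range n, f i ∧
      Agree k q r σ ((Cmd.loop (varArr k) sizeExpr c).exec σ) := by
  have key := Cmd.exec_loop_induction (a := varArr k) (e := sizeExpr) (c := c) (σ := σ)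
    (fun i τ => τ (regArr r) 0 0 = σ (regArr r) 0 0 + ∑ j ∈ range i, f j ∧ Agree k q r σ τ)
    ⟨by simp, Agree.refl _ _ _ _⟩ (by
      rintro i hi τ ⟨h1, h2⟩
      rw [h.eval_size] at hi
      obtain ⟨h3, h4⟩ := hc i hi _ ((h.of_agree h2).bind hi)
      refine ⟨?_, ?_⟩
      · rw [h3, Store.write_array_ne _ (by unfold varArr regArr; omega), h1, sum_range_succ]
        ring
      · exact (h2.write (by rw [kept_varArr]; omega) _ _ _).trans
          (h4.mono (Nat.le_succ k) le_rfl le_rfl))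
  rwa [h.eval_size] at key

/-- A loop that fills the first `n` entries of an array. -/
lemma exec_loop_fill {D : Store} {n k q r : ℕ} {env : ℕ → ℕ} {tab : ℕ → ℕ → ℕ} {σ : Store}
    (h : Represents D n k q env tab σ) {a : ℕ} {c : Cmd} {e : Expr} {f : ℕ → ℕ}
    {P : Store → Prop} (hP : P σ)
    (ha : ¬ Kept k q r a)
    (hc : ∀ i < n, ∀ τ, P τ → Represents D n k q env tab τ →
      e.eval (c.exec (τ.write (varArr k) 0 0 i)) = f i ∧
      c.exec (τ.write (varArr k) 0 0 i) (varArr k) 0 0 = i ∧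
      c.exec (τ.write (varArr k) 0 0 i) a = τ a ∧
      Agree k q r τ (c.exec (τ.write (varArr k) 0 0 i)) ∧
      ∀ x, P ((c.exec (τ.write (varArr k) 0 0 i)).write a i 0 x)) :
    (∀ i < n, (Cmd.loop (varArr k) sizeExpr (.seq c (setEntry a k e))).exec σ a i 0 = f i) ∧
      Agree k q r σ ((Cmd.loop (varArr k) sizeExpr (.seq c (setEntry a k e))).exec σ) ∧
      P ((Cmd.loop (varArr k) sizeExpr (.seq c (setEntry a k e))).exec σ) := by
  have key := Cmd.exec_loop_induction (a := varArr k) (e := sizeExpr)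
    (c := .seq c (setEntry a k e)) (σ := σ)
    (fun i τ => (∀ j < i, τ a j 0 = f j) ∧ Agree k q r σ τ ∧ P τ)
    ⟨by simp, Agree.refl _ _ _ _, hP⟩ (by
      rintro i hi τ ⟨h1, h2, h2'⟩
      rw [h.eval_size] at hi
      obtain ⟨h3, h4, h5, h6, h7⟩ := hc i hi τ h2' (h.of_agree h2)
      rw [Cmd.exec_seq, exec_setEntry, h4, h3]
      refine ⟨fun j hj => ?_, (h2.trans h6).write ha _ _ _, h7 _⟩
      rcases eq_or_ne j i with rfl | hne
      · rw [Store.write_self]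
      · rw [Store.write_entry_ne _ _ hne, h5, h1 j (by omega)])
  rwa [h.eval_size] at key

end Terms

end SeededMatching

/-! ### Correctness of the compilation -/

namespace SeededMatching

open Finset

section Terms

lemma exec_increment {D : Store} {n k q r x : ℕ} {env : ℕ → ℕ} {tab : ℕ → ℕ → ℕ} {c : Cmd}
    (hc : Computes D n k q (r + 1) env tab c x) {τ : Store} (hτ : Represents D n k q env tab τ) :
    (Cmd.seq c (.ifLt (.const 0) (scalar (regArr (r + 1)))
      (setScalar (regArr r) (.succ (scalar (regArr r)))) .skip)).exec τ (regArr r) 0 0 =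
        τ (regArr r) 0 0 + (if 0 < x then 1 else 0) ∧
      Agree k q r τ ((Cmd.seq c (.ifLt (.const 0) (scalar (regArr (r + 1)))
        (setScalar (regArr r) (.succ (scalar (regArr r)))) .skip)).exec τ) := by
  obtain ⟨h1, h2⟩ := hc τ hτ
  have h3 : c.exec τ (regArr r) = τ (regArr r) := h2 _ (kept_regArr.2 (Nat.lt_succ_self r))
  have h4 : Agree k q r τ (c.exec τ) := h2.mono le_rfl le_rfl (Nat.le_succ r)
  rw [Cmd.exec_seq, Cmd.exec_ifLt, eval_scalar, h1, Expr.eval]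
  split_ifs with hx
  · rw [exec_setScalar, Store.write_self]
    refine ⟨?_, h4.write (by rw [kept_regArr]; omega) _ _ _⟩
    rw [Expr.eval, eval_scalar, h3]
  · rw [Cmd.exec_skip, h3]
    exact ⟨rfl, h4⟩

/-- One step of an iteration: the next table is prepared in the buffer and then copied. -/
lemma exec_nextTable {D : Store} {n k q r : ℕ} {env : ℕ → ℕ} {tab : ℕ → ℕ → ℕ} {c : Cmd}
    {X Y : ℕ → ℕ}
    (hc : ∀ i < n, Computes D n (k + 1) (q + 1) r (Function.update env k i)
      (Function.update tab q X) c (Y i))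
    {σ : Store} (hσ : Represents D n k q env tab σ) (hX : ∀ i < n, σ (tabArr q) i 0 = X i) :
    (∀ i < n, (Cmd.seq (.loop (varArr k) sizeExpr (.seq c (setEntry (bufArr q) k
        (scalar (regArr r))))) (.loop (varArr k) sizeExpr (.seq .skip (setEntry (tabArr q) k
          (.read (bufArr q) (scalar (varArr k)) (.const 0)))))).exec σ (tabArr q) i 0 = Y i) ∧
      Agree k q r σ ((Cmd.seq (.loop (varArr k) sizeExpr (.seq c (setEntry (bufArr q) k
        (scalar (regArr r))))) (.loop (varArr k) sizeExpr (.seq .skip (setEntry (tabArr q) k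
          (.read (bufArr q) (scalar (varArr k)) (.const 0)))))).exec σ) := by
  -- All new entries are computed from the old table, so the invariant carried through the loop is
  -- that the old table is intact. During the copying below it is the buffer that must stay intact.
  obtain ⟨h1, h2, -⟩ := exec_loop_fill (r := r) hσ (a := bufArr q) (c := c)
    (e := scalar (regArr r)) (f := Y) (P := fun τ => τ (tabArr q) = σ (tabArr q)) rfl
    (by rw [kept_bufArr]; omega) (by
      intro i hi τ hP hτ
      have hrep := (hτ.bind hi).setTab (X := X) (by
        intro j hj
        rw [Store.write_array_ne _ (by unfold varArr tabArr; omega), hP, hX j hj])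
      obtain ⟨g1, g2⟩ := hc i hi _ hrep
      have g3 : ∀ a, a ≠ varArr k → Kept (k + 1) (q + 1) r a →
          c.exec (τ.write (varArr k) 0 0 i) a = τ a := fun a ha ha' => by
        rw [g2 a ha', Store.write_array_ne _ ha]
      refine ⟨g1, ?_, g3 _ (by unfold varArr bufArr; omega) (kept_bufArr.2 (by omega)), ?_, ?_⟩
      · rw [g2 _ (kept_varArr.2 (by omega)), Store.write_self]
      · intro a ha
        exact g3 a (fun e => by rw [e, kept_varArr] at ha; omega)
          (ha.mono (by omega) (by omega) le_rfl)
      · intro x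
        rw [Store.write_array_ne _ (by unfold tabArr bufArr; omega),
          g3 _ (by unfold varArr tabArr; omega) (kept_tabArr.2 (by omega)), hP])
  set σ' := (Cmd.loop (varArr k) sizeExpr (.seq c (setEntry (bufArr q) k
    (scalar (regArr r))))).exec σ with hσ'
  obtain ⟨h3, h4, -⟩ := exec_loop_fill (r := r) (hσ.of_agree h2) (a := tabArr q) (c := .skip)
    (e := .read (bufArr q) (scalar (varArr k)) (.const 0)) (f := Y)
    (P := fun τ => ∀ i < n, τ (bufArr q) i 0 = Y i) h1
    (by rw [kept_tabArr]; omega) (by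
      intro i hi τ hP hτ
      rw [Cmd.exec_skip, Expr.eval, eval_scalar, Store.write_self, Expr.eval,
        Store.write_array_ne _ (by unfold varArr bufArr; omega),
        Store.write_array_ne _ (by unfold varArr tabArr; omega)]
      refine ⟨hP i hi, rfl, rfl, (Agree.refl _ _ _ _).write (by rw [kept_varArr]; omega) _ _ _, ?_⟩
      intro x j hj
      rw [Store.write_array_ne _ (by unfold tabArr bufArr; omega),
        Store.write_array_ne _ (by unfold varArr bufArr; omega), hP j hj])
  rw [Cmd.exec_seq]
  exact ⟨h3, h2.trans h4⟩

/-- Induction on the term. The frame condition in `Computes` is what lets subterms be composed: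
evaluating one of them leaves the bound variables, the tables in scope and all lower registers
unchanged. -/
theorem Tm.computes_compile (D : Store) (n : ℕ) (t : Tm) : ∀ (k q r : ℕ) (env : ℕ → ℕ)
    (tab : ℕ → ℕ → ℕ), t.WF k q →
    Computes D n k q r env tab (t.compile k q r) (t.val D n k q env tab) := by
  induction t with
  | atom e =>
    intro k q r env tab hwf σ hσ
    rw [Tm.compile, exec_setScalar, Store.write_self]
    exact ⟨Atom.eval_toExpr hσ e hwf,
      (Agree.refl _ _ _ _).write (by rw [kept_regArr]; omega) _ _ _⟩
  | lt s t ihs iht =>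
    intro k q r env tab hwf σ hσ
    obtain ⟨h1, h2⟩ := ihs k q r env tab hwf.1 σ hσ
    obtain ⟨h3, h4⟩ := iht k q (r + 1) env tab hwf.2 _ (hσ.of_agree h2)
    rw [Tm.compile, Cmd.exec_seq, Cmd.exec_seq, Cmd.exec_ifLt, eval_scalar, eval_scalar, h3,
      h4 _ (kept_regArr.2 (Nat.lt_succ_self r)), h1, Tm.val]
    have h5 := h2.trans (h4.mono le_rfl le_rfl (Nat.le_succ r))
    have h6 : ∀ x, Agree k q r σ (((t.compile k q (r + 1)).exec
        ((s.compile k q r).exec σ)).write (regArr r) 0 0 x) :=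
      fun x => h5.write (by rw [kept_regArr]; omega) _ _ _
    split_ifs <;> rw [exec_setScalar, Store.write_self] <;> exact ⟨rfl, h6 _⟩
  | ite c s t ihc ihs iht =>
    intro k q r env tab hwf σ hσ
    obtain ⟨h1, h2⟩ := ihc k q r env tab hwf.1 σ hσ
    have hσ' := hσ.of_agree h2
    rw [Tm.compile, Cmd.exec_seq, Cmd.exec_ifLt, eval_scalar, h1, Tm.val, Expr.eval]
    split_ifs
    · obtain ⟨h3, h4⟩ := ihs k q r env tab hwf.2.1 _ hσ'
      exact ⟨h3, h2.trans h4⟩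
    · obtain ⟨h3, h4⟩ := iht k q r env tab hwf.2.2 _ hσ'
      exact ⟨h3, h2.trans h4⟩
  | count t ih =>
    intro k q r env tab hwf σ hσ
    have h0 : Agree k q r σ (σ.write (regArr r) 0 0 0) :=
      (Agree.refl _ _ _ _).write (by rw [kept_regArr]; omega) _ _ _
    obtain ⟨h1, h2⟩ := exec_loop_add (r := r) (hσ.of_agree h0) fun i _ τ hτ =>
      exec_increment (ih (k + 1) q (r + 1) (Function.update env k i) tab hwf) hτ
    rw [Store.write_self, zero_add] at h1
    exact ⟨h1, h0.trans h2⟩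
  | countPairs t ih =>
    intro k q r env tab hwf σ hσ
    have h0 : Agree k q r σ (σ.write (regArr r) 0 0 0) :=
      (Agree.refl _ _ _ _).write (by rw [kept_regArr]; omega) _ _ _
    obtain ⟨h1, h2⟩ := exec_loop_add (r := r) (hσ.of_agree h0) fun i _ τ hτ =>
      exec_loop_add (r := r) hτ fun j _ υ hυ =>
        exec_increment (ih (k + 2) q (r + 1) _ tab hwf) hυ
    rw [Store.write_self, zero_add] at h1
    exact ⟨h1, h0.trans h2⟩
  | iterate step body ihs ihb =>
    intro k q r env tab hwf σ hσ
    set X := tableSeq (fun s X m => step.val D n (k + 2) (q + 1)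
      (Function.update (Function.update env k s) (k + 1) m) (Function.update tab q X)) with hX
    obtain ⟨h1, h2, -⟩ := exec_loop_fill (r := r) hσ (a := tabArr q) (c := .skip)
      (e := .const 0) (f := fun _ => 0) (P := fun _ => True) trivial
      (by rw [kept_tabArr]; omega) (by
        intro i hi τ _ hτ
        rw [Cmd.exec_skip, Store.write_self,
          Store.write_array_ne _ (by unfold varArr tabArr; omega)]
        exact ⟨rfl, rfl, rfl, (Agree.refl _ _ _ _).write (by rw [kept_varArr]; omega) _ _ _,
          fun _ => trivial⟩)
    set σ₁ := (Cmd.loop (varArr k) sizeExpr (.seq .skip (setEntry (tabArr q) k (.const 0)))).exec σ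
    have key := Cmd.exec_loop_induction (a := varArr k) (e := sizeExpr)
      (c := .seq (.loop (varArr (k + 1)) sizeExpr (.seq (step.compile (k + 2) (q + 1) r)
            (setEntry (bufArr q) (k + 1) (scalar (regArr r)))))
          (.loop (varArr (k + 1)) sizeExpr (.seq .skip (setEntry (tabArr q) (k + 1)
            (.read (bufArr q) (scalar (varArr (k + 1))) (.const 0)))))) (σ := σ₁)
      (fun s τ => (∀ i < n, τ (tabArr q) i 0 = X s i) ∧ Agree k q r σ τ) ⟨h1, h2⟩ (by
        rintro s hs τ ⟨g1, g2⟩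
        rw [(hσ.of_agree h2).eval_size] at hs
        have hrep := (hσ.of_agree g2).bind hs
        obtain ⟨g3, g4⟩ := exec_nextTable (r := r) (c := step.compile (k + 2) (q + 1) r)
          (X := X s) (Y := X (s + 1))
          (fun i _ => ihs (k + 2) (q + 1) r _ _ hwf.1) hrep (by
            intro j hj
            rw [Store.write_array_ne _ (by unfold varArr tabArr; omega), g1 j hj])
        exact ⟨g3, (g2.write (by rw [kept_varArr]; omega) _ _ _).trans
          (g4.mono (Nat.le_succ k) le_rfl le_rfl)⟩)
    rw [(hσ.of_agree h2).eval_size] at key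
    obtain ⟨h3, h4⟩ := ihb k (q + 1) r env (Function.update tab q (X n)) hwf.2 _
      ((hσ.of_agree key.2).setTab key.1)
    exact ⟨h3, key.2.trans (h4.mono le_rfl (Nat.le_succ q) le_rfl)⟩

/-- The program that stores the values of a term with one free variable in an array. -/
def Tm.tabulate (a : ℕ) (t : Tm) : Cmd :=
  .loop (varArr 0) sizeExpr (.seq (t.compile 1 0 0) (setEntry a 0 (scalar (regArr 0))))

lemma Tm.sizeBounded_tabulate {a : ℕ} (ha : a ≠ 0) (t : Tm) : (t.tabulate a).SizeBounded :=
  ⟨by unfold varArr; omega, rfl, t.sizeBounded_compile 1 0 0, ha⟩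

/-- The output array changes while the loop runs, so the value of the term must be known for every
memory that differs from the initial one only in that array. -/
theorem Tm.exec_tabulate {a n : ℕ} (ha : a < 100) (ha0 : a ≠ 0) {D : Store} (hn : D 0 0 0 = n)
    (t : Tm) (hwf : t.WF 1 0) {f : ℕ → ℕ}
    (hf : ∀ D' : Store, (∀ b, b ≠ a → D' b = D b) → ∀ i < n,
      t.val D' n 1 0 (Function.update (fun _ => 0) 0 i) (fun _ _ => 0) = f i) :
    ∀ i < n, (t.tabulate a).exec D a i 0 = f i := by
  have key := Cmd.exec_loop_induction (a := varArr 0) (e := sizeExpr)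
    (c := .seq (t.compile 1 0 0) (setEntry a 0 (scalar (regArr 0)))) (σ := D)
    (fun i τ => (∀ j < i, τ a j 0 = f j) ∧ ∀ b < 100, b ≠ a → τ b = D b)
    ⟨by simp, fun _ _ _ => rfl⟩ (by
      rintro i hi τ ⟨h1, h2⟩
      change i < D 0 0 0 at hi
      rw [hn] at hi
      set D' : Store := fun b => if b < 100 then τ b else D b with hD'
      have hrep : Represents D' n 0 0 (fun _ => 0) (fun _ _ => 0) τ :=
        { size := by simp [hD', h2 0 (by norm_num) (Ne.symm ha0), hn]
          data := fun b hb => by simp [hD', hb]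
          env_lt := fun x hx => by omega
          var := fun x hx => by omega
          tab := fun x hx => by omega }
      obtain ⟨h3, h4⟩ := t.computes_compile D' n 1 0 0 _ _ hwf _ (hrep.bind hi)
      rw [hf D' (fun b hb => by
        by_cases hb' : b < 100
        · simp [hD', hb', h2 b hb' hb]
        · simp [hD', hb']) i hi] at h3
      have h5 : ∀ b < 100, (t.compile 1 0 0).exec (τ.write (varArr 0) 0 0 i) b = τ b := by
        intro b hb
        rw [h4 b (kept_of_lt hb), Store.write_array_ne _ (by unfold varArr; omega)]
      rw [Cmd.exec_seq, exec_setEntry, eval_scalar, h3, h4 _ (kept_varArr.2 one_pos),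
        Store.write_self]
      refine ⟨fun j hj => ?_, fun b hb hb' => ?_⟩
      · rcases eq_or_ne j i with rfl | hne
        · rw [Store.write_self]
        · rw [Store.write_entry_ne _ _ hne, h5 a ha, h1 j (by omega)]
      · rw [Store.write_array_ne _ hb', h5 b hb, h2 b hb hb'])
  intro i hi
  rw [← hn] at hi
  exact key.1 i hi

end Terms

end SeededMatching

namespace SeededMatching

open Finset

/-! ### The matching algorithm as a term -/

section Logic

/-- The truth of a term. -/
def Holds (D : Store) (n k q : ℕ) (env : ℕ → ℕ) (tab : ℕ → ℕ → ℕ) (t : Tm) : Prop :=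
  0 < t.val D n k q env tab

namespace Tm

def neg (t : Tm) : Tm := .lt t (.atom (.const 1))

def conj (s t : Tm) : Tm := .ite s t (.atom (.const 0))

def disj (s t : Tm) : Tm := .ite s (.atom (.const 1)) t

def all (t : Tm) : Tm := neg (.count (neg t))

def eq (a b : Atom) : Tm := conj (neg (.lt (.atom a) (.atom b))) (neg (.lt (.atom b) (.atom a)))

end Tm

variable {D : Store} {n k q : ℕ} {env : ℕ → ℕ} {tab : ℕ → ℕ → ℕ} {s t : Tm}

lemma holds_atom {e : Atom} : Holds D n k q env tab (.atom e) ↔ 0 < e.val D env tab := Iff.rfl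

lemma holds_lt : Holds D n k q env tab (.lt s t) ↔
    s.val D n k q env tab < t.val D n k q env tab := by
  unfold Holds
  rw [Tm.val]
  split_ifs with h <;> simp [h]

lemma holds_neg : Holds D n k q env tab t.neg ↔ ¬ Holds D n k q env tab t := by
  unfold Tm.neg
  rw [holds_lt, Holds, not_lt, Nat.le_zero, ← Nat.lt_one_iff]
  rfl

lemma holds_conj : Holds D n k q env tab (s.conj t) ↔
    Holds D n k q env tab s ∧ Holds D n k q env tab t := by
  unfold Holds Tm.conj
  rw [Tm.val]
  split_ifs with h
  · simp [h]
  · simp [h, Tm.val, Atom.val]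

lemma holds_disj : Holds D n k q env tab (s.disj t) ↔
    Holds D n k q env tab s ∨ Holds D n k q env tab t := by
  unfold Holds Tm.disj
  rw [Tm.val]
  split_ifs with h
  · simp [h, Tm.val, Atom.val]
  · simp [h]

lemma holds_count : Holds D n k q env tab (.count t) ↔
    ∃ a : Fin n, Holds D n (k + 1) q (Function.update env k a) tab t := by
  unfold Holds
  rw [Tm.val, Finset.sum_pos_iff]
  constructor
  · rintro ⟨i, hi, h⟩
    refine ⟨⟨i, mem_range.1 hi⟩, ?_⟩
    by_contra hcon
    rw [if_neg hcon] at h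
    exact lt_irrefl _ h
  · rintro ⟨a, ha⟩
    exact ⟨a, mem_range.2 a.2, by rw [if_pos ha]; exact one_pos⟩

lemma holds_all : Holds D n k q env tab t.all ↔
    ∀ a : Fin n, Holds D n (k + 1) q (Function.update env k a) tab t := by
  unfold Tm.all
  simp only [holds_neg, holds_count, not_exists, not_not]

lemma holds_eq {a b : Atom} : Holds D n k q env tab (Tm.eq a b) ↔
    a.val D env tab = b.val D env tab := by
  unfold Tm.eq
  simp only [holds_conj, holds_neg, holds_lt]
  change ¬ (a.val D env tab < b.val D env tab) ∧ ¬ (b.val D env tab < a.val D env tab) ↔ _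
  omega

lemma update_eq_of_lt {x : ℕ} (hx : x < k) {a i : ℕ} (h : env x = a) :
    Function.update env k i x = a := by
  rw [Function.update_of_ne hx.ne, h]

lemma update_eq_self {i : ℕ} : Function.update env k i k = i := Function.update_self _ _ _

end Logic

/-! ### Exploration of neighbourhoods by iteration -/

section Search

/-- A shortest walk visits no vertex twice. -/
lemma mem_nbhd_min_card {n : ℕ} {G : SimpleGraph (Fin n)} {ℓ : ℕ} {u v : Fin n} :
    v ∈ nbhd G (min (n - 1) ℓ) u ↔ v ∈ nbhd G ℓ u := by
  classical
  refine ⟨nbhd_mono_radius (min_le_right _ _), fun h => ?_⟩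
  obtain ⟨p, hp⟩ := mem_nbhd_iff_walk.1 h
  refine mem_nbhd_iff_walk.2 ⟨p.bypass, le_min ?_ (p.length_bypass_le_length.trans hp)⟩
  have := p.bypass_isPath.length_lt
  rw [Fintype.card_fin] at this
  omega

/-- The iteration that explores a graph from a vertex computes its neighbourhoods. -/
lemma tableSeq_pos_iff {n : ℕ} {G : SimpleGraph (Fin n)} {ℓ : ℕ} {i : Fin n}
    {F : ℕ → (ℕ → ℕ) → ℕ → ℕ}
    (hF : ∀ s X (m : Fin n), 0 < F s X m ↔
      if s < ℓ + 1 then m = i ∨ ∃ m' : Fin n, 0 < X m' ∧ G.Adj m' m else 0 < X m) (m : Fin n) :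
    0 < tableSeq F n m ↔ m ∈ nbhd G ℓ i := by
  -- The first application turns the zero table into the centre alone, so `s + 1` applications reach
  -- radius `min s ℓ`. After `n` applications the radius is `min (n - 1) ℓ`, which suffices because
  -- paths have length at most `n - 1`.
  have key : ∀ s, ∀ m : Fin n, 0 < tableSeq F (s + 1) m ↔ m ∈ nbhd G (min s ℓ) i := by
    intro s
    induction s with
    | zero =>
      intro m
      rw [tableSeq, hF, if_pos (by omega), Nat.zero_min, mem_nbhd_zero]
      simp [tableSeq]
    | succ s ih =>
      intro m
      rw [tableSeq, hF]
      split_ifs with h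
      · rw [show min (s + 1) ℓ = s + 1 by omega, mem_nbhd_succ']
        simp only [ih, show min s ℓ = s by omega]
      · rw [ih, show min s ℓ = min (s + 1) ℓ by omega]
  obtain ⟨N, rfl⟩ : ∃ N, n = N + 1 := ⟨n - 1, by have := m.2; omega⟩
  rw [key N m]
  exact mem_nbhd_min_card

end Search

section Algorithm

namespace Tm

/-- Adjacency in the graph that is stored in array `c`. -/
def adj (c x y : ℕ) : Tm := .atom (.data c (.var x) (.var y))

def eqVar (x y : ℕ) : Tm := .eq (.var x) (.var y)

/-- One step of the exploration of a graph without the vertices `u` and `x`, starting at `i`. -/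
def explore (c k q u x i : ℕ) : Tm :=
  .ite (.lt (.atom (.var k)) (.atom (.succ (.data 4 (.const 0) (.const 0)))))
    (disj (eqVar (k + 1) i) (.count (conj (.atom (.tab q (k + 2))) (conj (adj c (k + 2) (k + 1))
      (conj (conj (neg (eqVar (k + 2) u)) (neg (eqVar (k + 2) x)))
        (conj (neg (eqVar (k + 1) u)) (neg (eqVar (k + 1) x))))))))
    (.atom (.tab q (k + 1)))

/-- The seed of `x` is `y`. -/
def seed (x y : ℕ) : Tm := .eq (.data 3 (.var x) (.const 0)) (.succ (.var y))

def commonSeeds (k q u v i j x y : ℕ) : Tm :=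
  .iterate (explore 1 k q u x i) (.iterate (explore 2 k (q + 1) v y j)
    (.count (.count (conj (seed k (k + 1))
      (conj (.atom (.tab q (k + 1))) (.atom (.tab (q + 1) k)))))))

/-- The comparison of `w` with its threshold. -/
def heavy (k q u v i j : ℕ) : Tm :=
  all (all (disj (eqVar k i) (disj (eqVar (k + 1) j)
    (neg (.lt (commonSeeds (k + 2) q u v i j k (k + 1))
      (.atom (.data 5 (.const 0) (.const 0))))))))

def Z (k q u v : ℕ) : Tm :=
  .countPairs (conj (adj 1 u k) (conj (adj 2 v (k + 1)) (heavy (k + 2) q u v k (k + 1))))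

def highMatch (k q v u : ℕ) : Tm :=
  conj (neg (.atom (.data 3 (.var v) (.const 0)))) (conj (all (neg (seed k u)))
    (neg (.lt (Z k q u v) (.atom (.data 6 (.const 0) (.const 0))))))

def matched (k q v u : ℕ) : Tm := disj (highMatch k q v u) (seed v u)

def lowMatch (k q v u : ℕ) : Tm :=
  conj (all (neg (matched (k + 1) q v k))) (conj (all (neg (matched (k + 1) q k u)))
    (.count (.count (conj (matched (k + 2) q (k + 1) k) (conj (adj 1 u k) (adj 2 v (k + 1)))))))

def assigned (k q v u : ℕ) : Tm := disj (matched k q v u) (lowMatch k q v u)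

def success (k q : ℕ) : Tm :=
  conj (all (all (all (disj (neg (assigned (k + 3) q k (k + 1)))
      (disj (neg (assigned (k + 3) q k (k + 2))) (eqVar (k + 1) (k + 2)))))))
    (conj (all (all (all (disj (neg (assigned (k + 3) q k (k + 2)))
        (disj (neg (assigned (k + 3) q (k + 1) (k + 2))) (eqVar k (k + 1)))))))
      (all (.count (assigned (k + 2) q k (k + 1)))))

/-- The partner of the vertex that is the value of variable `0`: on success, the number of vertices
below the vertex that is assigned to it. -/
def output : Tm :=
  .ite (success 1 0)
    (.count (.count (conj (assigned 3 0 0 2) (.lt (.atom (.var 1)) (.atom (.var 2))))))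
    (.atom (.data 7 (.var 0) (.const 0)))

variable {k q : ℕ} {s t : Tm}

lemma wf_neg : t.neg.WF k q ↔ t.WF k q := and_iff_left trivial

lemma wf_conj : (s.conj t).WF k q ↔ s.WF k q ∧ t.WF k q :=
  and_congr_right fun _ => and_iff_left trivial

lemma wf_disj : (s.disj t).WF k q ↔ s.WF k q ∧ t.WF k q :=
  and_congr_right fun _ => and_iff_right trivial

lemma wf_all : t.all.WF k q ↔ t.WF (k + 1) q := by
  unfold all
  rw [wf_neg, WF, wf_neg]

lemma wf_eqVar {x y : ℕ} (hx : x < k) (hy : y < k) : (eqVar x y).WF k q :=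
  wf_conj.2 ⟨wf_neg.2 ⟨hx, hy⟩, wf_neg.2 ⟨hy, hx⟩⟩

lemma wf_seed {x y : ℕ} (hx : x < k) (hy : y < k) : (seed x y).WF k q :=
  wf_conj.2 ⟨wf_neg.2 ⟨⟨by norm_num, hx, trivial⟩, hy⟩, wf_neg.2 ⟨hy, by norm_num, hx, trivial⟩⟩

lemma wf_adj {c x y : ℕ} (hc : c < 100) (hx : x < k) (hy : y < k) : (adj c x y).WF k q :=
  ⟨hc, hx, hy⟩

lemma wf_scalar {a : ℕ} (ha : a < 100) : (Tm.atom (.data a (.const 0) (.const 0))).WF k q :=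
  ⟨ha, trivial, trivial⟩

lemma wf_explore {c u x i : ℕ} (hc : c < 100) (hu : u < k) (hx : x < k) (hi : i < k) :
    (explore c k q u x i).WF (k + 2) (q + 1) := by
  refine ⟨⟨?_, by norm_num, trivial, trivial⟩, wf_disj.2 ⟨wf_eqVar ?_ ?_, wf_conj.2 ⟨⟨?_, ?_⟩,
    wf_conj.2 ⟨wf_adj hc ?_ ?_, wf_conj.2 ⟨wf_conj.2 ⟨wf_neg.2 (wf_eqVar ?_ ?_),
      wf_neg.2 (wf_eqVar ?_ ?_)⟩, wf_conj.2 ⟨wf_neg.2 (wf_eqVar ?_ ?_),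
        wf_neg.2 (wf_eqVar ?_ ?_)⟩⟩⟩⟩⟩, ?_, ?_⟩
  all_goals first | omega | exact Nat.lt_add_of_pos_right (by norm_num)

lemma wf_commonSeeds {u v i j x y : ℕ} (hu : u < k) (hv : v < k) (hi : i < k) (hj : j < k)
    (hx : x < k) (hy : y < k) : (commonSeeds k q u v i j x y).WF k q := by
  refine ⟨wf_explore (by norm_num) hu hx hi, wf_explore (by norm_num) hv hy hj,
    wf_conj.2 ⟨wf_seed ?_ ?_, wf_conj.2 ⟨⟨?_, ?_⟩, ?_, ?_⟩⟩⟩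
  all_goals omega

lemma wf_matched {v u : ℕ} (hv : v < k) (hu : u < k) : (matched k q v u).WF k q := by
  refine wf_disj.2 ⟨wf_conj.2 ⟨wf_neg.2 ⟨by norm_num, hv, trivial⟩, wf_conj.2
    ⟨wf_all.2 (wf_neg.2 (wf_seed ?_ ?_)), wf_neg.2 ⟨wf_conj.2 ⟨wf_adj (by norm_num) ?_ ?_,
      wf_conj.2 ⟨wf_adj (by norm_num) ?_ ?_, wf_all.2 (wf_all.2 (wf_disj.2 ⟨wf_eqVar ?_ ?_,
        wf_disj.2 ⟨wf_eqVar ?_ ?_, wf_neg.2 ⟨wf_commonSeeds ?_ ?_ ?_ ?_ ?_ ?_,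
          wf_scalar (by norm_num)⟩⟩⟩))⟩⟩, wf_scalar (by norm_num)⟩⟩⟩, wf_seed hv hu⟩
  all_goals omega

lemma wf_assigned {v u : ℕ} (hv : v < k) (hu : u < k) : (assigned k q v u).WF k q := by
  refine wf_disj.2 ⟨wf_matched hv hu, wf_conj.2 ⟨wf_all.2 (wf_neg.2 (wf_matched ?_ ?_)), wf_conj.2
    ⟨wf_all.2 (wf_neg.2 (wf_matched ?_ ?_)), wf_conj.2 ⟨wf_matched ?_ ?_, wf_conj.2
      ⟨wf_adj (by norm_num) ?_ ?_, wf_adj (by norm_num) ?_ ?_⟩⟩⟩⟩⟩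
  all_goals omega

lemma wf_success : (success k q).WF k q := by
  refine wf_conj.2 ⟨wf_all.2 (wf_all.2 (wf_all.2 (wf_disj.2 ⟨wf_neg.2 (wf_assigned ?_ ?_), wf_disj.2
    ⟨wf_neg.2 (wf_assigned ?_ ?_), wf_eqVar ?_ ?_⟩⟩))), wf_conj.2 ⟨wf_all.2 (wf_all.2 (wf_all.2
      (wf_disj.2 ⟨wf_neg.2 (wf_assigned ?_ ?_), wf_disj.2 ⟨wf_neg.2 (wf_assigned ?_ ?_),
        wf_eqVar ?_ ?_⟩⟩))), wf_all.2 (wf_assigned ?_ ?_ : Tm.WF (k + 1 + 1) q _)⟩⟩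
  all_goals omega

lemma wf_output : output.WF 1 0 :=
  ⟨wf_success, wf_conj.2 ⟨wf_assigned (by norm_num) (by norm_num), (by norm_num : 1 < 3),
    (by norm_num : 2 < 3)⟩, by norm_num, one_pos, trivial⟩

end Tm

end Algorithm

end SeededMatching

/-! ### The term computes the matching algorithm -/

namespace SeededMatching

open Finset

section Correctness

variable {n : ℕ} {I : Input n} {D : Store} {k q : ℕ} {env : ℕ → ℕ} {tab : ℕ → ℕ → ℕ}

/-- The memory holds the input, except possibly for the output array. -/
def HoldsInput (I : Input n) (D : Store) : Prop := ∀ b, b ≠ 8 → D b = encode I b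

lemma encodeGraph_pos_iff {G : SimpleGraph (Fin n)} {a b : Fin n} :
    0 < encodeGraph G a b ↔ G.Adj a b := by
  unfold encodeGraph
  split_ifs with h
  · obtain ⟨_, _, h⟩ := h
    simpa using h
  · simp only [lt_irrefl, false_iff]
    exact fun hab => h ⟨a.2, b.2, hab⟩

lemma holds_adj_one (hD : HoldsInput I D) {x y : ℕ} {a b : Fin n} (hx : env x = a)
    (hy : env y = b) : Holds D n k q env tab (.adj 1 x y) ↔ I.G₁.Adj a b := by
  rw [Tm.adj, holds_atom, Atom.val, hD 1 (by norm_num), Atom.val, Atom.val, hx, hy]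
  exact encodeGraph_pos_iff

lemma holds_adj_two (hD : HoldsInput I D) {x y : ℕ} {a b : Fin n} (hx : env x = a)
    (hy : env y = b) : Holds D n k q env tab (.adj 2 x y) ↔ I.G₂.Adj a b := by
  rw [Tm.adj, holds_atom, Atom.val, hD 2 (by norm_num), Atom.val, Atom.val, hx, hy]
  exact encodeGraph_pos_iff

lemma holds_eqVar {x y : ℕ} {a b : Fin n} (hx : env x = a) (hy : env y = b) :
    Holds D n k q env tab (.eqVar x y) ↔ a = b := by
  rw [Tm.eqVar, holds_eq, Atom.val, Atom.val, hx, hy, Fin.val_inj]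

lemma encode_seed (I : Input n) (a : Fin n) :
    encode I 3 a 0 = (I.π₀ a).elim 0 (fun m => (m : ℕ) + 1) := by
  simp [encode]

lemma holds_seed (hD : HoldsInput I D) {x y : ℕ} {a b : Fin n} (hx : env x = a)
    (hy : env y = b) : Holds D n k q env tab (.seed x y) ↔ I.π₀ a = some b := by
  rw [Tm.seed, holds_eq, Atom.val, hD 3 (by norm_num), Atom.val, Atom.val, Atom.val, Atom.val, hx,
    hy, encode_seed]
  cases I.π₀ a with
  | none => simp
  | some m => simp [Fin.val_inj]

lemma holds_explore {c : ℕ} {G : SimpleGraph (Fin n)} (hD : HoldsInput I D)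
    (hG : ∀ (env : ℕ → ℕ) (tab : ℕ → ℕ → ℕ) (k q x y : ℕ) (a b : Fin n), env x = a → env y = b →
      (Holds D n k q env tab (.adj c x y) ↔ G.Adj a b))
    {u x i : ℕ} {a b e : Fin n} (hu : u < k) (hx : x < k) (hi : i < k)
    (hua : env u = a) (hxb : env x = b) (hie : env i = e) (s : ℕ) (X : ℕ → ℕ) (m : Fin n) :
    0 < (Tm.explore c k q u x i).val D n (k + 2) (q + 1)
      (Function.update (Function.update env k s) (k + 1) m) (Function.update tab q X) ↔
      if s < I.ℓ + 1 then m = e ∨ ∃ m' : Fin n, 0 < X m' ∧ (removeVerts G {a, b}).Adj m' m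
      else 0 < X m := by
  set env' := Function.update (Function.update env k s) (k + 1) (m : ℕ) with henv'
  have hm : env' (k + 1) = m := update_eq_self
  have hs : env' k = s := update_eq_of_lt (by omega) update_eq_self
  have hlt : ∀ y < k, ∀ {z : ℕ}, env y = z → env' y = z := fun y hy z hz =>
    update_eq_of_lt (by omega) (update_eq_of_lt hy hz)
  have hℓ : D 4 0 0 = I.ℓ := by rw [hD 4 (by norm_num)]; rfl
  have hval : (Tm.lt (.atom (.var k)) (.atom (.succ (.data 4 (.const 0) (.const 0))))).val D n
      (k + 2) (q + 1) env' (Function.update tab q X) = if s < I.ℓ + 1 then 1 else 0 := by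
    simp only [Tm.val, Atom.val, hs, hℓ]
  rw [Tm.explore, Tm.val, hval]
  split_ifs with h h' h'
  · change Holds _ _ _ _ _ _ _ ↔ _
    rw [holds_disj, holds_eqVar hm (hlt i hi hie), holds_count]
    refine or_congr Iff.rfl (exists_congr fun m' => ?_)
    have hm' : Function.update env' (k + 2) (m' : ℕ) (k + 2) = m' := update_eq_self
    have hm2 : Function.update env' (k + 2) (m' : ℕ) (k + 1) = m := update_eq_of_lt (by omega) hm
    have hu' : Function.update env' (k + 2) (m' : ℕ) u = a :=
      update_eq_of_lt (by omega) (hlt u hu hua)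
    have hx' : Function.update env' (k + 2) (m' : ℕ) x = b :=
      update_eq_of_lt (by omega) (hlt x hx hxb)
    simp only [holds_conj, holds_neg, holds_eqVar hm' hu', holds_eqVar hm' hx',
      holds_eqVar hm2 hu', holds_eqVar hm2 hx', hG _ _ _ _ _ _ _ _ hm' hm2]
    rw [holds_atom, Atom.val, hm', Function.update_self]
    simp only [removeVerts, Set.mem_insert_iff, Set.mem_singleton_iff, not_or]
  · omega
  · omega
  · rw [Tm.val, Atom.val, hm, Function.update_self]

lemma sum_range_indicator (P : ℕ → Prop) [DecidablePred P] :
    (∑ i ∈ range n, if P i then 1 else 0) = Set.ncard {a : Fin n | P a} := by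
  classical
  rw [Finset.sum_range (fun i => if P i then 1 else 0), Finset.sum_boole, Nat.cast_id,
    ← Set.ncard_coe_finset]
  congr 1
  ext
  simp

lemma val_commonSeeds (hD : HoldsInput I D) {u v i j x y : ℕ} {u' v' i' j' x' y' : Fin n}
    (hu : u < k) (hv : v < k) (hi : i < k) (hj : j < k) (hx : x < k) (hy : y < k)
    (eu : env u = u') (ev : env v = v') (ei : env i = i') (ej : env j = j') (ex : env x = x')
    (ey : env y = y') :
    (Tm.commonSeeds k q u v i j x y).val D n k q env tab = I.commonSeeds u' v' i' j' x' y' := by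
  rw [Tm.commonSeeds, Tm.val]
  set X₁ := tableSeq (fun s X m => (Tm.explore 1 k q u x i).val D n (k + 2) (q + 1)
    (Function.update (Function.update env k s) (k + 1) m) (Function.update tab q X)) n with hX₁
  have h₁ : ∀ m : Fin n, 0 < X₁ m ↔ m ∈ nbhd (removeVerts I.G₁ {u', x'}) I.ℓ i' :=
    tableSeq_pos_iff (holds_explore hD (fun _ _ _ _ _ _ _ _ => holds_adj_one hD) hu hx hi eu ex ei)
  rw [Tm.val]
  set tab₁ := Function.update tab q X₁
  set X₂ := tableSeq (fun s X m => (Tm.explore 2 k (q + 1) v y j).val D n (k + 2) (q + 1 + 1)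
    (Function.update (Function.update env k s) (k + 1) m) (Function.update tab₁ (q + 1) X)) n
    with hX₂
  have h₂ : ∀ m : Fin n, 0 < X₂ m ↔ m ∈ nbhd (removeVerts I.G₂ {v', y'}) I.ℓ j' :=
    tableSeq_pos_iff (holds_explore hD (fun _ _ _ _ _ _ _ _ => holds_adj_two hD) hv hy hj ev ey ej)
  rw [Tm.val, sum_range_indicator, Input.commonSeeds]
  congr 1
  ext a
  change Holds _ _ _ _ _ _ _ ↔ _
  rw [holds_count]
  refine exists_congr fun m => ?_
  set env₁ := Function.update (Function.update env k (a : ℕ)) (k + 1) (m : ℕ)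
  have ea : env₁ k = a := update_eq_of_lt (by omega) update_eq_self
  have em : env₁ (k + 1) = m := update_eq_self
  rw [holds_conj, holds_conj, holds_seed hD ea em, holds_atom, holds_atom, Atom.val, Atom.val, ea, em,
    Function.update_self, Function.update_of_ne (by omega), ← h₁, ← h₂,
    show tab₁ q = X₁ from Function.update_self _ _ _]

/-- Adjacency makes the index set of the infimum nonempty. On an empty index set the infimum would
be `0` whereas the quantified term holds vacuously; this is why `Tm.Z` tests adjacency first. -/
lemma holds_heavy (hD : HoldsInput I D) {u v i j : ℕ} {u' v' i' j' : Fin n}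
    (hu : u < k) (hv : v < k) (hi : i < k) (hj : j < k)
    (eu : env u = u') (ev : env v = v') (ei : env i = i') (ej : env j = j')
    (hui : I.G₁.Adj u' i') (hvj : I.G₂.Adj v' j') :
    Holds D n k q env tab (.heavy k q u v i j) ↔ I.η ≤ (I.w u' v' i' j' : ℝ) := by
  have hη : D 5 0 0 = ⌈I.η⌉₊ := by rw [hD 5 (by norm_num)]; rfl
  have : Nonempty ({x : Fin n // x ≠ i'} × {y : Fin n // y ≠ j'}) :=
    ⟨⟨u', hui.ne⟩, ⟨v', hvj.ne⟩⟩
  rw [← Nat.ceil_le, Input.w, le_ciInf_iff', Tm.heavy, holds_all]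
  simp only [holds_all]
  have key : ∀ x y : Fin n, Holds D n (k + 1 + 1) q
      (Function.update (Function.update env k (x : ℕ)) (k + 1) (y : ℕ)) tab
      ((Tm.eqVar k i).disj ((Tm.eqVar (k + 1) j).disj
        ((Tm.commonSeeds (k + 2) q u v i j k (k + 1)).lt
          (.atom (.data 5 (.const 0) (.const 0)))).neg)) ↔
      (x = i' ∨ y = j' ∨ ⌈I.η⌉₊ ≤ I.commonSeeds u' v' i' j' x y) := by
    intro x y
    set env₁ := Function.update (Function.update env k (x : ℕ)) (k + 1) (y : ℕ)
    have hlt : ∀ z < k, ∀ {c : ℕ}, env z = c → env₁ z = c := fun z hz c hc =>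
      update_eq_of_lt (by omega) (update_eq_of_lt hz hc)
    have ex : env₁ k = x := update_eq_of_lt (by omega) update_eq_self
    have ey : env₁ (k + 1) = y := update_eq_self
    rw [holds_disj, holds_disj, holds_neg, holds_lt, holds_eqVar ex (hlt i hi ei),
      holds_eqVar ey (hlt j hj ej), val_commonSeeds hD (by omega) (by omega) (by omega) (by omega)
        (by omega) (by omega) (hlt u hu eu) (hlt v hv ev) (hlt i hi ei) (hlt j hj ej) ex ey, Tm.val,
      Atom.val, Atom.val, hη, not_lt]
  simp only [key]
  constructor
  · rintro h ⟨⟨x, hx⟩, ⟨y, hy⟩⟩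
    rcases h x y with h | h | h
    exacts [absurd h hx, absurd h hy, h]
  · intro h x y
    by_cases hx : x = i'
    · exact Or.inl hx
    · by_cases hy : y = j'
      · exact Or.inr (Or.inl hy)
      · exact Or.inr (Or.inr (h (⟨x, hx⟩, ⟨y, hy⟩)))

lemma val_Z (hD : HoldsInput I D) {u v : ℕ} {u' v' : Fin n} (hu : u < k) (hv : v < k)
    (eu : env u = u') (ev : env v = v') :
    (Tm.Z k q u v).val D n k q env tab = I.Z u' v' := by
  classical
  rw [Tm.Z, Tm.val, Input.Z, Finset.sum_filter, Finset.sum_range]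
  refine Finset.sum_congr rfl fun i _ => ?_
  rw [Finset.sum_filter, Finset.sum_range]
  have key : ∀ j : Fin n, Holds D n (k + 2) q
      (Function.update (Function.update env k (i : ℕ)) (k + 1) (j : ℕ)) tab
      ((Tm.adj 1 u k).conj ((Tm.adj 2 v (k + 1)).conj (Tm.heavy (k + 2) q u v k (k + 1)))) ↔
      I.G₁.Adj u' i ∧ I.G₂.Adj v' j ∧ I.η ≤ (I.w u' v' i j : ℝ) := by
    intro j
    set env₁ := Function.update (Function.update env k (i : ℕ)) (k + 1) (j : ℕ)
    have hlt : ∀ z < k, ∀ {c : ℕ}, env z = c → env₁ z = c := fun z hz c hc =>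
      update_eq_of_lt (by omega) (update_eq_of_lt hz hc)
    have ei : env₁ k = i := update_eq_of_lt (by omega) update_eq_self
    have ej : env₁ (k + 1) = j := update_eq_self
    rw [holds_conj, holds_conj, holds_adj_one hD (hlt u hu eu) ei,
      holds_adj_two hD (hlt v hv ev) ej]
    refine and_congr_right fun h1 => and_congr_right fun h2 => ?_
    exact holds_heavy hD (by omega) (by omega) (by omega) (by omega) (hlt u hu eu) (hlt v hv ev) ei
      ej h1 h2
  split_ifs with h1
  · refine Finset.sum_congr rfl fun j _ => ?_
    have := key j
    unfold Holds at this
    simp only [this, h1, true_and]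
    split_ifs <;> tauto
  · refine Finset.sum_eq_zero fun j _ => ?_
    have := key j
    unfold Holds at this
    simp only [this, h1, false_and, if_false]

lemma holds_highMatch (hD : HoldsInput I D) {v u : ℕ} {v' u' : Fin n} (hv : v < k) (hu : u < k)
    (ev : env v = v') (eu : env u = u') :
    Holds D n k q env tab (.highMatch k q v u) ↔ I.highMatch v' u' := by
  have hthr : D 6 0 0 = ⌈Input.threshold n⌉₊ := by rw [hD 6 (by norm_num)]; rfl
  rw [Tm.highMatch, holds_conj, holds_conj, holds_neg, holds_atom, holds_all, holds_neg, holds_lt,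
    val_Z hD hu hv eu ev, Input.highMatch, ← Nat.ceil_le]
  refine and_congr ?_ (and_congr (forall_congr' fun a => ?_) ?_)
  · rw [Atom.val, hD 3 (by norm_num), Atom.val, Atom.val, ev, encode_seed]
    cases I.π₀ v' <;> simp
  · rw [holds_neg, holds_seed hD update_eq_self (update_eq_of_lt hu eu)]
  · rw [Tm.val, Atom.val, Atom.val, hthr, not_lt]

lemma holds_matched (hD : HoldsInput I D) {v u : ℕ} {v' u' : Fin n} (hv : v < k) (hu : u < k)
    (ev : env v = v') (eu : env u = u') :
    Holds D n k q env tab (.matched k q v u) ↔ I.matched v' u' := by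
  rw [Tm.matched, holds_disj, holds_highMatch hD hv hu ev eu, holds_seed hD ev eu, Input.matched]

lemma holds_lowMatch (hD : HoldsInput I D) {v u : ℕ} {v' u' : Fin n} (hv : v < k) (hu : u < k)
    (ev : env v = v') (eu : env u = u') :
    Holds D n k q env tab (.lowMatch k q v u) ↔ I.lowMatch v' u' := by
  rw [Tm.lowMatch, holds_conj, holds_conj, holds_all, holds_all, holds_count, Input.lowMatch]
  refine and_congr (forall_congr' fun a => ?_) (and_congr (forall_congr' fun a => ?_)
    (exists_congr fun a => ?_))
  · rw [holds_neg, holds_matched hD (by omega) (by omega) (update_eq_of_lt hv ev) update_eq_self]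
  · rw [holds_neg, holds_matched hD (by omega) (by omega) update_eq_self (update_eq_of_lt hu eu)]
  · rw [holds_count]
    refine exists_congr fun b => ?_
    have ea : Function.update (Function.update env k (a : ℕ)) (k + 1) (b : ℕ) k = a :=
      update_eq_of_lt (by omega) update_eq_self
    rw [holds_conj, holds_conj, holds_matched hD (by omega) (by omega) update_eq_self ea,
      holds_adj_one hD (update_eq_of_lt (by omega) (update_eq_of_lt hu eu)) ea,
      holds_adj_two hD (update_eq_of_lt (by omega) (update_eq_of_lt hv ev)) update_eq_self]

lemma holds_assigned (hD : HoldsInput I D) {v u : ℕ} {v' u' : Fin n} (hv : v < k) (hu : u < k)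
    (ev : env v = v') (eu : env u = u') :
    Holds D n k q env tab (.assigned k q v u) ↔ I.assigned v' u' := by
  rw [Tm.assigned, holds_disj, holds_matched hD hv hu ev eu, holds_lowMatch hD hv hu ev eu,
    Input.assigned]

lemma holds_success (hD : HoldsInput I D) :
    Holds D n k q env tab (.success k q) ↔ I.Success := by
  rw [Tm.success, holds_conj, holds_conj, holds_all, holds_all, holds_all, Input.Success]
  simp only [holds_all]
  refine and_congr (forall_congr' fun a => forall_congr' fun b => forall_congr' fun c => ?_)
    (and_congr (forall_congr' fun a => forall_congr' fun b => forall_congr' fun c => ?_)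
    (forall_congr' fun a => ?_))
  · have ea : Function.update (Function.update (Function.update env k (a : ℕ)) (k + 1) (b : ℕ))
        (k + 1 + 1) (c : ℕ) k = a :=
      update_eq_of_lt (by omega) (update_eq_of_lt (by omega) update_eq_self)
    have eb : Function.update (Function.update (Function.update env k (a : ℕ)) (k + 1) (b : ℕ))
        (k + 1 + 1) (c : ℕ) (k + 1) = b := update_eq_of_lt (by omega) update_eq_self
    have ec : Function.update (Function.update (Function.update env k (a : ℕ)) (k + 1) (b : ℕ))
        (k + 1 + 1) (c : ℕ) (k + 2) = c := update_eq_self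
    rw [holds_disj, holds_disj, holds_neg, holds_neg, holds_assigned hD (by omega) (by omega) ea eb,
      holds_assigned hD (by omega) (by omega) ea ec, holds_eqVar eb ec]
    tauto
  · have ea : Function.update (Function.update (Function.update env k (a : ℕ)) (k + 1) (b : ℕ))
        (k + 1 + 1) (c : ℕ) k = a :=
      update_eq_of_lt (by omega) (update_eq_of_lt (by omega) update_eq_self)
    have eb : Function.update (Function.update (Function.update env k (a : ℕ)) (k + 1) (b : ℕ))
        (k + 1 + 1) (c : ℕ) (k + 1) = b := update_eq_of_lt (by omega) update_eq_self
    have ec : Function.update (Function.update (Function.update env k (a : ℕ)) (k + 1) (b : ℕ))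
        (k + 1 + 1) (c : ℕ) (k + 2) = c := update_eq_self
    rw [holds_disj, holds_disj, holds_neg, holds_neg, holds_assigned hD (by omega) (by omega) ea ec,
      holds_assigned hD (by omega) (by omega) eb ec, holds_eqVar ea eb]
    tauto
  · rw [holds_count]
    refine exists_congr fun b => ?_
    exact holds_assigned hD (by omega) (by omega) (update_eq_of_lt (by omega) update_eq_self)
      update_eq_self

/-- Without conflicts an assigned partner is unique, so the permutation selected by choice in
`Input.output` can be computed. -/
lemma Input.Success.assigned_iff {I : Input n} (h : I.Success) (v u : Fin n) :
    I.assigned v u ↔ u = I.output v := by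
  have hspec : ∀ v, I.assigned v (I.output v) := by
    rw [Input.output, dif_pos h]
    exact h.exists_perm.choose_spec
  exact ⟨fun hu => h.1 v _ _ hu (hspec v), fun hu => hu ▸ hspec v⟩

lemma val_output (hD : HoldsInput I D) (v : Fin n) (hv : env 0 = v) :
    Tm.output.val D n 1 0 env tab = I.output v := by
  classical
  rw [Tm.output, Tm.val]
  have hsucc : 0 < (Tm.success 1 0).val D n 1 0 env tab ↔ I.Success := holds_success hD
  by_cases hS : I.Success
  · rw [if_pos (hsucc.2 hS), Tm.val, sum_range_indicator]
    have : {a : Fin n | 0 < (Tm.count ((Tm.assigned 3 0 0 2).conj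
        (.lt (.atom (.var 1)) (.atom (.var 2))))).val D n (1 + 1) 0
        (Function.update env 1 (a : ℕ)) tab} = {a | a < I.output v} := by
      ext a
      change Holds _ _ _ _ _ _ _ ↔ a < I.output v
      rw [holds_count]
      have key : ∀ b : Fin n, Holds D n (1 + 1 + 1) 0
          (Function.update (Function.update env 1 (a : ℕ)) (1 + 1) (b : ℕ)) tab
          ((Tm.assigned 3 0 0 2).conj (.lt (.atom (.var 1)) (.atom (.var 2)))) ↔
          b = I.output v ∧ a < b := by
        intro b
        rw [holds_conj, holds_assigned hD (by norm_num) (by norm_num)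
          (update_eq_of_lt (by norm_num) (update_eq_of_lt (by norm_num) hv)) update_eq_self,
          hS.assigned_iff, holds_lt]
        rfl
      simp only [key]
      constructor
      · rintro ⟨b, rfl, h⟩
        exact h
      · exact fun h => ⟨_, rfl, h⟩
    rw [this, show {a | a < I.output v} = Set.Iio (I.output v) from rfl, ← Finset.coe_Iio,
      Set.ncard_coe_finset, Fin.card_Iio]
  · rw [if_neg (fun h => hS (hsucc.1 h)), Tm.val, Atom.val, hD 7 (by norm_num),
      Atom.val, Atom.val, hv, Input.output, dif_neg hS]
    simp [encode]

/-- The matching algorithm runs in polynomial time. -/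
theorem runsInPolynomialTime_output : RunsInPolynomialTime Input.output := by
  obtain ⟨K, N, hcost⟩ := (Tm.sizeBounded_tabulate (a := 8) (by norm_num) Tm.output).exists_cost_le
  refine ⟨Tm.output.tabulate 8, K * 2 ^ N, N, fun n I => ⟨fun v => ?_, ?_⟩⟩
  · refine Tm.exec_tabulate (a := 8) (n := n) (by norm_num) (by norm_num) (D := encode I) rfl
      Tm.output Tm.wf_output (f := fun i => if h : i < n then (I.output ⟨i, h⟩ : ℕ) else 0) ?_ v v.2
      |>.trans (by simp)
    intro D' hD' i hi
    rw [dif_pos hi]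
    exact val_output hD' ⟨i, hi⟩ update_eq_self
  · calc _ ≤ K * (n + 1) ^ N := hcost (encode I)
      _ ≤ K * (2 ^ N * n ^ N + 2 ^ N) := Nat.mul_le_mul_left _ (succ_pow_le n N)
      _ = _ := by ring

end Correctness

end SeededMatching

theorem theorem3 (ε : ℝ) (hε : ε < 1 / 6) (p s α : ℕ → unitInterval)
    (hp : ∀ᶠ n : ℕ in Filter.atTop, (n : ℝ) * (p n : ℝ) ≤ (n : ℝ) ^ ε)
    (hs : ∃ s₀ : ℝ, 0 < s₀ ∧ ∀ᶠ n : ℕ in Filter.atTop, s₀ ≤ (s n : ℝ))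
    (hIT : Filter.Tendsto
      (fun n : ℕ => (n : ℝ) * (p n : ℝ) * (s n : ℝ) ^ 2 - Real.log n) Filter.atTop Filter.atTop)
    (hα : ∀ᶠ n : ℕ in Filter.atTop, (n : ℝ) ^ (-1 + 3 * ε) ≤ (α n : ℝ)) :
    SeededMatching.RunsInPolynomialTime SeededMatching.Input.output ∧
    Filter.Tendsto
      (fun n : ℕ => SeededMatching.prob n (p n) (s n) (α n)
        (fun ω => (SeededMatching.observed ε (p n) (α n) ω).output = ω.latent))
      Filter.atTop (nhds 1) := by
  exact ⟨SeededMatching.runsInPolynomialTime_output,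
    SeededMatching.tendsto_prob_output hε hp hs hIT hα⟩
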